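/- Let $F$ be a $p$-adic field (a non-archimedean local field of characteristic $0$ and residue characteristic $p$) with ring of integers $\mathcal O$, maximal ideal $\mathfrak p$ and residue field $\mathbb F_q$. Let $l\neq p$ be a prime, $k=\overline{\mathbb F}_l$, $W(k)$ its ring of Witt vectors, and fix a character $\psi:F\to k^\times$ of level one (trivial on $\mathfrak p$ but not on $\mathcal O$). *Types.* For a chain order $\mathfrak A$ in $M_2(F)$ (the stabilizer of a chain of $\mathcal O$-lattices in $F^2$) with radical $\mathfrak P$ and period $e_{\mathfrak A}\in\{1,2\}$, put $U_{\mathfrak A}^m=1+\mathfrak P^m$ for $m\ge 1$. A simple stratum $(\mathfrak A,n,\alpha)$ consists of such an $\mathfrak A$, an integer $n\ge1$ and $\alpha\in\mathfrak P^{-n}$ such that either $e_{\mathfrak A}=1$ and the characteristic polynomial of $\varpi^n\alpha$ ($\varpi$ a uniformizer of $F$) is irreducible modulo $\mathfrak p$, or $e_{\mathfrak A}=2$, $n$ is odd and $\alpha\mathfrak A=\mathfrak P^{-n}$. Put $E=F[\alpha]$ and $\psi_\alpha(x)=\psi(\operatorname{tr}(\alpha(x-1)))$. Let $J\subseteq \operatorname{GL}_2(F)$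 be a subgroup and $\Lambda=\Lambda'\otimes(\phi\circ\det)$ a representation of $J$ over $k$, where $\phi:F^\times\to k^\times$ is a smooth character and one of the following holds: 1. $J=F^\times\operatorname{GL}_2(\mathcal O)$, and $\Lambda'|_{\operatorname{GL}_2(\mathcal O)}$ is inflated from an irreducible supercuspidal representation of $\operatorname{GL}_2(\mathbb F_q)$; 2. there is a simple stratum $(\mathfrak A,n,\alpha)$ with $n$ odd such that $J=E^\times U_{\mathfrak A}^{(n+1)/2}$, and $\Lambda'$ is a character of $J$ whose restriction to $U_{\mathfrak A}^{(n+1)/2}$ is $\psi_\alpha$; 3. there is a simple stratum $(\mathfrak A,n,\alpha)$ with $n$ even such that $J=E^\times U_{\mathfrak A}^{n/2}$, and $\Lambda'$ is an irreducible representation of $J$ whose restriction to $U_{\mathfrak A}^{n/2+1}$ is a multiple of $\psi_\alpha$. Here an irreducible representation of $\operatorname{GL}_2(\mathbb F_q)$, or an irreducible admissible representation of $\operatorname{GL}_2(F)$, over $k$ is called supercuspidal if it is not a subquotient of the (smooth) induction to $\operatorname{GL}_2$ of a (smooth) character of the diagonal torus extended trivially to the upper triangular Borel subgroup. *Deformations.*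 Let $A$ be a local $W(k)$-algebra of finite length, with maximal ideal $m_A$ (so $A/m_A=k$). For a representation $\sigma$ over $k$ of $H=J$ or $H=\operatorname{GL}_2(F)$, an $A$-deformation of $\sigma$ is a smooth representation $\sigma_A$ of $H$ on a free $A$-module together with an $H$-equivariant isomorphism $\sigma_A/m_A\sigma_A\cong\sigma$ over $k$. Two $A$-deformations are identified if there is an $A[H]$-isomorphism between them that is compatible with the isomorphisms to $\sigma$. **Proposition.** Let $\pi$ be an irreducible admissible supercuspidal representation of $\operatorname{GL}_2(F)$ over $k$ with an isomorphism $\operatorname{c-Ind}_J^{\operatorname{GL}_2(F)}\Lambda\cong\pi$, where $(J,\Lambda)$ is as above. Then $J$ is open in $\operatorname{GL}_2(F)$, and the map $$\Lambda_A\longmapsto \operatorname{c-Ind}_J^{\operatorname{GL}_2(F)}\Lambda_A$$ (with the isomorphism $(\operatorname{c-Ind}\Lambda_A)/m_A\cong\operatorname{c-Ind}\Lambda\cong\pi$ obtained by reducing functions pointwise) is a well-defined bijection between the set of $A$-deformations of $\Lambda$ and the set of $A$-deformations of $\pi$. -/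

import Mathlib

open ValuativeRel

universe u v

/-! ### Smooth representations, compact induction and deformations -/

section General

variable {R : Type*} [CommRing R] {G : Type*} [Group G] {M : Type*} [AddCommGroup M] [Module R M]

/-- A representation of a topological group is smooth if the stabilizer of every vector is open. -/
def IsSmoothRep [TopologicalSpace G] (ρ : Representation R G M) : Prop :=
  ∀ x : M, IsOpen {g : G | ρ g x = x}

/-- A representation is admissible if it is smooth and its space of `U`-fixed vectors is finitely
generated for every compact open subgroup `U`. -/
def IsAdmissibleRep [TopologicalSpace G] (ρ : Representation R G M) : Prop :=
  IsSmoothRep ρ ∧ ∀ U : Subgroup G, IsOpen (U : Set G) → IsCompact (U : Set G) →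
    (Representation.invariants (ρ.comp U.subtype)).FG

variable (R G M) in
/-- The action of `G` on functions `G → M` by right translation. -/
def rightTranslation : Representation R G (G → M) where
  toFun g := LinearMap.funLeft R M (fun x => x * g)
  map_one' := by ext; simp [LinearMap.funLeft]
  map_mul' _ _ := by ext; simp [LinearMap.funLeft, mul_assoc]

/-- `f : G → M` is invariant under right translation by some open subgroup. -/
def IsSmoothFun [TopologicalSpace G] (f : G → M) : Prop :=
  ∃ K : OpenSubgroup G, ∀ x : G, ∀ h ∈ K, f (x * h) = f x

/-- The space of the compactly induced representation `c-Ind_J^G ρ`: the functions `f : G → M` with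
`f (j g) = ρ(j) f(g)` that are invariant under right translation by some open subgroup and
compactly supported modulo `J`; the group `G` acts by right translation. -/
def cIndSub [TopologicalSpace G] [IsTopologicalGroup G] (J : Subgroup G)
    (ρ : Representation R J M) : Subrepresentation (rightTranslation R G M) where
  toSubmodule :=
    { carrier := {f | (∀ (j : J) (g : G), f (j * g) = ρ j (f g)) ∧ IsSmoothFun f ∧
        ∃ C : Set G, IsCompact C ∧ ∀ g, f g ≠ 0 → ∃ j : J, ∃ c ∈ C, g = j * c}
      add_mem' := by
        rintro f f' ⟨h1, ⟨K, hK⟩, C, hC, h3⟩ ⟨h1', ⟨K', hK'⟩, C', hC', h3'⟩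
        refine ⟨fun j g => by simp [h1, h1'], ⟨K ⊓ K', fun x h hh => ?_⟩, C ∪ C', hC.union hC',
          fun g hg => ?_⟩
        · obtain ⟨ha, hb⟩ := OpenSubgroup.mem_inf.mp hh
          simp [hK x h ha, hK' x h hb]
        · by_cases hf : f g = 0
          · have hf' : f' g ≠ 0 := fun h => hg (by simp [hf, h])
            obtain ⟨j, c, hc, e⟩ := h3' g hf'
            exact ⟨j, c, Or.inr hc, e⟩
          · obtain ⟨j, c, hc, e⟩ := h3 g hf
            exact ⟨j, c, Or.inl hc, e⟩
      zero_mem' := ⟨fun j g => by simp, ⟨⊤, fun _ _ _ => rfl⟩, ∅, isCompact_empty,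
        fun g hg => (hg rfl).elim⟩
      smul_mem' := by
        rintro a f ⟨h1, ⟨K, hK⟩, C, hC, h3⟩
        refine ⟨fun j g => by simp [h1], ⟨K, fun x h hh => by simp [hK x h hh]⟩, C, hC,
          fun g hg => h3 g fun h => hg (by simp [h])⟩ }
  apply_mem_toSubmodule := by
    rintro g f ⟨h1, ⟨K, hK⟩, C, hC, h3⟩
    refine ⟨fun j x => ?_, ⟨K.comap (MulAut.conj g⁻¹).toMonoidHom ?_, fun x h hh => ?_⟩,
      (fun c => c * g⁻¹) '' C, hC.image (continuous_mul_const _), fun x hx => ?_⟩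
    · simp [rightTranslation, LinearMap.funLeft, mul_assoc, h1]
    · change Continuous fun x => g⁻¹ * x * g⁻¹⁻¹
      fun_prop
    · have h2 := hK (x * g) (g⁻¹ * h * g) (by simpa using hh)
      simp only [rightTranslation, LinearMap.funLeft, MonoidHom.coe_mk, OneHom.coe_mk,
        LinearMap.coe_mk, AddHom.coe_mk, Function.comp_apply]
      rw [← h2]
      congr 1
      group
    · obtain ⟨j, c, hc, e⟩ := h3 (x * g) hx
      exact ⟨j, c * g⁻¹, ⟨c, hc, rfl⟩, by rw [← mul_assoc, ← e]; group⟩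

/-- The compactly induced representation `c-Ind_J^G ρ`. -/
def cInd [TopologicalSpace G] [IsTopologicalGroup G] (J : Subgroup G)
    (ρ : Representation R J M) : Representation R G (cIndSub J ρ).toSubmodule :=
  (cIndSub J ρ).toRepresentation

end General

section Deformations

variable (l : ℕ) [Fact l.Prime] {k : Type v} [Field k] {G : Type u} [Group G] [TopologicalSpace G]
  {V : Type u} [AddCommGroup V] [Module k V]

/-- A deformation to `A`, a local algebra over the Witt vectors `W(k)`, of a representation `π` of
`G` over `k`: a smooth representation of `G` on a free `A`-module `M`, together with a
`G`-equivariant isomorphism `M / m_A M ≅ π`, where `W(k)` acts on `π` through `W(k) → k`. -/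
structure Deformation (π : Representation k G V) (A : Type u) [CommRing A] [IsLocalRing A]
    [Algebra (WittVector l k) A] where
  carrier : Type u
  [addCommGroup : AddCommGroup carrier]
  [module : Module A carrier]
  rep : Representation A G carrier
  free : Module.Free A carrier
  smooth : IsSmoothRep rep
  red : (carrier ⧸ (IsLocalRing.maximalIdeal A • ⊤ : Submodule A carrier)) ≃+ V
  red_smul : ∀ (a : WittVector l k) (x : carrier),
    red (Submodule.Quotient.mk (algebraMap (WittVector l k) A a • x)) =
      WittVector.constantCoeff a • red (Submodule.Quotient.mk x)
  red_rep : ∀ (g : G) (x : carrier),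
    red (Submodule.Quotient.mk (rep g x)) = π g (red (Submodule.Quotient.mk x))

attribute [instance] Deformation.addCommGroup Deformation.module

namespace Deformation

variable {l} {π : Representation k G V} {A : Type u} [CommRing A] [IsLocalRing A]
  [Algebra (WittVector l k) A]

/-- Isomorphism of deformations: an isomorphism of representations over `A` that is compatible
with the given identifications of the reductions with `π`. -/
def Iso (D D' : Deformation l π A) : Prop :=
  ∃ φ : D.rep.Equiv D'.rep, ∀ x : D.carrier,
    D'.red (Submodule.Quotient.mk (φ x)) = D.red (Submodule.Quotient.mk x)

variable (l π A) in
/-- The setoid of isomorphism of deformations. -/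
def isoSetoid : Setoid (Deformation l π A) where
  r := Iso
  iseqv :=
    { refl := fun D => ⟨.refl _, fun _ => rfl⟩
      symm := by
        rintro D D' ⟨φ, h⟩
        refine ⟨φ.symm, fun x => ?_⟩
        rw [← h]
        simp
      trans := by
        rintro D D' D'' ⟨φ, h⟩ ⟨φ', h'⟩
        exact ⟨φ.trans φ', fun x => (h' (φ x)).trans (h x)⟩ }

variable (l π A) in
/-- The set of (isomorphism classes of) deformations of `π` to `A`. -/
def Classes : Type _ := Quotient (isoSetoid l π A)

end Deformation

end Deformations

/-! ### Compact induction of deformations -/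

section Cosets

variable {G : Type*} [Group G] {J : Subgroup G}

theorem mul_out_inv_mem (x : G) :
    x * (Quotient.mk (QuotientGroup.rightRel J) x).out⁻¹ ∈ J := by
  have := Quotient.mk_out (s := QuotientGroup.rightRel J) x
  exact QuotientGroup.rightRel_apply.mp this

theorem mk_mul_coset (j : J) (x : G) : Quotient.mk (QuotientGroup.rightRel J) (j * x) =
    Quotient.mk (QuotientGroup.rightRel J) x := by
  rw [Quotient.eq, QuotientGroup.rightRel_apply]
  simp

end Cosets

section OpenInduction

variable {R : Type*} [CommRing R] {G : Type*} [Group G] [TopologicalSpace G] [IsTopologicalGroup G]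
  {M : Type*} [AddCommGroup M] [Module R M] {J : Subgroup G} {ρ : Representation R J M}

theorem cInd_apply (g x : G) (f : (cIndSub J ρ).toSubmodule) :
    (cInd J ρ g f).1 x = f.1 (x * g) := rfl

theorem isSmoothRep_cInd : IsSmoothRep (cInd J ρ) := by
  intro f
  obtain ⟨-, ⟨K, hK⟩, -⟩ := f.2
  rw [isOpen_iff_mem_nhds]
  intro g hg
  have hg' : cInd J ρ g f = f := hg
  have : (fun h : G => g⁻¹ * h) ⁻¹' (K : Set G) ∈ nhds g :=
    (K.isOpen.preimage (continuous_const_mul g⁻¹)).mem_nhds (by simp)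
  refine Filter.mem_of_superset this fun h hh => ?_
  have hk : cInd J ρ (g⁻¹ * h) f = f := Subtype.ext (funext fun x => hK x _ hh)
  change cInd J ρ h f = f
  have : h = g * (g⁻¹ * h) := by group
  rw [this, map_mul, Module.End.mul_apply, hk, hg']

theorem finite_support_out (hJ : IsOpen (J : Set G)) (f : (cIndSub J ρ).toSubmodule) :
    (Function.support fun c : Quotient (QuotientGroup.rightRel J) => f.1 c.out).Finite := by
  obtain ⟨-, -, C, hC, h3⟩ := f.2
  have hopen : ∀ c : Quotient (QuotientGroup.rightRel J),
      IsOpen {x : G | Quotient.mk (QuotientGroup.rightRel J) x = c} := by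
    intro c
    have : {x : G | Quotient.mk (QuotientGroup.rightRel J) x = c} =
        (fun x => c.out * x⁻¹) ⁻¹' (J : Set G) := by
      ext x
      conv_lhs => rw [Set.mem_ofPred_eq, ← Quotient.out_eq c]
      rw [Quotient.eq, QuotientGroup.rightRel_apply]
      rfl
    rw [this]
    exact hJ.preimage (by fun_prop)
  obtain ⟨t, ht⟩ := hC.elim_finite_subcover _ hopen fun x _ => Set.mem_iUnion.mpr ⟨_, rfl⟩
  refine t.finite_toSet.subset fun c hc => ?_
  obtain ⟨j, x, hx, e⟩ := h3 _ hc
  obtain ⟨c', hc', hxc⟩ := Set.mem_iUnion₂.mp (ht hx)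
  have h1 : Quotient.mk (QuotientGroup.rightRel J) x = c := by
    conv_rhs => rw [← Quotient.out_eq c]
    rw [Quotient.eq, QuotientGroup.rightRel_apply, e]
    simp
  have h2 : c = c' := h1.symm.trans hxc
  rw [h2]
  exact hc'

theorem isSmoothFun_of_values (hJ : IsOpen (J : Set G)) (hρ : IsSmoothRep ρ)
    (h : Quotient (QuotientGroup.rightRel J) →₀ M) :
    IsSmoothFun fun x : G => ρ ⟨_, mul_out_inv_mem x⟩ (h (Quotient.mk _ x)) := by
  classical
  induction h using Finsupp.induction_linear with
  | zero => exact ⟨⊤, fun x k _ => by simp⟩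
  | add f g hf hg =>
    obtain ⟨K, hK⟩ := hf
    obtain ⟨K', hK'⟩ := hg
    refine ⟨K ⊓ K', fun x k hk => ?_⟩
    obtain ⟨ha, hb⟩ := OpenSubgroup.mem_inf.mp hk
    have h1 := hK x k ha
    have h2 := hK' x k hb
    simp only [Finsupp.add_apply, map_add] at h1 h2 ⊢
    rw [h1, h2]
  | single c m =>
    let S : Subgroup J :=
      { carrier := {j | ρ j m = m}
        one_mem' := by simp
        mul_mem' := fun {a b} ha hb => by
          rw [Set.mem_ofPred_eq] at ha hb ⊢
          rw [map_mul, Module.End.mul_apply, hb, ha]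
        inv_mem' := fun {a} ha => by
          rw [Set.mem_ofPred_eq] at ha ⊢
          conv_lhs => rw [← ha, ← Module.End.mul_apply, ← map_mul]
          simp }
    have hS : IsOpen ((S.map J.subtype : Subgroup G) : Set G) := by
      rw [Subgroup.coe_map]
      exact hJ.isOpenMap_subtype_val _ (hρ m)
    let K : OpenSubgroup G := OpenSubgroup.comap (MulAut.conj c.out).toMonoidHom
      (by change Continuous fun x => c.out * x * c.out⁻¹; fun_prop) ⟨S.map J.subtype, hS⟩
    refine ⟨K, fun x k hk => ?_⟩
    obtain ⟨j, hj, e⟩ : ∃ j ∈ S, (j : G) = c.out * k * c.out⁻¹ := hk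
    have hj' : ρ j m = m := hj
    have hiff : ∀ y : G, Quotient.mk (QuotientGroup.rightRel J) y = c ↔ y * c.out⁻¹ ∈ J := by
      intro y
      conv_lhs => rw [← Quotient.out_eq c]
      rw [eq_comm, Quotient.eq, QuotientGroup.rightRel_apply]
    have hxk : x * k * c.out⁻¹ = x * c.out⁻¹ * j := by rw [e]; group
    by_cases hx : Quotient.mk (QuotientGroup.rightRel J) x = c
    · have hx' : Quotient.mk (QuotientGroup.rightRel J) (x * k) = c := by
        rw [hiff, hxk]
        exact J.mul_mem ((hiff x).mp hx) j.2
      have e2 : (⟨_, mul_out_inv_mem (x * k)⟩ : J) = ⟨_, mul_out_inv_mem x⟩ * j := by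
        ext
        simp only [hx, hx', Subgroup.coe_mul, hxk]
      beta_reduce
      rw [e2, map_mul, Module.End.mul_apply]
      simp [hx, hx', hj']
    · have hx' : Quotient.mk (QuotientGroup.rightRel J) (x * k) ≠ c := by
        rw [ne_eq, hiff, hxk, J.mul_mem_cancel_right j.2, ← hiff]
        exact hx
      simp [Ne.symm hx, Ne.symm hx']

/-- The element of the compactly induced representation with prescribed values on a set of
representatives of `J \ G`. -/
noncomputable def cIndOfValues (hJ : IsOpen (J : Set G)) (hρ : IsSmoothRep ρ)
    (h : Quotient (QuotientGroup.rightRel J) →₀ M) : (cIndSub J ρ).toSubmodule :=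
  ⟨fun x => ρ ⟨_, mul_out_inv_mem x⟩ (h (Quotient.mk _ x)), by
    refine ⟨fun j x => ?_, ?_, (fun c => c.out) '' (h.support : Set (Quotient (QuotientGroup.rightRel J))),
      (h.support.finite_toSet.image _).isCompact, fun x hx => ?_⟩
    · rw [← Module.End.mul_apply, ← map_mul]
      simp only [mk_mul_coset]
      congr 2
      ext
      simp [mul_assoc]
    · exact isSmoothFun_of_values hJ hρ h
    · refine ⟨⟨_, mul_out_inv_mem x⟩, _, ⟨Quotient.mk _ x, ?_, rfl⟩, by simp⟩
      rw [Finset.mem_coe, Finsupp.mem_support_iff]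
      intro h0
      exact hx (by simp [h0])⟩

theorem cInd_eq_of_out (f f' : (cIndSub J ρ).toSubmodule)
    (h : ∀ c : Quotient (QuotientGroup.rightRel J), f.1 c.out = f'.1 c.out) : f = f' := by
  refine Subtype.ext (funext fun x => ?_)
  have e : x = (⟨_, mul_out_inv_mem x⟩ : J) * (Quotient.mk (QuotientGroup.rightRel J) x).out := by
    simp
  rw [e, f.2.1, f'.2.1, h]

theorem cIndOfValues_out (hJ : IsOpen (J : Set G)) (hρ : IsSmoothRep ρ)
    (h : Quotient (QuotientGroup.rightRel J) →₀ M) (c : Quotient (QuotientGroup.rightRel J)) :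
    (cIndOfValues hJ hρ h).1 c.out = h c := by
  have e : (⟨_, mul_out_inv_mem c.out⟩ : J) = 1 := by
    ext
    simp
  change ρ ⟨_, mul_out_inv_mem c.out⟩ (h (Quotient.mk _ c.out)) = h c
  rw [e, Quotient.out_eq]
  simp

/-- An element of the compactly induced representation is determined by its values on a set of
representatives of `J \ G`, which can be prescribed freely. -/
noncomputable def cIndEquiv (hJ : IsOpen (J : Set G)) (hρ : IsSmoothRep ρ) :
    (Quotient (QuotientGroup.rightRel J) →₀ M) ≃ₗ[R] (cIndSub J ρ).toSubmodule where
  toFun := cIndOfValues hJ hρ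
  map_add' h h' := cInd_eq_of_out _ _ fun c => by
    simp [cIndOfValues_out]
  map_smul' a h := cInd_eq_of_out _ _ fun c => by
    simp [cIndOfValues_out]
  invFun f := Finsupp.ofSupportFinite (fun c => f.1 c.out) (finite_support_out hJ f)
  left_inv h := Finsupp.ext fun c => cIndOfValues_out hJ hρ h c
  right_inv f := cInd_eq_of_out _ _ fun c => cIndOfValues_out hJ hρ _ c

theorem cInd_mem_smul_top (hJ : IsOpen (J : Set G)) (hρ : IsSmoothRep ρ) (I : Ideal R)
    (f : (cIndSub J ρ).toSubmodule) :
    f ∈ (I • ⊤ : Submodule R (cIndSub J ρ).toSubmodule) ↔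
      ∀ x, f.1 x ∈ (I • ⊤ : Submodule R M) := by
  constructor
  · intro hf x
    have := Submodule.mem_map_of_mem
      (f := LinearMap.proj x ∘ₗ (cIndSub J ρ).toSubmodule.subtype) hf
    rw [Submodule.map_smul''] at this
    exact Submodule.smul_mono (le_refl I) le_top this
  · intro hf
    obtain ⟨h, rfl⟩ := (cIndEquiv hJ hρ).surjective f
    have hh : ∀ c, h c ∈ (I • ⊤ : Submodule R M) := fun c => by
      have := hf c.out
      change (cIndOfValues hJ hρ h).1 c.out ∈ _ at this
      rwa [cIndOfValues_out] at this
    rw [← Finsupp.sum_single h, Finsupp.sum, map_sum]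
    refine Submodule.sum_mem _ fun c _ => ?_
    have := Submodule.mem_map_of_mem
      (f := (cIndEquiv hJ hρ).toLinearMap ∘ₗ Finsupp.lsingle c) (hh c)
    rw [Submodule.map_smul''] at this
    exact Submodule.smul_mono (le_refl I) le_top this

/-- Composition of an element of a compactly induced representation with an intertwining map. -/
def cIndPost {M' : Type*} [AddCommGroup M'] [Module R M'] {ρ' : Representation R J M'}
    (φ : ρ.IntertwiningMap ρ') (f : (cIndSub J ρ).toSubmodule) : (cIndSub J ρ').toSubmodule :=
  ⟨fun x => φ (f.1 x), by
    obtain ⟨h1, ⟨K, hK⟩, C, hC, h3⟩ := f.2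
    refine ⟨fun j g => ?_, ⟨K, fun x h hh => by beta_reduce; rw [hK x h hh]⟩, C, hC,
      fun g hg => h3 g ?_⟩
    · beta_reduce
      rw [h1]
      exact Representation.IntertwiningMap.isIntertwining ρ ρ' φ j _
    · intro h0
      exact hg (by simp [h0])⟩

/-- Compact induction of an isomorphism of representations. -/
def cIndCongr {M' : Type*} [AddCommGroup M'] [Module R M'] {ρ' : Representation R J M'}
    (φ : ρ.Equiv ρ') : (cInd J ρ).Equiv (cInd J ρ') :=
  Representation.Equiv.mk
    { toFun := cIndPost φ.toIntertwiningMap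
      map_add' := fun f f' => by ext; simp [cIndPost]
      map_smul' := fun a f => by ext; simp [cIndPost]
      invFun := cIndPost φ.symm.toIntertwiningMap
      left_inv := fun f => by ext; simp [cIndPost]
      right_inv := fun f => by ext; simp [cIndPost] }
    fun g => rfl

end OpenInduction

namespace Deformation

variable {l : ℕ} [Fact l.Prime] {k : Type v} [Field k] {G : Type u} [Group G] [TopologicalSpace G]
  [IsTopologicalGroup G] {J : Subgroup G}
  {V : Type u} [AddCommGroup V] [Module k V] {Λ : Representation k J V}
  {W : Type u} [AddCommGroup W] [Module k W] {π : Representation k G W}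
  {A : Type u} [CommRing A] [IsLocalRing A] [Algebra (WittVector l k) A]

theorem red_mk_eq_zero_iff {H : Type u} [Group H] [TopologicalSpace H]
    {σ : Representation k H V} (D : Deformation l σ A) (x : D.carrier) :
    D.red (Submodule.Quotient.mk x) = 0 ↔
      x ∈ (IsLocalRing.maximalIdeal A • ⊤ : Submodule A D.carrier) := by
  rw [map_eq_zero_iff D.red D.red.injective, Submodule.Quotient.mk_eq_zero]

/-- Pointwise reduction `c-Ind_J^G Λ_A → c-Ind_J^G Λ`. -/
def cIndRed (D : Deformation l Λ A) :
    (cIndSub J D.rep).toSubmodule →+ (cIndSub J Λ).toSubmodule where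
  toFun f := ⟨fun x => D.red (Submodule.Quotient.mk (f.1 x)), by
    obtain ⟨h1, ⟨K, hK⟩, C, hC, h3⟩ := f.2
    refine ⟨fun j g => ?_, ⟨K, fun x h hh => by beta_reduce; rw [hK x h hh]⟩, C, hC, fun g hg => h3 g ?_⟩
    · beta_reduce
      rw [h1, D.red_rep]
    · intro h0
      exact hg (by simp [h0])⟩
  map_zero' := by
    ext x
    simp
  map_add' f f' := by
    ext x
    simp

theorem cIndRed_surjective (hJ : IsOpen (J : Set G)) (D : Deformation l Λ A) :
    Function.Surjective D.cIndRed := by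
  intro f
  have hr : Function.Surjective
      fun x : D.carrier => D.red (Submodule.Quotient.mk x) :=
    D.red.surjective.comp (Submodule.Quotient.mk_surjective _)
  obtain ⟨h, hh⟩ := Finsupp.mapRange_surjective (α := Quotient (QuotientGroup.rightRel J))
    _ (by simp) hr (Finsupp.ofSupportFinite (fun c => f.1 c.out) (finite_support_out hJ f))
  refine ⟨cIndOfValues hJ D.smooth h, cInd_eq_of_out _ _ fun c => ?_⟩
  change D.red (Submodule.Quotient.mk ((cIndOfValues hJ D.smooth h).1 c.out)) = f.1 c.out
  rw [cIndOfValues_out]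
  exact DFunLike.congr_fun hh c

theorem cIndRed_ker (hJ : IsOpen (J : Set G)) (D : Deformation l Λ A)
    (f : (cIndSub J D.rep).toSubmodule) :
    D.cIndRed f = 0 ↔ f ∈
      (IsLocalRing.maximalIdeal A • ⊤ : Submodule A (cIndSub J D.rep).toSubmodule) := by
  rw [cInd_mem_smul_top hJ D.smooth, Subtype.ext_iff, funext_iff]
  exact forall_congr' fun x => D.red_mk_eq_zero_iff _

/-- The isomorphism `(c-Ind_J^G Λ_A) / m_A ≅ c-Ind_J^G Λ` induced by pointwise reduction. -/
noncomputable def cIndRedEquiv (hJ : IsOpen (J : Set G)) (D : Deformation l Λ A) :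
    ((cIndSub J D.rep).toSubmodule ⧸
      (IsLocalRing.maximalIdeal A • ⊤ : Submodule A (cIndSub J D.rep).toSubmodule)) ≃+
      (cIndSub J Λ).toSubmodule :=
  (QuotientAddGroup.quotientAddEquivOfEq (by
    ext f
    exact (D.cIndRed_ker hJ f).symm)).trans
  (QuotientAddGroup.quotientKerEquivOfSurjective D.cIndRed (D.cIndRed_surjective hJ))

theorem cIndRedEquiv_mk (hJ : IsOpen (J : Set G)) (D : Deformation l Λ A)
    (f : (cIndSub J D.rep).toSubmodule) :
    D.cIndRedEquiv hJ (Submodule.Quotient.mk f) = D.cIndRed f := rfl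

/-- If `π ≅ c-Ind_J^G Λ` with `J` open and `Λ_A` is a deformation of `Λ`, then `c-Ind_J^G Λ_A`,
with pointwise reduction, is a deformation of `π`. -/
noncomputable def cInd (hJ : IsOpen (J : Set G)) (θ : (_root_.cInd J Λ).Equiv π)
    (D : Deformation l Λ A) : Deformation l π A where
  carrier := (cIndSub J D.rep).toSubmodule
  rep := _root_.cInd J D.rep
  free :=
    haveI := D.free
    Module.Free.of_equiv (cIndEquiv hJ D.smooth)
  smooth := isSmoothRep_cInd
  red := (D.cIndRedEquiv hJ).trans θ.toLinearEquiv.toAddEquiv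
  red_smul a f := by
    change θ (D.cIndRed _) = _ • θ (D.cIndRed _)
    rw [← map_smul]
    congr 1
    refine Subtype.ext (funext fun x => ?_)
    exact D.red_smul a (f.1 x)
  red_rep g f := by
    change θ (D.cIndRed _) = π g (θ (D.cIndRed _))
    have h1 : D.cIndRed (_root_.cInd J D.rep g f) = _root_.cInd J Λ g (D.cIndRed f) := rfl
    refine (congrArg θ h1).trans ?_
    exact Representation.IntertwiningMap.isIntertwining _ _ θ.toIntertwiningMap g _

theorem cInd_iso (hJ : IsOpen (J : Set G)) (θ : (_root_.cInd J Λ).Equiv π)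
    (D D' : Deformation l Λ A) (h : D.Iso D') : (D.cInd hJ θ).Iso (D'.cInd hJ θ) := by
  obtain ⟨φ, hφ⟩ := h
  refine ⟨cIndCongr φ, fun f => ?_⟩
  exact congrArg θ (Subtype.ext (funext fun x => hφ (f.1 x)))

/-- The map `Λ_A ↦ c-Ind_J^G Λ_A` on isomorphism classes of deformations. -/
noncomputable def cIndClasses (hJ : IsOpen (J : Set G)) (θ : (_root_.cInd J Λ).Equiv π) :
    Classes l Λ A → Classes l π A :=
  Quotient.map (fun D => D.cInd hJ θ) fun D D' h => cInd_iso hJ θ D D' h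

end Deformation

/-! ### Supercuspidal representations of `GL₂` -/

section Supercuspidal

variable {k : Type*} [Field k]

/-- `π` is a quotient of a subrepresentation, contained in `S`, of the space of functions
`G → k` with the action of `G` by right translation. -/
def IsSubquotientOfFunctions {G : Type*} [Group G] {V : Type*} [AddCommGroup V] [Module k V]
    (π : Representation k G V) (S : Set (G → k)) : Prop :=
  ∃ N : Subrepresentation (rightTranslation k G k), (N.toSubmodule : Set (G → k)) ⊆ S ∧
    ∃ f : N.toRepresentation.IntertwiningMap π, Function.Surjective f

/-- The functions `f` on `GL₂(K)` with `f (t g) = χ₁(a) χ₂(d) f(g)` for all upper triangular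
matrices `t` with diagonal entries `a`, `d`. -/
def borelFunctions {K : Type*} [Field K] (χ₁ χ₂ : Kˣ →* kˣ) : Set (GL (Fin 2) K → k) :=
  {f | ∀ (a d : Kˣ) (b : K) (t g : GL (Fin 2) K),
    (t : Matrix (Fin 2) (Fin 2) K) = !![(a : K), b; 0, (d : K)] →
      f (t * g) = (χ₁ a : k) * (χ₂ d : k) * f g}

/-- Irreducible supercuspidal representations of `GL₂` of a finite field: the irreducible
representations that are not a subquotient of any representation induced from a character of the
upper triangular subgroup. -/
def IsFiniteSupercuspidal {K : Type*} [Field K] {V : Type*} [AddCommGroup V] [Module k V]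
    (π : Representation k (GL (Fin 2) K) V) : Prop :=
  π.IsIrreducible ∧ ∀ χ₁ χ₂ : Kˣ →* kˣ, ¬ IsSubquotientOfFunctions π (borelFunctions χ₁ χ₂)

/-- A character of `Fˣ` is smooth if its kernel is open. -/
def IsSmoothChar {F : Type*} [Field F] [TopologicalSpace F] (χ : Fˣ →* kˣ) : Prop :=
  IsOpen (χ.ker : Set Fˣ)

/-- Irreducible (admissible) supercuspidal representations of `GL₂(F)`: the irreducible admissible
representations that are not a subquotient of the smooth parabolic induction of any smooth
character of the diagonal torus. -/
def IsSupercuspidal {F : Type*} [Field F] [TopologicalSpace F] {V : Type*} [AddCommGroup V]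
    [Module k V] (π : Representation k (GL (Fin 2) F) V) : Prop :=
  π.IsIrreducible ∧ IsAdmissibleRep π ∧ ∀ χ₁ χ₂ : Fˣ →* kˣ, IsSmoothChar χ₁ → IsSmoothChar χ₂ →
    ¬ IsSubquotientOfFunctions π {f | f ∈ borelFunctions χ₁ χ₂ ∧ IsSmoothFun f}

end Supercuspidal

/-! ### Lattice chains, strata and types in `GL₂(F)` -/

section Strata

variable (F : Type u) [Field F] [ValuativeRel F] [TopologicalSpace F]
  [IsNonarchimedeanLocalField F]

/-- A chain `⋯ ⊋ L₀ ⊋ L₁ ⊋ ⋯` of `𝒪`-lattices in `F²` with `L_{i+e} = 𝔪 L_i`; here `e ≥ 1` is the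
period. The stabilizers `{x ∈ M₂(F) | x L_i ⊆ L_i for all i}` of such chains are the chain orders
`𝔄` in `M₂(F)`, with ramification index `e_𝔄 = e`. -/
structure LatticeChain where
  lattice : ℤ → Submodule 𝒪[F] (Fin 2 → F)
  fg : ∀ i, (lattice i).FG
  span_eq_top : ∀ i, Submodule.span F (lattice i : Set (Fin 2 → F)) = ⊤
  strictAnti : StrictAnti lattice
  period : ℕ
  period_pos : 0 < period
  lattice_add_period : ∀ i, lattice (i + period) = 𝓂[F] • lattice i

variable {F}

namespace LatticeChain

variable (L : LatticeChain F)

/-- The power `𝔓^m`, `m ∈ ℤ`, of the Jacobson radical `𝔓` of the chain order `𝔄` of `L`: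
the matrices `x` with `x L_i ⊆ L_{i+m}` for all `i`. In particular `𝔓^0 = 𝔄`. -/
def radPow (m : ℤ) : AddSubgroup (Matrix (Fin 2) (Fin 2) F) where
  carrier := {x | ∀ i, ∀ v ∈ L.lattice i, x.mulVec v ∈ L.lattice (i + m)}
  zero_mem' i v _ := by simp
  add_mem' hx hy i v hv := by
    rw [Matrix.add_mulVec]
    exact add_mem (hx i v hv) (hy i v hv)
  neg_mem' hx i v hv := by
    rw [Matrix.neg_mulVec]
    exact neg_mem (hx i v hv)

theorem mul_sub_one_mem (m : ℕ) {x y : Matrix (Fin 2) (Fin 2) F} (hx : x - 1 ∈ L.radPow m)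
    (hy : y - 1 ∈ L.radPow m) : x * y - 1 ∈ L.radPow m := by
  have h : x * y - 1 = (x - 1) * (y - 1) + ((x - 1) + (y - 1)) := by noncomm_ring
  rw [h]
  refine add_mem (fun i v hv => ?_) (add_mem hx hy)
  rw [← Matrix.mulVec_mulVec]
  exact hx i _ (L.strictAnti.antitone (by simp) (hy i v hv))

/-- The group `U_𝔄^m` for `m ≥ 0`: the unit group `𝔄ˣ` for `m = 0`, and `1 + 𝔓^m` for `m ≥ 1`. -/
def unitGroup (m : ℕ) : Subgroup (GL (Fin 2) F) where
  carrier := {g | (g : Matrix (Fin 2) (Fin 2) F) - 1 ∈ L.radPow m ∧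
    ((g⁻¹ : GL (Fin 2) F) : Matrix (Fin 2) (Fin 2) F) - 1 ∈ L.radPow m}
  one_mem' := by simp [zero_mem]
  mul_mem' := by
    rintro g h ⟨h1, h2⟩ ⟨h3, h4⟩
    refine ⟨?_, ?_⟩
    · rw [Units.val_mul]
      exact L.mul_sub_one_mem m h1 h3
    · rw [mul_inv_rev, Units.val_mul]
      exact L.mul_sub_one_mem m h4 h2
  inv_mem' := by
    rintro g ⟨h1, h2⟩
    exact ⟨h2, by simpa using h1⟩

/-- `(𝔄, n, α)` is a simple stratum, where `𝔄` is the chain order of `L`: we have `n ≥ 1`,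
`α ∈ 𝔓^{-n}`, and
* (unramified case) `e_𝔄 = 1` and the characteristic polynomial of `ϖ^n α`, which has coefficients
  in `𝒪`, is irreducible modulo `𝔪`, or
* (ramified case) `e_𝔄 = 2`, `n` is odd and `α 𝔄 = 𝔓^{-n}` (that is, `α` is invertible and
  `α⁻¹ ∈ 𝔓^n`). -/
def IsSimpleStratum (n : ℕ) (α : Matrix (Fin 2) (Fin 2) F) : Prop :=
  1 ≤ n ∧ α ∈ L.radPow (-n) ∧
    ((L.period = 1 ∧ ∃ ϖ : 𝒪[F], Irreducible ϖ ∧ ∃ f : Polynomial 𝒪[F],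
        f.map (algebraMap 𝒪[F] F) = ((ϖ : F) ^ n • α).charpoly ∧
        Irreducible (f.map (IsLocalRing.residue 𝒪[F]))) ∨
      (L.period = 2 ∧ Odd n ∧ ∃ β ∈ L.radPow n, α * β = 1))

end LatticeChain

/-- The multiplicative group of `E = F[α]`, as a subgroup of `GL₂(F)`. -/
def unitsAdjoin (α : Matrix (Fin 2) (Fin 2) F) : Subgroup (GL (Fin 2) F) :=
  (Algebra.adjoin F {α}).toSubmonoid.units

/-- The subgroup `Fˣ GL₂(𝒪)` of `GL₂(F)`. -/
noncomputable def centerMulGLInteger : Subgroup (GL (Fin 2) F) :=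
  Subgroup.center (GL (Fin 2) F) ⊔
    (Matrix.GeneralLinearGroup.map (n := Fin 2) (algebraMap 𝒪[F] F)).range

variable {k : Type v} [Field k]

/-- An additive character of `F` of level one: it is trivial on `𝔪` but not on `𝒪`. -/
def IsLevelOne (ψ : AddChar F k) : Prop :=
  (∀ x : 𝒪[F], x ∈ 𝓂[F] → ψ x = 1) ∧ ∃ x : 𝒪[F], ψ x ≠ 1

variable {V : Type u} [AddCommGroup V] [Module k V] {J : Subgroup (GL (Fin 2) F)}

/-- The group `U` acts through a multiple of the character `ψ_α : u ↦ ψ (tr (α (u - 1)))`. -/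
def ActsByPsi (ψ : AddChar F k) (α : Matrix (Fin 2) (Fin 2) F) (U : Subgroup (GL (Fin 2) F))
    (Λ : Representation k J V) : Prop :=
  ∀ u : J, (u : GL (Fin 2) F) ∈ U → ∀ x : V,
    Λ u x = ψ (α * (((u : GL (Fin 2) F) : Matrix (Fin 2) (Fin 2) F) - 1)).trace • x

/-- `J = Fˣ GL₂(𝒪)` and the restriction of `Λ` to `GL₂(𝒪)` is inflated from an irreducible
supercuspidal representation of `GL₂` of the residue field. -/
def IsDepthZeroType (Λ : Representation k J V) : Prop :=
  J = centerMulGLInteger ∧ ∃ σ : Representation k (GL (Fin 2) 𝓀[F]) V,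
    IsFiniteSupercuspidal σ ∧ ∀ (x : GL (Fin 2) 𝒪[F])
      (hx : Matrix.GeneralLinearGroup.map (algebraMap 𝒪[F] F) x ∈ J),
      Λ ⟨_, hx⟩ = σ (Matrix.GeneralLinearGroup.map (IsLocalRing.residue 𝒪[F]) x)

/-- For a simple stratum `(𝔄, n, α)` with `n` odd and `E = F[α]`: `J = Eˣ U_𝔄^{(n+1)/2}` and `Λ` is
a character whose restriction to `U_𝔄^{(n+1)/2}` is `ψ_α`. -/
def IsOddType (ψ : AddChar F k) (Λ : Representation k J V) : Prop :=
  ∃ (L : LatticeChain F) (n : ℕ) (α : Matrix (Fin 2) (Fin 2) F), L.IsSimpleStratum n α ∧ Odd n ∧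
    J = unitsAdjoin α ⊔ L.unitGroup ((n + 1) / 2) ∧
    Module.finrank k V = 1 ∧ ActsByPsi ψ α (L.unitGroup ((n + 1) / 2)) Λ

/-- For a simple stratum `(𝔄, n, α)` with `n` even and `E = F[α]`: `J = Eˣ U_𝔄^{n/2}` and `Λ` is
an irreducible representation whose restriction to `U_𝔄^{n/2+1}` is a multiple of `ψ_α`. -/
def IsEvenType (ψ : AddChar F k) (Λ : Representation k J V) : Prop :=
  ∃ (L : LatticeChain F) (n : ℕ) (α : Matrix (Fin 2) (Fin 2) F), L.IsSimpleStratum n α ∧ Even n ∧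
    J = unitsAdjoin α ⊔ L.unitGroup (n / 2) ∧
    Λ.IsIrreducible ∧ ActsByPsi ψ α (L.unitGroup (n / 2 + 1)) Λ

/-- `Λ = Λ' ⊗ (φ ∘ det)` for a smooth character `φ` of `Fˣ` and a representation `Λ'` of `J` of one
of the three preceding kinds. -/
def IsTwistedType (ψ : AddChar F k) (Λ : Representation k J V) : Prop :=
  ∃ (φ : Fˣ →* kˣ) (Λ' : Representation k J V), IsSmoothChar φ ∧
    (∀ (j : J) (x : V),
      Λ j x = (φ (Matrix.GeneralLinearGroup.det (j : GL (Fin 2) F)) : k) • Λ' j x) ∧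
    (IsDepthZeroType Λ' ∨ IsOddType ψ Λ' ∨ IsEvenType ψ Λ')

end Strata

/-! The group `J` contains an open normal subgroup `H`, one of the pro-`p` groups `U_𝔄^m` with `m ≥
1`, that acts on `Λ` through a character `χ`. Two facts about `H` give the bijection.

Prime-to-`l` order: all indices of open subgroups in `H` are powers of `p`, hence units in `A`.
Averaging over `H` therefore projects any smooth `A`-representation onto its isotypic part for a
character of `H`, compatibly with reduction modulo `m_A`.

Intertwining: if `g ∉ J`, no nonzero `v` in `Λ` satisfies `Λ(g h g⁻¹) v = χ(h) v` for all `h ∈ H`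
with `g h g⁻¹ ∈ J`. Hence a `χ`-isotypic function in `c-Ind Λ` is supported on `J`, and the
`χ`-isotypic part of `c-Ind Λ` is a copy of `Λ`.

Surjectivity (`exists_cInd_iso`): in a deformation `E` of `π`, let `P` be the isotypic part for the
Teichmüller lift of `χ`. By averaging, `P` is free and reduces to `Λ`. Frobenius reciprocity gives a
map `c-Ind P → E` that is an isomorphism modulo `m_A`, hence an isomorphism because `m_A` is
nilpotent. Injectivity (`cIndClasses_injective`) is formal: an isomorphism of induced deformations
is compressed to `J` by extending vectors by zero and evaluating at `1`.

For a simple stratum, `H = U^{[n/2]+1}` and `χ` is `ψ_α` up to the twist. Trace duality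
(`exists_eq_add_conj`) turns intertwining by `g` into a conjugacy between two elements of `α +
𝔓^{-[n/2]}`. Scaled elements of this coset determine the lattice chain (`Generates`), so `g`
permutes the chain; approximating by elements of `F[α]` then puts `g` in `Eˣ U^{[(n+1)/2]} = J`
(`mem_of_intertwines`).

In depth zero, `H` is the first congruence subgroup. For `g ∉ J`, the reduction of `g H g⁻¹ ∩
GL₂(𝒪)` contains the unipotent radical of a Borel subgroup, which fixes no nonzero vector of a
supercuspidal representation (`eq_zero_of_fixed`). -/

/-! ### Nakayama's lemma for a nilpotent ideal, and free modules -/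

section Nilpotent

variable {A : Type*} [CommRing A] {I : Ideal A} {M N : Type*} [AddCommGroup M] [Module A M]
  [AddCommGroup N] [Module A N]

/-- Nilpotence replaces the finiteness hypothesis of Nakayama's lemma, which the spaces of
`GL₂(F)`-representations need not satisfy: the relation is iterated until the power of `I` vanishes.
-/
theorem Submodule.eq_top_of_sup_smul_of_isNilpotent (hI : IsNilpotent I) (P : Submodule A M)
    (h : P ⊔ I • ⊤ = ⊤) : P = ⊤ := by
  have key : ∀ n : ℕ, P ⊔ I ^ n • ⊤ = ⊤ := by
    intro n
    induction n with
    | zero => simp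
    | succ n ih =>
      refine eq_top_iff.mpr (h.ge.trans (sup_le le_sup_left ?_))
      have h1 : I • (P ⊔ I ^ n • (⊤ : Submodule A M)) ≤ P ⊔ I ^ (n + 1) • ⊤ := by
        rw [Submodule.smul_sup, pow_succ', Submodule.mul_smul]
        exact sup_le_sup_right Submodule.smul_le_right _
      rwa [ih] at h1
  obtain ⟨n, hn⟩ := hI
  simpa [hn] using key n

theorem Submodule.eq_bot_of_le_smul_of_isNilpotent (hI : IsNilpotent I) (P : Submodule A M)
    (h : P ≤ I • P) : P = ⊥ := by
  have key : ∀ n : ℕ, P ≤ I ^ n • P := by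
    intro n
    induction n with
    | zero => simp
    | succ n ih =>
      refine h.trans ?_
      rw [pow_succ', Submodule.mul_smul]
      exact Submodule.smul_mono le_rfl ih
  obtain ⟨n, hn⟩ := hI
  simpa [hn] using key n

/-- A linear map to a projective module that is an isomorphism modulo a nilpotent ideal is an
isomorphism. -/
theorem LinearMap.bijective_of_isNilpotent [Module.Projective A N] (hI : IsNilpotent I)
    (f : M →ₗ[A] N) (h1 : ∀ y, ∃ x, f x - y ∈ (I • ⊤ : Submodule A N))
    (h2 : ∀ x, f x ∈ (I • ⊤ : Submodule A N) → x ∈ (I • ⊤ : Submodule A M)) :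
    Function.Bijective f := by
  have hs : Function.Surjective f := by
    rw [← LinearMap.range_eq_top]
    refine Submodule.eq_top_of_sup_smul_of_isNilpotent hI _ (eq_top_iff.mpr fun y _ => ?_)
    obtain ⟨x, hx⟩ := h1 y
    rw [← sub_sub_cancel (f x) y]
    exact sub_mem (Submodule.mem_sup_left ⟨x, rfl⟩) (Submodule.mem_sup_right hx)
  refine ⟨?_, hs⟩
  -- The projection `id - s ∘ f` onto the kernel maps `I M` into `I ker f`. It fixes the kernel,
  -- which lies in `I M`, so `ker f ≤ I ker f`.
  obtain ⟨s, hs⟩ := Module.projective_lifting_property f LinearMap.id hs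
  have hs' : ∀ y, f (s y) = y := fun y => LinearMap.congr_fun hs y
  rw [← LinearMap.ker_eq_bot]
  refine Submodule.eq_bot_of_le_smul_of_isNilpotent hI _ fun x hx => ?_
  have hx' : f x = 0 := hx
  have h := Submodule.mem_map_of_mem (f := (LinearMap.id - s ∘ₗ f : M →ₗ[A] M)) (h2 x (by simp [hx']))
  rw [Submodule.map_smul''] at h
  have e : (LinearMap.id - s ∘ₗ f : M →ₗ[A] M) x = x := by simp [hx']
  rw [e] at h
  refine Submodule.smul_mono le_rfl ?_ h
  rintro _ ⟨y, -, rfl⟩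
  simp [hs']

/-- A submodule `P` of a free module `M` over a local ring with nilpotent maximal ideal `𝔪` is free
if `P ∩ 𝔪 M = 𝔪 P`. -/
theorem Submodule.free_of_inf_smul_le [IsLocalRing A] [Module.Free A M]
    (hm : IsNilpotent (IsLocalRing.maximalIdeal A)) (P : Submodule A M)
    (h : P ⊓ IsLocalRing.maximalIdeal A • ⊤ ≤ IsLocalRing.maximalIdeal A • P) :
    Module.Free A P := by
  let m := IsLocalRing.maximalIdeal A
  let _ : Field (A ⧸ m) := Ideal.Quotient.field (IsLocalRing.maximalIdeal A)
  change P ⊓ m • ⊤ ≤ m • P at h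
  let q : M →ₗ[A] M ⧸ (m • ⊤ : Submodule A M) := Submodule.mkQ _
  -- The image of `P` in the vector space `M / 𝔪 M`. A basis of `Q` is lifted into `P` and its
  -- complement to a basis of `M / 𝔪 M` is lifted anywhere in `M`.
  let Q : Submodule (A ⧸ m) (M ⧸ (m • ⊤ : Submodule A M)) :=
    { carrier := q '' P
      add_mem' := by
        rintro _ _ ⟨x, hx, rfl⟩ ⟨y, hy, rfl⟩
        exact ⟨x + y, add_mem hx hy, map_add _ _ _⟩
      zero_mem' := ⟨0, zero_mem _, map_zero _⟩
      smul_mem' := by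
        rintro a _ ⟨x, hx, rfl⟩
        obtain ⟨a, rfl⟩ := Ideal.Quotient.mk_surjective a
        exact ⟨a • x, P.smul_mem a hx, rfl⟩ }
  let b := Module.Basis.ofVectorSpace (A ⧸ m) Q
  have hb : LinearIndependent (A ⧸ m) (fun i => (b i : M ⧸ (m • ⊤ : Submodule A M))) :=
    b.linearIndependent.map' Q.subtype Q.ker_subtype
  let b' := Module.Basis.sumExtend hb
  have hlift : ∀ i, ∃ x ∈ P, q x = b i := fun i => (b i).2
  choose x hxP hx using hlift
  have hlift' : ∀ i, ∃ y, q y = b' i := fun i => Submodule.mkQ_surjective _ _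
  choose y hy using hlift'
  let w := Sum.elim x (fun i => y (Sum.inr i))
  have hw : ∀ i, q (w i) = b' i := by
    rintro (i | i)
    · simp only [w, Sum.elim_inl, hx, b', Module.Basis.sumExtend, Module.Basis.reindex_apply,
        Module.Basis.extend_apply_self]
      rfl
    · simp [w, hy]
  let f := Finsupp.linearCombination A w
  have hqf : ∀ c, q (f c) = Finsupp.linearCombination (A ⧸ m) b'
      (c.mapRange (Ideal.Quotient.mk m) (map_zero _)) := by
    intro c
    rw [Finsupp.linearCombination_apply, Finsupp.linearCombination_apply,
      Finsupp.sum_mapRange_index (by simp), Finsupp.sum, map_sum, Finsupp.sum]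
    refine Finset.sum_congr rfl fun i _ => ?_
    rw [map_smul, hw]
    rfl
  -- The lifted family is a basis of `M`, because it is one modulo `𝔪`.
  have hf : Function.Bijective f := by
    refine LinearMap.bijective_of_isNilpotent hm f (fun z => ?_) fun c hc => ?_
    · obtain ⟨c, hc⟩ := Finsupp.mapRange_surjective (α := _) (Ideal.Quotient.mk m) (map_zero _)
        Ideal.Quotient.mk_surjective (b'.repr (q z))
      refine ⟨c, ?_⟩
      rw [← Submodule.Quotient.mk_eq_zero, Submodule.Quotient.mk_sub, sub_eq_zero]
      change q (f c) = q z
      rw [hqf, hc, Module.Basis.linearCombination_repr]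
    · have h0 : q (f c) = 0 := (Submodule.Quotient.mk_eq_zero _).mpr hc
      rw [hqf] at h0
      have h1 := linearIndependent_iff.mp b'.linearIndependent _ h0
      rw [← Finsupp.sum_single c]
      refine Submodule.sum_mem _ fun i _ => ?_
      have h2 : c i ∈ m := by
        have := DFunLike.congr_fun h1 i
        rw [Finsupp.mapRange_apply] at this
        exact Ideal.Quotient.eq_zero_iff_mem.mp this
      rw [← mul_one (c i), ← smul_eq_mul, ← Finsupp.smul_single]
      exact Submodule.smul_mem_smul h2 trivial
  have hwli : LinearIndependent A w := hf.1
  have hxli : LinearIndependent A x := hwli.comp Sum.inl Sum.inl_injective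
  have hxli' : LinearIndependent A (fun i => (⟨x i, hxP i⟩ : P)) :=
    LinearIndependent.of_comp P.subtype hxli
  refine Module.Free.of_basis (Module.Basis.mk hxli' (top_le_iff.mpr ?_))
  -- It is enough to span `P` modulo `𝔪 P`. The lifts span it modulo `𝔪 M`, and the hypothesis `h`
  -- converts the error in `P ∩ 𝔪 M` into one in `𝔪 P`.
  refine Submodule.eq_top_of_sup_smul_of_isNilpotent hm _ (eq_top_iff.mpr ?_)
  rintro ⟨z, hz⟩ -
  have hz' : ∃ c : _ →₀ A, q (Finsupp.linearCombination A x c) = q z := by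
    obtain ⟨c, hc⟩ := Finsupp.mapRange_surjective (α := _) (Ideal.Quotient.mk m) (map_zero _)
      Ideal.Quotient.mk_surjective (b.repr ⟨q z, z, hz, rfl⟩)
    refine ⟨c, ?_⟩
    have h3 := congrArg Subtype.val (b.linearCombination_repr ⟨q z, z, hz, rfl⟩)
    rw [← hc, Finsupp.linearCombination_apply, Finsupp.sum_mapRange_index (by simp), Finsupp.sum,
      AddSubmonoidClass.coe_finsetSum] at h3
    rw [Finsupp.linearCombination_apply, Finsupp.sum, map_sum]
    refine Eq.trans (Finset.sum_congr rfl fun i _ => ?_) h3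
    rw [map_smul, hx]
    rfl
  obtain ⟨c, hc⟩ := hz'
  let z' : P := Finsupp.linearCombination A (fun i => (⟨x i, hxP i⟩ : P)) c
  have hz'v : (z' : M) = Finsupp.linearCombination A x c := by
    change P.subtype z' = _
    rw [Finsupp.apply_linearCombination]
    rfl
  have hd : (⟨z, hz⟩ - z' : P) ∈ (m • ⊤ : Submodule A P) := by
    have h4 : z - z' ∈ m • P := by
      refine h ⟨sub_mem hz z'.2, ?_⟩
      change _ ∈ (m • ⊤ : Submodule A M)
      rw [← Submodule.Quotient.mk_eq_zero, Submodule.Quotient.mk_sub, sub_eq_zero, hz'v]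
      exact hc.symm
    have h5 : Submodule.map P.subtype (m • ⊤ : Submodule A P) = m • P := by
      rw [Submodule.map_smul'', Submodule.map_top, Submodule.range_subtype]
    rw [← h5] at h4
    obtain ⟨t, ht, e⟩ := h4
    rwa [show (⟨z, hz⟩ - z' : P) = t from Subtype.ext e.symm]
  rw [← sub_add_cancel (⟨z, hz⟩ : P) z']
  refine add_mem (Submodule.mem_sup_right hd) (Submodule.mem_sup_left ?_)
  rw [← Finsupp.range_linearCombination]
  exact ⟨c, rfl⟩

end Nilpotent

/-! ### Averaging over a subgroup of invertible index -/

section Averaging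

variable {R H M : Type*} [CommRing R] [Group H] [AddCommGroup M] [Module R M]

/-- The average over the cosets of a subgroup of finite index. -/
noncomputable def cosetAverage (ρ : Representation R H M) (N : Subgroup H) [Fintype (H ⧸ N)] :
    M →ₗ[R] M :=
  Ring.inverse (Fintype.card (H ⧸ N) : R) • ∑ q : H ⧸ N, ρ q.out

variable {ρ : Representation R H M} {N : Subgroup H}

/-- On vectors fixed by `N` the chosen coset representatives do not matter; this is what makes the
average meaningful. -/
theorem rep_out_mk {x : M} (hx : ∀ h ∈ N, ρ h x = x) (h : H) :
    ρ (h : H ⧸ N).out x = ρ h x := by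
  obtain ⟨n, hn⟩ := QuotientGroup.mk_out_eq_mul N h
  rw [hn, map_mul, Module.End.mul_apply, hx _ n.2]

variable [Fintype (H ⧸ N)]

theorem cosetAverage_apply (x : M) : cosetAverage ρ N x =
    Ring.inverse (Fintype.card (H ⧸ N) : R) • ∑ q : H ⧸ N, ρ q.out x := by
  simp [cosetAverage]

theorem rep_cosetAverage {x : M} (hx : ∀ h ∈ N, ρ h x = x) (h : H) :
    ρ h (cosetAverage ρ N x) = cosetAverage ρ N x := by
  rw [cosetAverage_apply, map_smul, map_sum]
  congr 1
  -- Left translation by `h` permutes the cosets.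
  refine Fintype.sum_equiv (MulAction.toPerm h) _ _ fun q => ?_
  obtain ⟨g, rfl⟩ := QuotientGroup.mk_surjective q
  change _ = ρ (((h * g : H) : H ⧸ N)).out x
  rw [rep_out_mk hx, rep_out_mk hx, map_mul, Module.End.mul_apply]

/-- Every summand is congruent to `x` modulo `S`, and the number of summands is a unit. -/
theorem cosetAverage_sub_mem (hN : IsUnit (Fintype.card (H ⧸ N) : R)) {S : Submodule R M} {x : M}
    (hx : ∀ h, ρ h x - x ∈ S) : cosetAverage ρ N x - x ∈ S := by
  have h1 : Ring.inverse (Fintype.card (H ⧸ N) : R) • ∑ _q : H ⧸ N, x = x := by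
    rw [Finset.sum_const, Finset.card_univ, ← Nat.cast_smul_eq_nsmul R, smul_smul,
      Ring.inverse_mul_cancel _ hN, one_smul]
  nth_rewrite 2 [← h1]
  rw [cosetAverage_apply, ← smul_sub, ← Finset.sum_sub_distrib]
  exact S.smul_mem _ (S.sum_mem fun q _ => hx _)

theorem cosetAverage_eq (hN : IsUnit (Fintype.card (H ⧸ N) : R)) {x : M}
    (hx : ∀ h, ρ h x = x) : cosetAverage ρ N x = x := by
  have := cosetAverage_sub_mem (ρ := ρ) (S := ⊥) hN (x := x) (fun h => by simp [hx])
  simpa [sub_eq_zero] using this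

end Averaging

section Stabilizer

variable {R : Type*} [CommRing R] {G : Type*} [Group G] {M : Type*} [AddCommGroup M] [Module R M]

/-- The stabilizer of a vector of a representation. -/
def repStabilizer (ρ : Representation R G M) (x : M) : Subgroup G where
  carrier := {g | ρ g x = x}
  one_mem' := by simp
  mul_mem' := fun {a b} ha hb => by
    rw [Set.mem_ofPred_eq] at ha hb ⊢
    rw [map_mul, Module.End.mul_apply, hb, ha]
  inv_mem' := fun {a} ha => by
    rw [Set.mem_ofPred_eq] at ha ⊢
    conv_lhs => rw [← ha, ← Module.End.mul_apply, ← map_mul]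
    simp

theorem isSmoothRep_of_openSubgroup [TopologicalSpace G] [IsTopologicalGroup G]
    {ρ : Representation R G M}
    (h : ∀ x, ∃ U : OpenSubgroup G, ∀ g ∈ U, ρ g x = x) : IsSmoothRep ρ := by
  intro x
  obtain ⟨U, hU⟩ := h x
  exact Subgroup.isOpen_mono (H₁ := (U : Subgroup G)) (H₂ := repStabilizer ρ x)
    (fun g hg => hU g hg) U.isOpen

end Stabilizer

/-! ### Functions supported on `J` inside the compact induction -/

section Single

variable {R : Type*} [CommRing R] {G : Type*} [Group G] [TopologicalSpace G] [IsTopologicalGroup G]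
  {M : Type*} [AddCommGroup M] [Module R M] {J : Subgroup G} {ρ : Representation R J M}

open Classical in
/-- The function supported on `J` with value `v` at `1`, as an element of the compactly induced
representation. -/
noncomputable def cIndSingle (hJ : IsOpen (J : Set G)) (hρ : IsSmoothRep ρ) :
    M →ₗ[R] (cIndSub J ρ).toSubmodule where
  toFun v := ⟨fun x => if h : x ∈ J then ρ ⟨x, h⟩ v else 0, by
    refine ⟨fun j g => ?_, ⟨⟨(repStabilizer ρ v).map J.subtype,
      hJ.isOpenMap_subtype_val _ (hρ v)⟩, ?_⟩, {1}, isCompact_singleton, fun g hg => ?_⟩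
    · by_cases h : g ∈ J
      · have h' : (j : G) * g ∈ J := J.mul_mem j.2 h
        simp only [h, h', dif_pos, ← Module.End.mul_apply, ← map_mul]
        rfl
      · have h' : (j : G) * g ∉ J := by rwa [J.mul_mem_cancel_left j.2]
        simp [h, h']
    · rintro x _ ⟨j, hj, rfl⟩
      by_cases h : x ∈ J
      · have h' : x * (j : G) ∈ J := J.mul_mem h j.2
        have e : (⟨x * j, h'⟩ : J) = ⟨x, h⟩ * j := rfl
        have hj' : ρ j v = v := hj
        simp only [Subgroup.subtype_apply, h, h', dif_pos, e, map_mul, Module.End.mul_apply, hj']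
      · have h' : x * (j : G) ∉ J := by rwa [J.mul_mem_cancel_right j.2]
        simp [h, h']
    · by_cases h : g ∈ J
      · exact ⟨⟨g, h⟩, 1, rfl, by simp⟩
      · simp [h] at hg⟩
  map_add' v w := by
    ext x
    by_cases h : x ∈ J <;> simp [h]
  map_smul' a v := by
    ext x
    by_cases h : x ∈ J <;> simp [h]

theorem cIndSingle_apply_mem (hJ : IsOpen (J : Set G)) (hρ : IsSmoothRep ρ) (v : M) (j : J) :
    (cIndSingle hJ hρ v).1 j = ρ j v := by
  simp [cIndSingle]

theorem cIndSingle_apply_one (hJ : IsOpen (J : Set G)) (hρ : IsSmoothRep ρ) (v : M) :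
    (cIndSingle hJ hρ v).1 1 = v := by
  simpa using cIndSingle_apply_mem hJ hρ v 1

theorem cIndSingle_apply_of_notMem (hJ : IsOpen (J : Set G)) (hρ : IsSmoothRep ρ) (v : M) {x : G}
    (hx : x ∉ J) : (cIndSingle hJ hρ v).1 x = 0 := by
  simp [cIndSingle, hx]

theorem cInd_apply_mem (f : (cIndSub J ρ).toSubmodule) (j : J) : f.1 j = ρ j (f.1 1) := by
  simpa using f.2.1 j 1

theorem eq_cIndSingle (hJ : IsOpen (J : Set G)) (hρ : IsSmoothRep ρ) (f : (cIndSub J ρ).toSubmodule)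
    (hf : ∀ x ∉ J, f.1 x = 0) : f = cIndSingle hJ hρ (f.1 1) := by
  refine Subtype.ext (funext fun x => ?_)
  by_cases h : x ∈ J
  · exact (cInd_apply_mem f ⟨x, h⟩).trans (cIndSingle_apply_mem hJ hρ _ ⟨x, h⟩).symm
  · rw [hf x h, cIndSingle_apply_of_notMem hJ hρ _ h]

/-- Both sides are supported on `J`, so comparing values at `1` suffices. Thus extension by zero
embeds `ρ` in the restriction of its induction to `J`. -/
theorem cInd_cIndSingle (hJ : IsOpen (J : Set G)) (hρ : IsSmoothRep ρ) (j : J) (v : M) :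
    cInd J ρ j (cIndSingle hJ hρ v) = cIndSingle hJ hρ (ρ j v) := by
  refine (eq_cIndSingle hJ hρ _ fun x hx => ?_).trans ?_
  · rw [cInd_apply, cIndSingle_apply_of_notMem]
    rwa [J.mul_mem_cancel_right j.2]
  · rw [cInd_apply, one_mul, cIndSingle_apply_mem]

/-- Translating by `c.out⁻¹` moves the support from `J` to the coset of `c.out`, so the sum splits
`f` according to the cosets in its finite support. -/
theorem eq_sum_cIndSingle (hJ : IsOpen (J : Set G)) (hρ : IsSmoothRep ρ)
    (f : (cIndSub J ρ).toSubmodule) :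
    f = ∑ c ∈ (finite_support_out hJ f).toFinset,
      cInd J ρ c.out⁻¹ (cIndSingle hJ hρ (f.1 c.out)) := by
  refine cInd_eq_of_out _ _ fun c => ?_
  have hev : ∀ (s : Finset (Quotient (QuotientGroup.rightRel J)))
      (F : Quotient (QuotientGroup.rightRel J) → (cIndSub J ρ).toSubmodule),
      (∑ c ∈ s, F c).1 c.out = ∑ c' ∈ s, (F c').1 c.out := fun s F =>
    map_sum (LinearMap.proj (R := R) c.out ∘ₗ (cIndSub J ρ).toSubmodule.subtype) F s
  rw [hev, Finset.sum_eq_single c]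
  · rw [cInd_apply, mul_inv_cancel, cIndSingle_apply_one]
  · intro c' _ hne
    rw [cInd_apply]
    refine cIndSingle_apply_of_notMem hJ hρ _ fun h => hne ?_
    rw [← Quotient.out_eq c, ← Quotient.out_eq c', Quotient.eq, QuotientGroup.rightRel_apply]
    exact h
  · intro hc
    rw [Set.Finite.mem_toFinset, Function.notMem_support] at hc
    rw [hc, map_zero, map_zero]
    rfl

end Single

/-! ### Isotypic vectors for a character of a subgroup of invertible index -/

section Isotypic

variable {A : Type*} [CommRing A] {G : Type*} [Group G] {M : Type*} [AddCommGroup M] [Module A M]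
  {H : Subgroup G}

/-- The vectors on which the subgroup `H` acts through the character `χ`. -/
def isotypic (ρ : Representation A G M) (χ : H →* A) : Submodule A M where
  carrier := {x | ∀ h : H, ρ h x = χ h • x}
  add_mem' hx hy h := by rw [map_add, hx, hy, smul_add]
  zero_mem' h := by simp
  smul_mem' a x hx h := by rw [map_smul, hx, smul_comm]

/-- The restriction of `ρ` to `H`, twisted by the inverse of a character of `H`. -/
def twistRes (ρ : Representation A G M) (χ : H →* A) : Representation A H M where
  -- The values of `χ` lie in the monoid `A`, so the inverse character is written `h ↦ χ(h⁻¹)`.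
  toFun h := χ h⁻¹ • ρ h
  map_one' := by simp
  map_mul' a b := by
    ext x
    simp only [mul_inv_rev, map_mul, Subgroup.coe_mul, LinearMap.smul_apply, Module.End.mul_apply,
      map_smul, smul_smul]

theorem twistRes_apply (ρ : Representation A G M) (χ : H →* A) (h : H) (x : M) :
    twistRes ρ χ h x = χ h⁻¹ • ρ h x := rfl

theorem char_smul_twistRes (ρ : Representation A G M) (χ : H →* A) (h : H) (x : M) :
    χ h • twistRes ρ χ h x = ρ h x := by
  rw [twistRes_apply, smul_smul, ← map_mul]
  simp

/-- Twisting turns isotypic vectors into fixed vectors, which coset averages produce. -/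
theorem mem_isotypic_iff_twistRes {ρ : Representation A G M} {χ : H →* A} {x : M} :
    x ∈ isotypic ρ χ ↔ ∀ h : H, twistRes ρ χ h x = x := by
  refine forall_congr' fun h => ⟨fun e => ?_, fun e => ?_⟩
  · rw [twistRes_apply, e, smul_smul, ← map_mul]
    simp
  · rw [← char_smul_twistRes, e]

variable [TopologicalSpace G]

theorem exists_openSubgroup_twistRes {ρ : Representation A G M} {χ : H →* A} (hρ : IsSmoothRep ρ)
    (K : OpenSubgroup G) (hK : ∀ h : H, (h : G) ∈ K → χ h = 1) (x : M) :
    ∃ U : OpenSubgroup G, ∀ h : H, (h : G) ∈ U → twistRes ρ χ h x = x := by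
  refine ⟨⟨repStabilizer ρ x, hρ x⟩ ⊓ K, fun h hh => ?_⟩
  obtain ⟨h1, h2⟩ := OpenSubgroup.mem_inf.mp hh
  have h3 : ρ h x = x := h1
  rw [twistRes_apply, h3, hK h⁻¹ (inv_mem h2), one_smul]

theorem exists_fintype_quotient [Nontrivial A] (U : OpenSubgroup G)
    (hU : IsUnit (((U : Subgroup G).relIndex H : ℕ) : A)) :
    ∃ _ : Fintype (H ⧸ (U : Subgroup G).subgroupOf H),
      IsUnit (Fintype.card (H ⧸ (U : Subgroup G).subgroupOf H) : A) := by
  -- An infinite index is `0` by convention, hence not a unit of the nontrivial ring `A`; the unit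
  -- hypothesis includes finiteness.
  have h0 : ((U : Subgroup G).subgroupOf H).index ≠ 0 := fun h => by
    rw [Subgroup.relIndex, h] at hU
    simp at hU
  have : ((U : Subgroup G).subgroupOf H).FiniteIndex := ⟨h0⟩
  let F : Fintype (H ⧸ (U : Subgroup G).subgroupOf H) := Fintype.ofFinite _
  refine ⟨F, ?_⟩
  rw [← Nat.card_eq_fintype_card]
  exact hU

variable [Nontrivial A] {ρ : Representation A G M} {χ : H →* A} (hρ : IsSmoothRep ρ)
    (K : OpenSubgroup G) (hK : ∀ h : H, (h : G) ∈ K → χ h = 1)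
    (hidx : ∀ U : OpenSubgroup G, IsUnit (((U : Subgroup G).relIndex H : ℕ) : A))

include hρ hK hidx in
-- The average of `x` for the twisted action works. With `S = 𝔪 M` this lifts isotypic vectors of
-- the reduction.
theorem exists_mem_isotypic_sub_mem {S : Submodule A M} {x : M}
    (hx : ∀ h : H, ρ h x - χ h • x ∈ S) : ∃ y ∈ isotypic ρ χ, y - x ∈ S := by
  obtain ⟨U, hU⟩ := exists_openSubgroup_twistRes hρ K hK x
  obtain ⟨_, hc⟩ := exists_fintype_quotient (H := H) U (hidx U)
  refine ⟨cosetAverage (twistRes ρ χ) ((U : Subgroup G).subgroupOf H) x,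
    mem_isotypic_iff_twistRes.mpr (rep_cosetAverage fun h hh => hU h hh),
    cosetAverage_sub_mem hc fun h => ?_⟩
  have h1 := S.smul_mem (χ h⁻¹) (hx h)
  rwa [smul_sub, ← twistRes_apply, smul_smul, ← map_mul, inv_mul_cancel, map_one, one_smul] at h1

include hρ hK hidx in
-- Averaging is `A`-linear and fixes isotypic vectors, and it should carry `I M` into `I` times the
-- isotypic part. It does so once the averaging subgroup fixes the finitely many vectors in an
-- expression of the given element of `I M`.
theorem isotypic_inf_smul_le (I : Ideal A) :
    isotypic ρ χ ⊓ I • ⊤ ≤ I • isotypic ρ χ := by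
  -- Allowing all smaller subgroups lets two summands share a common one.
  have key : ∀ z ∈ (I • ⊤ : Submodule A M), ∃ U : OpenSubgroup G, ∀ U' : OpenSubgroup G, U' ≤ U →
      ∀ _ : Fintype (H ⧸ (U' : Subgroup G).subgroupOf H),
      cosetAverage (twistRes ρ χ) ((U' : Subgroup G).subgroupOf H) z ∈ I • isotypic ρ χ := by
    intro z hz
    refine Submodule.smul_induction_on hz (fun a ha x _ => ?_) fun x y hx hy => ?_
    · obtain ⟨U, hU⟩ := exists_openSubgroup_twistRes hρ K hK x
      refine ⟨U, fun U' hU' _ => ?_⟩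
      rw [map_smul]
      exact Submodule.smul_mem_smul ha (mem_isotypic_iff_twistRes.mpr
        (rep_cosetAverage fun h hh => hU h (hU' hh)))
    · obtain ⟨U, hU⟩ := hx
      obtain ⟨U', hU'⟩ := hy
      refine ⟨U ⊓ U', fun U'' h _ => ?_⟩
      rw [map_add]
      exact add_mem (hU U'' (h.trans inf_le_left) _) (hU' U'' (h.trans inf_le_right) _)
  rintro z ⟨hz1, hz2⟩
  obtain ⟨U, hU⟩ := key z hz2
  obtain ⟨F, hc⟩ := exists_fintype_quotient (H := H) U (hidx U)
  have := hU U le_rfl F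
  rwa [cosetAverage_eq hc (mem_isotypic_iff_twistRes.mp hz1)] at this

end Isotypic

/-! ### Injectivity of compact induction on deformations -/

namespace Deformation

variable {l : ℕ} [Fact l.Prime] {k : Type v} [Field k] {G : Type u} [Group G] [TopologicalSpace G]
  {W : Type u} [AddCommGroup W] [Module k W] {π : Representation k G W}
  {A : Type u} [CommRing A] [IsLocalRing A] [Algebra (WittVector l k) A]

theorem red_mk_eq_iff (D : Deformation l π A) (x y : D.carrier) :
    D.red (Submodule.Quotient.mk x) = D.red (Submodule.Quotient.mk y) ↔
      x - y ∈ (IsLocalRing.maximalIdeal A • ⊤ : Submodule A D.carrier) := by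
  rw [D.red.injective.eq_iff, Submodule.Quotient.eq]

theorem exists_red_mk_eq (D : Deformation l π A) (w : W) :
    ∃ x, D.red (Submodule.Quotient.mk x) = w := by
  obtain ⟨y, rfl⟩ := D.red.surjective w
  obtain ⟨x, rfl⟩ := Submodule.Quotient.mk_surjective _ y
  exact ⟨x, rfl⟩

/-- An equivariant map of deformations that is compatible with the reductions is an isomorphism. -/
theorem iso_of_linearMap (hm : IsNilpotent (IsLocalRing.maximalIdeal A)) (D D' : Deformation l π A)
    (φ : D.carrier →ₗ[A] D'.carrier) (hφ : ∀ g x, φ (D.rep g x) = D'.rep g (φ x))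
    (hred : ∀ x, D'.red (Submodule.Quotient.mk (φ x)) = D.red (Submodule.Quotient.mk x)) :
    D.Iso D' := by
  have := D'.free
  have hb : Function.Bijective φ := by
    refine LinearMap.bijective_of_isNilpotent hm φ (fun y => ?_) fun x hx => ?_
    · obtain ⟨x, hx⟩ := D.exists_red_mk_eq (D'.red (Submodule.Quotient.mk y))
      exact ⟨x, (D'.red_mk_eq_iff _ _).mp ((hred x).trans hx)⟩
    · rw [← Submodule.Quotient.mk_eq_zero] at hx ⊢
      have h := hred x
      rw [hx, map_zero] at h
      exact (map_eq_zero_iff D.red D.red.injective).mp h.symm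
  exact ⟨Representation.Equiv.mk (LinearEquiv.ofBijective φ hb)
    fun g => LinearMap.ext fun x => hφ g x, hred⟩

variable [IsTopologicalGroup G] {J : Subgroup G}
  {V : Type u} [AddCommGroup V] [Module k V] {Λ : Representation k J V}

/-- Extension by zero `D → c-Ind D` and evaluation at `1`, `c-Ind D' → D'`, are `J`-maps. Placing
the given isomorphism between them yields a `J`-map `D → D'` that respects the reductions, hence an
isomorphism. -/
theorem cIndClasses_injective (hJ : IsOpen (J : Set G)) (θ : (_root_.cInd J Λ).Equiv π)
    (hm : IsNilpotent (IsLocalRing.maximalIdeal A)) :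
    Function.Injective (cIndClasses hJ θ : Classes l Λ A → Classes l π A) := by
  intro a b hab
  induction a using Quotient.inductionOn with | _ D
  induction b using Quotient.inductionOn with | _ D'
  obtain ⟨Φ, hΦ⟩ : (D.cInd hJ θ).Iso (D'.cInd hJ θ) := Quotient.exact hab
  refine Quotient.sound ?_
  let Φ' : (cIndSub J D.rep).toSubmodule →ₗ[A] (cIndSub J D'.rep).toSubmodule :=
    Φ.toIntertwiningMap.toLinearMap
  have hΦ' : ∀ f, D'.cIndRed (Φ' f) = D.cIndRed f := fun f =>
    EquivLike.injective θ (hΦ f)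
  have hΦg : ∀ g f, Φ' (_root_.cInd J D.rep g f) = _root_.cInd J D'.rep g (Φ' f) := fun g f =>
    Representation.IntertwiningMap.isIntertwining _ _ Φ.toIntertwiningMap g f
  refine iso_of_linearMap hm D D' (LinearMap.proj 1 ∘ₗ (cIndSub J D'.rep).toSubmodule.subtype ∘ₗ
    Φ' ∘ₗ cIndSingle hJ D.smooth) (fun j x => ?_) fun x => ?_
  · change (Φ' (cIndSingle hJ D.smooth (D.rep j x))).1 1 =
      D'.rep j ((Φ' (cIndSingle hJ D.smooth x)).1 1)
    rw [← cInd_cIndSingle, hΦg, cInd_apply, one_mul, cInd_apply_mem]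
  · have h1 := congrFun (congrArg Subtype.val (hΦ' (cIndSingle hJ D.smooth x))) 1
    refine h1.trans ?_
    change D.red (Submodule.Quotient.mk ((cIndSingle hJ D.smooth x).1 1)) = _
    rw [cIndSingle_apply_one]

end Deformation

/-! ### Frobenius reciprocity -/

section Frobenius

variable {R : Type*} [CommRing R] {G : Type*} [Group G] [TopologicalSpace G] [IsTopologicalGroup G]
  {M : Type*} [AddCommGroup M] [Module R M] {J : Subgroup G} {ρ : Representation R J M}

@[elab_as_elim]
theorem cInd_induction (hJ : IsOpen (J : Set G)) (hρ : IsSmoothRep ρ)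
    {p : (cIndSub J ρ).toSubmodule → Prop} (f : (cIndSub J ρ).toSubmodule) (h0 : p 0)
    (hadd : ∀ f f', p f → p f' → p (f + f'))
    (hsingle : ∀ (g : G) (v : M), p (cInd J ρ g (cIndSingle hJ hρ v))) : p f := by
  rw [eq_sum_cIndSingle hJ hρ f]
  exact Finset.sum_induction _ p hadd h0 fun c _ => hsingle _ _

/-- Frobenius reciprocity for compact induction from an open subgroup. -/
theorem exists_cInd_lift (hJ : IsOpen (J : Set G)) (hρ : IsSmoothRep ρ) {N : Type*}
    [AddCommGroup N] [Module R N] (σ : Representation R G N) (i : M →ₗ[R] N)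
    (hi : ∀ (j : J) (v : M), i (ρ j v) = σ j (i v)) :
    ∃ Ψ : (cIndSub J ρ).toSubmodule →ₗ[R] N, (∀ g f, Ψ (cInd J ρ g f) = σ g (Ψ f)) ∧
      ∀ v, Ψ (cIndSingle hJ hρ v) = i v := by
  classical
  -- The map is `f ↦ ∑ σ(c⁻¹) i(f(c))` over coset representatives `c`; equivariance is then checked
  -- on translates of functions supported on `J`.
  let Ψ : (cIndSub J ρ).toSubmodule →ₗ[R] N :=
    (Finsupp.lsum R fun c : Quotient (QuotientGroup.rightRel J) => σ c.out⁻¹ ∘ₗ i) ∘ₗ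
      (cIndEquiv hJ hρ).symm.toLinearMap
  have hΨ : ∀ (g : G) (v : M), Ψ (cInd J ρ g (cIndSingle hJ hρ v)) = σ g (i v) := by
    intro g v
    -- The translate by `g` of a function supported on `J` is supported on the coset `J g⁻¹`.
    let c₀ : Quotient (QuotientGroup.rightRel J) := Quotient.mk _ g⁻¹
    have hc₀ : c₀.out * g ∈ J := by
      have h := J.inv_mem (mul_out_inv_mem (J := J) g⁻¹)
      rwa [mul_inv_rev, inv_inv, inv_inv] at h
    have h1 : (cIndEquiv hJ hρ).symm (cInd J ρ g (cIndSingle hJ hρ v)) =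
        Finsupp.single c₀ (ρ ⟨_, hc₀⟩ v) := by
      ext c
      change (cInd J ρ g (cIndSingle hJ hρ v)).1 c.out = _
      rw [cInd_apply]
      by_cases h : c = c₀
      · subst h
        rw [Finsupp.single_eq_same]
        exact cIndSingle_apply_mem hJ hρ v ⟨_, hc₀⟩
      · rw [Finsupp.single_eq_of_ne h]
        refine cIndSingle_apply_of_notMem hJ hρ v fun h2 => h ?_
        rw [← Quotient.out_eq c, eq_comm, Quotient.eq, QuotientGroup.rightRel_apply, inv_inv]
        exact h2
    change Finsupp.lsum R _ ((cIndEquiv hJ hρ).symm _) = _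
    rw [h1, Finsupp.lsum_single, LinearMap.comp_apply, hi, ← Module.End.mul_apply, ← map_mul,
      inv_mul_cancel_left]
  refine ⟨Ψ, fun g f => ?_, fun v => ?_⟩
  · refine cInd_induction hJ hρ f ?_ (fun f f' h h' => ?_) fun g' v => ?_
    · simp only [map_zero]
    · rw [map_add, map_add, map_add, map_add, h, h']
    · rw [← Module.End.mul_apply, ← map_mul, hΨ, hΨ, map_mul, Module.End.mul_apply]
  · have := hΨ 1 v
    rwa [map_one, map_one, Module.End.one_apply, Module.End.one_apply] at this

end Frobenius

/-! ### Subgroups acting by scalars, and intertwining -/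

section Scalars

variable {k : Type*} [Field k] {G : Type*} [Group G] {V : Type*} [AddCommGroup V] [Module k V]

theorem exists_char_of_scalars [Nontrivial V] (Λ : Representation k G V)
    (h : ∀ g, ∃ c : k, ∀ v, Λ g v = c • v) : ∃ χ : G →* k, ∀ g v, Λ g v = χ g • v := by
  choose c hc using h
  obtain ⟨v, hv⟩ := exists_ne (0 : V)
  refine ⟨{ toFun := c, map_one' := ?_, map_mul' := fun a b => ?_ }, hc⟩
  · refine smul_left_injective k hv ?_
    change c 1 • v = (1 : k) • v
    rw [← hc, map_one, one_smul, Module.End.one_apply]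
  · refine smul_left_injective k hv ?_
    change c (a * b) • v = (c a * c b) • v
    rw [← hc, map_mul, Module.End.mul_apply, hc, hc, mul_smul, smul_comm]

/-- Scalar operators commute with `Λ j`. This invariance makes the isotypic part stable under `J`.
-/
theorem char_conj_eq [Nontrivial V] {J H : Subgroup G} {Λ : Representation k J V} (hHJ : H ≤ J)
    {χ : H →* k} (hχ : ∀ (h : H) (v : V), Λ ⟨h, hHJ h.2⟩ v = χ h • v) (j : J) (h : H)
    (hj : (j : G)⁻¹ * h * j ∈ H) : χ ⟨_, hj⟩ = χ h := by
  obtain ⟨v, hv⟩ := exists_ne (0 : V)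
  refine smul_left_injective k hv ?_
  change χ ⟨_, hj⟩ • v = χ h • v
  rw [← hχ]
  have e : (⟨_, hHJ hj⟩ : J) = j⁻¹ * ⟨h, hHJ h.2⟩ * j := rfl
  rw [e, map_mul, Module.End.mul_apply, map_mul, Module.End.mul_apply, hχ, map_smul,
    ← Module.End.mul_apply, ← map_mul, inv_mul_cancel, map_one, Module.End.one_apply]

variable [TopologicalSpace G] [IsTopologicalGroup G] {J H : Subgroup G} {Λ : Representation k J V}

/-- If an open subgroup `H ≤ J` acts on `Λ` through a character and `c-Ind_J^G Λ ≠ 0`, then this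
character is smooth. -/
theorem exists_openSubgroup_char_eq_one (hHJ : H ≤ J) (hHo : IsOpen (H : Set G))
    {χ : H →* k} (hχ : ∀ (h : H) (v : V), Λ ⟨h, hHJ h.2⟩ v = χ h • v)
    {f : (cIndSub J Λ).toSubmodule} (hf : f ≠ 0) :
    ∃ K : OpenSubgroup G, (K : Subgroup G) ≤ H ∧ ∀ h : H, (h : G) ∈ K → χ h = 1 := by
  obtain ⟨g, hg⟩ : ∃ g, f.1 g ≠ 0 := by
    by_contra! h
    exact hf (Subtype.ext (funext h))
  -- After translation the value at `1` is nonzero. For `h ∈ H` close to `1`, this value equals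
  -- `f'(h)` by smoothness, and `f'(h) = χ(h) f'(1)` by `J`-equivariance.
  let f' := cInd J Λ g f
  have hf' : f'.1 1 ≠ 0 := by rwa [cInd_apply, one_mul]
  obtain ⟨-, ⟨K, hK⟩, -⟩ := f'.2
  refine ⟨K ⊓ ⟨H, hHo⟩, fun x hx => (OpenSubgroup.mem_inf.mp hx).2, fun h hh => ?_⟩
  have h1 := hK 1 h (OpenSubgroup.mem_inf.mp hh).1
  rw [one_mul] at h1
  refine smul_left_injective k hf' ?_
  change χ h • f'.1 1 = (1 : k) • f'.1 1
  rw [one_smul, ← hχ, ← cInd_apply_mem f']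
  exact h1

theorem isSmoothRep_of_char (hHJ : H ≤ J)
    {χ : H →* k} (hχ : ∀ (h : H) (v : V), Λ ⟨h, hHJ h.2⟩ v = χ h • v)
    (K : OpenSubgroup G) (hKH : (K : Subgroup G) ≤ H) (hK : ∀ h : H, (h : G) ∈ K → χ h = 1) :
    IsSmoothRep Λ := by
  refine isSmoothRep_of_openSubgroup fun v =>
    ⟨K.comap J.subtype continuous_subtype_val, fun j hj => ?_⟩
  have hj' : (j : G) ∈ K := hj
  have := hχ ⟨j, hKH hj'⟩ v
  rw [hK _ hj', one_smul] at this
  exact this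

/-- The value `v = f(x)` satisfies `Λ(x h x⁻¹) v = f(x h) = χ(h) v` whenever `x h x⁻¹ ∈ J`, which
`hint` forbids for `v ≠ 0`. -/
theorem eq_zero_of_isotypic
    {χ : H →* k} (hint : ∀ g ∉ J, ∀ v : V,
      (∀ (h : H) (hh : g * h * g⁻¹ ∈ J), Λ ⟨_, hh⟩ v = χ h • v) → v = 0)
    (f : (cIndSub J Λ).toSubmodule) (hf : ∀ h : H, cInd J Λ h f = χ h • f) (x : G) (hx : x ∉ J) :
    f.1 x = 0 := by
  refine hint x hx _ fun h hh => ?_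
  rw [← f.2.1]
  have := congrFun (congrArg Subtype.val (hf h)) x
  rw [cInd_apply] at this
  simpa using this

end Scalars

/-! ### Surjectivity: recovering a deformation of `Λ` as an isotypic part -/

namespace Deformation

variable {l : ℕ} [Fact l.Prime] {k : Type v} [Field k] {G : Type u} [Group G] [TopologicalSpace G]
  [IsTopologicalGroup G] {J H : Subgroup G}
  {V : Type u} [AddCommGroup V] [Module k V] {Λ : Representation k J V}
  {W : Type u} [AddCommGroup W] [Module k W] {π : Representation k G W}
  {A : Type u} [CommRing A] [IsLocalRing A] [Algebra (WittVector l k) A]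

theorem nontrivial_of_equiv_cInd [Nontrivial W] (θ : (_root_.cInd J Λ).Equiv π) :
    Nontrivial V := by
  by_contra h
  rw [not_nontrivial_iff_subsingleton] at h
  have : Subsingleton (cIndSub J Λ).toSubmodule :=
    ⟨fun f f' => Subtype.ext (funext fun x => Subsingleton.elim _ _)⟩
  exact not_subsingleton W (EquivLike.surjective θ).subsingleton

theorem cIndRed_single (hJ : IsOpen (J : Set G)) (hΛ : IsSmoothRep Λ) (D : Deformation l Λ A)
    (g : G) (v : D.carrier) :
    D.cIndRed (_root_.cInd J D.rep g (cIndSingle hJ D.smooth v)) =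
      _root_.cInd J Λ g (cIndSingle hJ hΛ (D.red (Submodule.Quotient.mk v))) := by
  have h1 : D.cIndRed (cIndSingle hJ D.smooth v) =
      cIndSingle hJ hΛ (D.red (Submodule.Quotient.mk v)) := by
    refine (eq_cIndSingle hJ hΛ _ fun x hx => ?_).trans ?_
    · change D.red (Submodule.Quotient.mk ((cIndSingle hJ D.smooth v).1 x)) = 0
      rw [cIndSingle_apply_of_notMem hJ _ _ hx, Submodule.Quotient.mk_zero, map_zero]
    · congr 1
      change D.red (Submodule.Quotient.mk ((cIndSingle hJ D.smooth v).1 1)) = _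
      rw [cIndSingle_apply_one]
  rw [← h1]
  rfl

/-- Let `Λ` be a representation of an open subgroup `J` on which a normal subgroup `H` of `J` acts
through a character `χ`, and suppose that the `χ`-isotypic part of `c-Ind_J^G Λ` is `Λ`. If the
indices of the open subgroups of `H` are invertible in `A`, then every deformation of
`c-Ind_J^G Λ` is induced from a deformation of `Λ`, namely its isotypic part for the Teichmüller
lift of `χ`. -/
theorem exists_cInd_iso [Nontrivial W] (hJ : IsOpen (J : Set G))
    (θ : (_root_.cInd J Λ).Equiv π) (hm : IsNilpotent (IsLocalRing.maximalIdeal A))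
    (hHJ : H ≤ J) (hHo : IsOpen (H : Set G)) (hnorm : ∀ j ∈ J, ∀ h ∈ H, j⁻¹ * h * j ∈ H)
    (χ : H →* k) (hχ : ∀ (h : H) (v : V), Λ ⟨h, hHJ h.2⟩ v = χ h • v)
    (hint : ∀ g ∉ J, ∀ v : V,
      (∀ (h : H) (hh : g * h * g⁻¹ ∈ J), Λ ⟨_, hh⟩ v = χ h • v) → v = 0)
    (hidx : ∀ U : OpenSubgroup G, IsUnit (((U : Subgroup G).relIndex H : ℕ) : A))
    (E : Deformation l π A) : ∃ D : Deformation l Λ A, (D.cInd hJ θ).Iso E := by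
  have := nontrivial_of_equiv_cInd θ
  have hW : ∃ f : (cIndSub J Λ).toSubmodule, f ≠ 0 := by
    obtain ⟨w, hw⟩ := exists_ne (0 : W)
    obtain ⟨f, rfl⟩ := EquivLike.surjective θ w
    exact ⟨f, fun h => hw (by rw [h, map_zero])⟩
  obtain ⟨f₀, hf₀⟩ := hW
  obtain ⟨K, hKH, hK⟩ := exists_openSubgroup_char_eq_one hHJ hHo hχ hf₀
  have hΛ : IsSmoothRep Λ := isSmoothRep_of_char hHJ hχ K hKH hK
  -- The Teichmüller map is multiplicative, so `χA` is again a character; it reduces to `χ` and is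
  -- trivial wherever `χ` is.
  let χA : H →* A := (algebraMap (WittVector l k) A : WittVector l k →* A).comp
    ((WittVector.teichmuller l).comp χ)
  have hKA : ∀ h : H, (h : G) ∈ K → χA h = 1 := fun h hh => by simp [χA, hK h hh]
  have hredχ : ∀ (h : H) (x : E.carrier), E.red (Submodule.Quotient.mk (χA h • x)) =
      χ h • E.red (Submodule.Quotient.mk x) := by
    intro h x
    refine (E.red_smul _ x).trans ?_
    congr 1
  let P : Submodule A E.carrier := isotypic E.rep χA
  let ρP : Subrepresentation (E.rep.comp J.subtype) :=
    { toSubmodule := P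
      apply_mem_toSubmodule := by
        intro j x hx h
        have hj := hnorm j j.2 h h.2
        have e : (h : G) * j = j * ((j : G)⁻¹ * h * j) := by group
        change E.rep h (E.rep j x) = χA h • E.rep j x
        rw [← Module.End.mul_apply, ← map_mul, e, map_mul, Module.End.mul_apply, hx ⟨_, hj⟩,
          map_smul]
        congr 1
        exact congrArg (fun c => algebraMap (WittVector l k) A (WittVector.teichmuller l c))
          (char_conj_eq hHJ hχ j h hj) }
  have hsub : ∀ x : E.carrier, (∀ h : H, E.rep h x - χA h • x ∈
      (IsLocalRing.maximalIdeal A • ⊤ : Submodule A E.carrier)) ↔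
      ∀ h : H, π h (E.red (Submodule.Quotient.mk x)) =
        χ h • E.red (Submodule.Quotient.mk x) := by
    intro x
    refine forall_congr' fun h => ?_
    rw [← E.red_mk_eq_iff, E.red_rep, hredχ]
  have hθ : ∀ (g : G) (f : (cIndSub J Λ).toSubmodule), θ (_root_.cInd J Λ g f) = π g (θ f) :=
    fun g f => Representation.IntertwiningMap.isIntertwining _ _ θ.toIntertwiningMap g f
  -- The reduction of a vector of `P` is a `χ`-isotypic function under `θ`, hence supported on `J`
  -- and determined by its value at `1`.
  let r : P →+ V :=
    { toFun := fun x => (θ.symm (E.red (Submodule.Quotient.mk (x : E.carrier)))).1 1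
      map_zero' := by simp
      map_add' := fun x y => by simp }
  have hr : ∀ x : P, E.red (Submodule.Quotient.mk (x : E.carrier)) =
      θ (cIndSingle hJ hΛ (r x)) := by
    intro x
    obtain ⟨f, hf⟩ := EquivLike.surjective θ (E.red (Submodule.Quotient.mk (x : E.carrier)))
    have hrx : r x = f.1 1 := by
      change (θ.symm (E.red (Submodule.Quotient.mk (x : E.carrier)))).1 1 = _
      rw [← hf]
      simp
    rw [hrx, ← eq_cIndSingle hJ hΛ f, hf]
    refine eq_zero_of_isotypic hint f fun h => EquivLike.injective θ ?_
    rw [hθ, map_smul, hf]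
    refine (hsub x).mp (fun h => ?_) h
    rw [x.2 h, sub_self]
    exact zero_mem _
  have hrsurj : Function.Surjective r := by
    intro v
    obtain ⟨x, hx⟩ := E.exists_red_mk_eq (θ (cIndSingle hJ hΛ v))
    -- An arbitrary lift of an isotypic vector is isotypic modulo `m_A`; averaging corrects it
    -- without changing its reduction.
    obtain ⟨y, hy, hyx⟩ := exists_mem_isotypic_sub_mem E.smooth K hKA hidx (x := x)
      (S := IsLocalRing.maximalIdeal A • ⊤) ((hsub x).mpr fun h => by
        rw [hx, ← hθ, ← map_smul, cInd_cIndSingle hJ hΛ ⟨h, hHJ h.2⟩, hχ, map_smul])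
    refine ⟨⟨y, hy⟩, ?_⟩
    have h1 := (E.red_mk_eq_iff _ _).mpr hyx
    rw [hx, hr ⟨y, hy⟩] at h1
    have h2 := EquivLike.injective θ h1
    rw [← cIndSingle_apply_one hJ hΛ (r ⟨y, hy⟩), h2, cIndSingle_apply_one]
  have hmapP : Submodule.map P.subtype (IsLocalRing.maximalIdeal A • ⊤ : Submodule A P) =
      IsLocalRing.maximalIdeal A • P := by
    rw [Submodule.map_smul'', Submodule.map_top, Submodule.range_subtype]
  have hPm := isotypic_inf_smul_le E.smooth K hKA hidx (IsLocalRing.maximalIdeal A)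
  have hrker : ∀ x : P, x ∈ (IsLocalRing.maximalIdeal A • ⊤ : Submodule A P) ↔ r x = 0 := by
    intro x
    constructor
    · intro hx
      have h1 := Submodule.mem_map_of_mem (f := P.subtype) hx
      rw [hmapP] at h1
      have h2 := (E.red_mk_eq_zero_iff _).mpr (Submodule.smul_mono le_rfl le_top h1)
      change E.red (Submodule.Quotient.mk (x : E.carrier)) = 0 at h2
      rw [hr, ← map_zero θ] at h2
      have h3 := EquivLike.injective θ h2
      rw [← cIndSingle_apply_one hJ hΛ (r x), h3]
      rfl
    · intro hx
      have h1 := hr x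
      rw [hx, map_zero, map_zero, E.red_mk_eq_zero_iff] at h1
      have h2 := hPm ⟨x.2, h1⟩
      change (x : E.carrier) ∈ IsLocalRing.maximalIdeal A • P at h2
      rw [← hmapP] at h2
      obtain ⟨t, ht, e⟩ := h2
      rwa [← show t = x from Subtype.ext e]
  let D : Deformation l Λ A :=
    { carrier := P
      rep := ρP.toRepresentation
      free := by
        have := E.free
        exact Submodule.free_of_inf_smul_le hm P hPm
      smooth := fun x => by
        have h1 : {j : J | ρP.toRepresentation j x = x} =
            Subtype.val ⁻¹' {g : G | E.rep g (x : E.carrier) = x} :=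
          Set.ext fun j => Subtype.ext_iff
        rw [h1]
        exact (E.smooth x).preimage continuous_subtype_val
      red := (QuotientAddGroup.quotientAddEquivOfEq (by
        ext x
        exact hrker x)).trans (QuotientAddGroup.quotientKerEquivOfSurjective r hrsurj)
      red_smul := fun a x => by
        change (θ.symm (E.red (Submodule.Quotient.mk (algebraMap _ A a • (x : E.carrier))))).1 1 =
          _ • (θ.symm (E.red (Submodule.Quotient.mk (x : E.carrier)))).1 1
        rw [E.red_smul, map_smul]
        rfl
      red_rep := fun j x => by
        change r (ρP.toRepresentation j x) = Λ j (r x)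
        have h1 : θ (cIndSingle hJ hΛ (r (ρP.toRepresentation j x))) =
            θ (cIndSingle hJ hΛ (Λ j (r x))) := by
          rw [← hr, ← cInd_cIndSingle, hθ, ← hr]
          exact E.red_rep j x
        have h2 := EquivLike.injective θ h1
        rw [← cIndSingle_apply_one hJ hΛ (r _), h2, cIndSingle_apply_one] }
  -- The inclusion `P → E` extends to the induced representation, and only compatibility with the
  -- reductions remains, to be checked on translates of functions supported on `J`.
  obtain ⟨Ψ, hΨg, hΨ⟩ := exists_cInd_lift hJ D.smooth E.rep P.subtype fun j v => rfl
  suffices hred : ∀ f : (cIndSub J D.rep).toSubmodule,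
      E.red (Submodule.Quotient.mk (Ψ f)) = θ (D.cIndRed f) from
    ⟨D, iso_of_linearMap hm _ _ Ψ hΨg hred⟩
  intro f
  refine cInd_induction hJ D.smooth f ?_ (fun f f' h h' => ?_) fun g v => ?_
  · rw [map_zero Ψ, Submodule.Quotient.mk_zero, map_zero E.red, map_zero D.cIndRed, map_zero θ]
  · rw [map_add Ψ, Submodule.Quotient.mk_add, map_add E.red, h, h', map_add D.cIndRed, map_add θ]
  · rw [hΨg, hΨ, E.red_rep, cIndRed_single hJ hΛ, hθ]
    congr 1
    exact hr v

theorem cIndClasses_bijective [Nontrivial W] (hJ : IsOpen (J : Set G))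
    (θ : (_root_.cInd J Λ).Equiv π) (hm : IsNilpotent (IsLocalRing.maximalIdeal A))
    (hHJ : H ≤ J) (hHo : IsOpen (H : Set G)) (hnorm : ∀ j ∈ J, ∀ h ∈ H, j⁻¹ * h * j ∈ H)
    (hscal : ∀ h : H, ∃ c : k, ∀ v : V, Λ ⟨h, hHJ h.2⟩ v = c • v)
    (hint : ∀ g ∉ J, ∀ v : V,
      (∀ (h : H) (hh : g * h * g⁻¹ ∈ J), Λ ⟨_, hh⟩ v = Λ ⟨h, hHJ h.2⟩ v) → v = 0)
    (hidx : ∀ U : OpenSubgroup G, IsUnit (((U : Subgroup G).relIndex H : ℕ) : A)) :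
    Function.Bijective (cIndClasses hJ θ : Classes l Λ A → Classes l π A) := by
  have := nontrivial_of_equiv_cInd θ
  obtain ⟨χ, hχ⟩ := exists_char_of_scalars (Λ.comp (Subgroup.inclusion hHJ)) hscal
  refine ⟨cIndClasses_injective hJ θ hm, fun b => ?_⟩
  induction b using Quotient.inductionOn with | _ E
  obtain ⟨D, hD⟩ := exists_cInd_iso hJ θ hm hHJ hHo hnorm χ hχ
    (fun g hg v h => hint g hg v fun x hx => (h x hx).trans (hχ x v).symm) hidx E
  exact ⟨Quotient.mk _ D, Quotient.sound hD⟩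

end Deformation

theorem WittVector.isUnit_natCast_of_coprime {l : ℕ} [Fact l.Prime] {k : Type*} [Field k]
    [CharP k l] {n : ℕ} (hn : n.Coprime l) : IsUnit (n : WittVector l k) := by
  refine WittVector.isUnit_of_coeff_zero_ne_zero _ ?_
  have h1 : (n : WittVector l k).coeff 0 = (n : k) := map_natCast WittVector.constantCoeff n
  rw [h1, ne_eq, CharP.cast_eq_zero_iff k l]
  exact (Nat.Prime.coprime_iff_not_dvd Fact.out).mp hn.symm

/-- Finite length makes `A` Artinian, and the Jacobson radical of an Artinian ring is nilpotent. -/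
theorem IsFiniteLength.isNilpotent_maximalIdeal {R A : Type*} [CommRing R] [CommRing A]
    [IsLocalRing A] [Algebra R A] (h : IsFiniteLength R A) :
    IsNilpotent (IsLocalRing.maximalIdeal A) := by
  have := (isFiniteLength_iff_isNoetherian_isArtinian.mp h).2
  have : IsArtinianRing A := isArtinian_of_tower R this
  rw [← IsLocalRing.jacobson_eq_maximalIdeal ⊥ bot_ne_top]
  exact IsArtinianRing.isNilpotent_jacobson_bot

/-! ### Lattices over `𝒪` and the topology of `F` -/

section Local

variable {F : Type u} [Field F] [ValuativeRel F]

theorem irreducible_coe_ne_zero {ϖ : 𝒪[F]} (hϖ : Irreducible ϖ) : (ϖ : F) ≠ 0 := fun h =>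
  hϖ.ne_zero (Subtype.ext h)

theorem integer_smul_def {W : Type*} [AddCommGroup W] [Module F W] (c : 𝒪[F]) (w : W) :
    c • w = (c : F) • w := rfl

variable [TopologicalSpace F] [IsNonarchimedeanLocalField F]

theorem exists_pow_mul_mem_integer {ϖ : 𝒪[F]} (hϖ : Irreducible ϖ) (x : F) :
    ∃ n : ℕ, (ϖ : F) ^ n * x ∈ 𝒪[F] := by
  have h1 := Valuation.integer.v_irreducible_lt_one hϖ
  by_cases hx : x = 0
  · exact ⟨0, by simp [hx, zero_mem]⟩
  have hx' : valuation F x ≠ 0 := (Valuation.ne_zero_iff _).mpr hx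
  obtain ⟨n, hn⟩ := exists_pow_lt₀ h1 (Units.mk0 _ hx')⁻¹
  refine ⟨n, ?_⟩
  change valuation F _ ≤ 1
  rw [map_mul, map_pow]
  rw [Units.val_inv_eq_inv_val, Units.val_mk0] at hn
  calc _ ≤ (valuation F x)⁻¹ * valuation F x := mul_le_mul_left hn.le _
    _ = 1 := inv_mul_cancel₀ hx'

theorem isOpen_integer : IsOpen (𝒪[F] : Set F) := by
  refine AddSubgroup.isOpen_of_mem_nhds (H := 𝒪[F].toAddSubgroup) (g := 0) ?_
  rw [IsValuativeTopology.mem_nhds_zero_iff]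
  refine ⟨1, fun x hx => ?_⟩
  change valuation F x ≤ 1
  exact le_of_lt hx

theorem exists_pow_mul_integer_subset {ϖ : 𝒪[F]} (hϖ : Irreducible ϖ) {U : Set F}
    (hU : U ∈ nhds (0 : F)) : ∃ n : ℕ, ∀ x : 𝒪[F], (ϖ : F) ^ n * x ∈ U := by
  have h1 := Valuation.integer.v_irreducible_lt_one hϖ
  obtain ⟨γ, hγ⟩ := (IsValuativeTopology.mem_nhds_zero_iff U).mp hU
  obtain ⟨n, hn⟩ := exists_pow_lt₀ h1 γ
  refine ⟨n, fun x => hγ ?_⟩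
  change valuation F _ < _
  rw [map_mul, map_pow]
  exact (mul_le_of_le_one_right' x.2).trans_lt hn

variable {W : Type*} [AddCommGroup W] [Module F W]

theorem exists_pow_smul_mem_of_mem_span {ϖ : 𝒪[F]} (hϖ : Irreducible ϖ) (L : Submodule 𝒪[F] W)
    {w : W} (hw : w ∈ Submodule.span F (L : Set W)) : ∃ n : ℕ, (ϖ : F) ^ n • w ∈ L := by
  induction hw using Submodule.span_induction with
  | mem x hx => exact ⟨0, by simpa using hx⟩
  | zero => exact ⟨0, by simp⟩
  | add x y _ _ hx hy =>
    obtain ⟨n, hn⟩ := hx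
    obtain ⟨m, hm⟩ := hy
    refine ⟨n + m, ?_⟩
    rw [smul_add]
    refine add_mem ?_ ?_
    · rw [add_comm n m, pow_add, mul_smul]
      exact L.smul_mem (ϖ ^ m) hn
    · rw [pow_add, mul_smul]
      exact L.smul_mem (ϖ ^ n) hm
  | smul a x _ hx =>
    obtain ⟨n, hn⟩ := hx
    obtain ⟨m, hm⟩ := exists_pow_mul_mem_integer hϖ a
    refine ⟨m + n, ?_⟩
    have e : (ϖ : F) ^ (m + n) • a • x = (⟨_, hm⟩ : 𝒪[F]) • (ϖ : F) ^ n • x := by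
      rw [integer_smul_def, smul_smul, smul_smul, pow_add]
      congr 1
      ring
    rw [e]
    exact L.smul_mem _ hn

theorem exists_pow_smul_mem_of_fg {ϖ : 𝒪[F]} (hϖ : Irreducible ϖ) {L L' : Submodule 𝒪[F] W}
    (hL : L.FG) (hL' : Submodule.span F (L' : Set W) = ⊤) :
    ∃ n : ℕ, ∀ w ∈ L, (ϖ : F) ^ n • w ∈ L' := by
  obtain ⟨s, rfl⟩ := hL
  have h : ∀ w : W, ∃ n : ℕ, (ϖ : F) ^ n • w ∈ L' := fun w =>
    exists_pow_smul_mem_of_mem_span hϖ L' (hL' ▸ Submodule.mem_top)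
  choose n hn using h
  refine ⟨s.sup n, fun w hw => ?_⟩
  induction hw using Submodule.span_induction with
  | mem x hx =>
    obtain ⟨d, hd⟩ := Nat.exists_eq_add_of_le (Finset.le_sup (f := n) hx)
    rw [hd, add_comm, pow_add, mul_smul]
    exact L'.smul_mem (ϖ ^ d) (hn x)
  | zero => simp
  | add x y _ _ hx hy => rw [smul_add]; exact add_mem hx hy
  | smul a x _ hx => rw [smul_comm]; exact L'.smul_mem a hx

theorem isOpen_of_span_eq_top {ι : Type*} [Finite ι] (L : Submodule 𝒪[F] (ι → F))
    (hL : Submodule.span F (L : Set (ι → F)) = ⊤) : IsOpen (L : Set (ι → F)) := by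
  classical
  have := Fintype.ofFinite ι
  obtain ⟨ϖ, hϖ⟩ := IsDiscreteValuationRing.exists_irreducible 𝒪[F]
  have h0 := irreducible_coe_ne_zero hϖ
  have h : ∀ j : ι, ∃ n : ℕ, (ϖ : F) ^ n • Pi.single j (1 : F) ∈ L := fun j =>
    exists_pow_smul_mem_of_mem_span hϖ L (hL ▸ Submodule.mem_top)
  choose n hn using h
  refine AddSubgroup.isOpen_of_mem_nhds (H := L.toAddSubgroup) (g := 0) ?_
  -- The open box `∏ ϖ^{n_j} 𝒪` is contained in `L`.
  have hopen : IsOpen {v : ι → F | ∀ j, ((ϖ : F) ^ n j)⁻¹ * v j ∈ 𝒪[F]} := by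
    rw [Set.ofPred_forall]
    exact isOpen_iInter_of_finite fun j => isOpen_integer.preimage (by fun_prop)
  refine Filter.mem_of_superset (hopen.mem_nhds fun j => by simp [zero_mem]) fun v hv => ?_
  have e : v = ∑ j, (⟨_, hv j⟩ : 𝒪[F]) • ((ϖ : F) ^ n j • Pi.single j (1 : F)) := by
    ext i
    rw [Finset.sum_apply, Finset.sum_eq_single i]
    · simp only [integer_smul_def, Pi.smul_apply, Pi.single_eq_same, smul_eq_mul, mul_one]
      rw [mul_comm, mul_inv_cancel_left₀ (pow_ne_zero _ h0)]
    · intro j _ hj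
      simp [Ne.symm hj]
    · simp
  rw [e]
  exact L.toAddSubgroup.sum_mem fun j _ => L.smul_mem _ (hn j)

end Local

/-! ### Lattice chains: periodicity and cofinality -/

namespace LatticeChain

variable {F : Type u} [Field F] [ValuativeRel F] [TopologicalSpace F]
  [IsNonarchimedeanLocalField F] (L : LatticeChain F) {ϖ : 𝒪[F]} (hϖ : Irreducible ϖ)

theorem antitone_lattice : Antitone L.lattice := L.strictAnti.antitone

include hϖ in
theorem mem_add_period_iff (i : ℤ) (v : Fin 2 → F) :
    v ∈ L.lattice (i + L.period) ↔ (ϖ : F)⁻¹ • v ∈ L.lattice i := by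
  have h0 := irreducible_coe_ne_zero hϖ
  rw [L.lattice_add_period, hϖ.maximalIdeal_eq, Submodule.ideal_span_singleton_smul,
    Submodule.mem_smul_pointwise_iff_exists]
  constructor
  · rintro ⟨w, hw, rfl⟩
    rwa [integer_smul_def, inv_smul_smul₀ h0]
  · intro h
    exact ⟨_, h, smul_inv_smul₀ h0 v⟩

include hϖ in
theorem mem_add_mul_period_iff (i t : ℤ) (v : Fin 2 → F) :
    v ∈ L.lattice (i + L.period * t) ↔ (ϖ : F) ^ (-t) • v ∈ L.lattice i := by
  have h0 := irreducible_coe_ne_zero hϖ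
  induction t using Int.induction_on generalizing v with
  | zero => simp
  | succ t ih =>
    rw [mul_add, mul_one, ← add_assoc, L.mem_add_period_iff hϖ]
    refine (ih _).trans ?_
    rw [smul_smul, ← zpow_neg_one, ← zpow_add₀ h0, neg_add]
  | pred t ih =>
    have h1 := L.mem_add_period_iff hϖ (i + L.period * (-t - 1)) ((ϖ : F) • v)
    rw [inv_smul_smul₀ h0] at h1
    rw [← h1, mul_sub, mul_one, add_assoc, sub_add_cancel]
    refine (ih _).trans ?_
    rw [smul_smul, ← zpow_add_one₀ h0]
    congr! 3
    ring

include hϖ in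
theorem smul_zpow_mem_iff (i t : ℤ) (v : Fin 2 → F) :
    (ϖ : F) ^ t • v ∈ L.lattice (i + L.period * t) ↔ v ∈ L.lattice i := by
  have h0 := irreducible_coe_ne_zero hϖ
  rw [L.mem_add_mul_period_iff hϖ, smul_smul, ← zpow_add₀ h0, neg_add_cancel, zpow_zero, one_smul]

theorem exists_mem_lattice (v : Fin 2 → F) : ∃ i, v ∈ L.lattice i := by
  obtain ⟨ϖ, hϖ⟩ := IsDiscreteValuationRing.exists_irreducible 𝒪[F]
  obtain ⟨n, hn⟩ := exists_pow_smul_mem_of_mem_span hϖ (L.lattice 0) (w := v)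
    (L.span_eq_top 0 ▸ Submodule.mem_top)
  refine ⟨0 + L.period * (-n), ?_⟩
  rw [L.mem_add_mul_period_iff hϖ, neg_neg]
  simpa using hn

theorem exists_lattice_le (N : Submodule 𝒪[F] (Fin 2 → F)) (hN : N.FG) :
    ∃ i, N ≤ L.lattice i := by
  obtain ⟨s, rfl⟩ := hN
  choose i hi using L.exists_mem_lattice
  obtain ⟨j, hj⟩ := (s.image i).bddBelow
  refine ⟨j, Submodule.span_le.mpr fun v hv => L.antitone_lattice (hj ?_) (hi v)⟩
  exact_mod_cast Finset.mem_image_of_mem i hv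

theorem exists_le_lattice (N : Submodule 𝒪[F] (Fin 2 → F))
    (hN : Submodule.span F (N : Set (Fin 2 → F)) = ⊤) : ∃ i, L.lattice i ≤ N := by
  obtain ⟨ϖ, hϖ⟩ := IsDiscreteValuationRing.exists_irreducible 𝒪[F]
  obtain ⟨n, hn⟩ := exists_pow_smul_mem_of_fg hϖ (L.fg 0) hN
  refine ⟨0 + L.period * n, fun v hv => ?_⟩
  rw [L.mem_add_mul_period_iff hϖ] at hv
  have := hn _ hv
  rwa [← zpow_natCast, smul_smul, ← zpow_add₀ (irreducible_coe_ne_zero hϖ), add_neg_cancel,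
    zpow_zero, one_smul] at this

/-- A neighbourhood of `0` contains a box `∏ ϖ^{n_i} 𝒪`, which spans `F²` over `F` and so contains a
member of the chain. -/
theorem exists_lattice_subset {U : Set (Fin 2 → F)} (hU : U ∈ nhds 0) :
    ∃ i, (L.lattice i : Set (Fin 2 → F)) ⊆ U := by
  obtain ⟨ϖ, hϖ⟩ := IsDiscreteValuationRing.exists_irreducible 𝒪[F]
  have h0 := irreducible_coe_ne_zero hϖ
  rw [nhds_pi, Filter.mem_pi'] at hU
  obtain ⟨I, t, ht, hI⟩ := hU
  choose n hn using fun i => exists_pow_mul_integer_subset hϖ (ht i)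
  let N : Submodule 𝒪[F] (Fin 2 → F) :=
    Submodule.pi Set.univ fun i => (Submodule.span 𝒪[F] {(ϖ : F) ^ n i})
  obtain ⟨i, hi⟩ := L.exists_le_lattice N (by
    rw [eq_top_iff]
    intro w _
    rw [← Finset.univ_sum_single w]
    refine Submodule.sum_mem _ fun i _ => ?_
    have e : (Pi.single i (w i) : Fin 2 → F) =
        (w i / (ϖ : F) ^ n i) • Pi.single i ((ϖ : F) ^ n i) := by
      rw [← Pi.single_smul, smul_eq_mul, div_mul_cancel₀ _ (pow_ne_zero _ h0)]
    rw [e]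
    refine Submodule.smul_mem _ _ (Submodule.subset_span ?_)
    intro i' _
    by_cases h : i' = i
    · subst h
      simp
    · rw [Pi.single_eq_of_ne h]
      exact zero_mem _)
  refine ⟨i, fun v hv => hI fun j _ => ?_⟩
  obtain ⟨c, hc⟩ := Submodule.mem_span_singleton.mp (hi hv j trivial)
  rw [← hc, integer_smul_def, smul_eq_mul, mul_comm]
  exact hn j c

theorem eq_zero_of_forall_mem_lattice {v : Fin 2 → F} (hv : ∀ i, v ∈ L.lattice i) : v = 0 := by
  by_contra h0
  obtain ⟨j, hj⟩ : ∃ j, v j ≠ 0 := by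
    by_contra! h
    exact h0 (funext h)
  have h1 : {x : F | valuation F x < valuation F (v j)} ∈ nhds (0 : F) :=
    (IsValuativeTopology.mem_nhds_zero_iff _).mpr
      ⟨Units.mk0 _ ((Valuation.ne_zero_iff _).mpr hj), subset_rfl⟩
  have h2 : Filter.Tendsto (fun w : Fin 2 → F => w j) (nhds 0) (nhds 0) :=
    (continuous_apply j).tendsto 0
  obtain ⟨i, hi⟩ := L.exists_lattice_subset (h2 h1)
  exact lt_irrefl _ (show valuation F (v j) < valuation F (v j) from hi (hv i))

end LatticeChain

/-! ### The filtrations `𝔓^m` and `U^m` -/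

namespace LatticeChain

variable {F : Type u} [Field F] [ValuativeRel F] [TopologicalSpace F]
  [IsNonarchimedeanLocalField F] (L : LatticeChain F) {ϖ : 𝒪[F]}

theorem radPow_antitone : Antitone L.radPow := fun _ _ h _ hx i v hv =>
  L.antitone_lattice (add_le_add_right h i) (hx i v hv)

theorem mul_mem_radPow {a b : ℤ} {x y : Matrix (Fin 2) (Fin 2) F} (hx : x ∈ L.radPow a)
    (hy : y ∈ L.radPow b) : x * y ∈ L.radPow (a + b) := by
  intro i v hv
  rw [← Matrix.mulVec_mulVec, add_comm a b, ← add_assoc]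
  exact hx _ _ (hy i v hv)

theorem mul_mem_radPow' {a b c : ℤ} {x y : Matrix (Fin 2) (Fin 2) F} (hx : x ∈ L.radPow a)
    (hy : y ∈ L.radPow b) (h : c ≤ a + b) : x * y ∈ L.radPow c :=
  L.radPow_antitone h (L.mul_mem_radPow hx hy)

theorem one_mem_radPow : (1 : Matrix (Fin 2) (Fin 2) F) ∈ L.radPow 0 := fun i v hv => by
  simpa using hv

theorem smul_mem_radPow (c : 𝒪[F]) {m : ℤ} {x : Matrix (Fin 2) (Fin 2) F} (hx : x ∈ L.radPow m) :
    (c : F) • x ∈ L.radPow m := fun i v hv => by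
  rw [Matrix.smul_mulVec]
  exact (L.lattice _).smul_mem c (hx i v hv)

/-- The power `𝔓^m` as an `𝒪`-submodule. -/
def radPowSubmodule (m : ℤ) : Submodule 𝒪[F] (Matrix (Fin 2) (Fin 2) F) where
  __ := L.radPow m
  smul_mem' c _ hx := L.smul_mem_radPow c hx

theorem smul_zpow_mem_radPow (hϖ : Irreducible ϖ) {m : ℤ} (t : ℤ)
    {x : Matrix (Fin 2) (Fin 2) F} (hx : x ∈ L.radPow m) :
    (ϖ : F) ^ t • x ∈ L.radPow (m + L.period * t) := fun i v hv => by
  rw [Matrix.smul_mulVec, ← add_assoc, L.smul_zpow_mem_iff hϖ]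
  exact hx i v hv

/-- Membership in `𝔓^m` can be checked on one period of the chain. -/
theorem mem_radPow_of_period {m : ℤ} {x : Matrix (Fin 2) (Fin 2) F}
    (h : ∀ i : ℤ, 0 ≤ i → i < L.period → ∀ v ∈ L.lattice i, x.mulVec v ∈ L.lattice (i + m)) :
    x ∈ L.radPow m := by
  obtain ⟨ϖ, hϖ⟩ := IsDiscreteValuationRing.exists_irreducible 𝒪[F]
  intro i v hv
  have hp : (0 : ℤ) < L.period := by exact_mod_cast L.period_pos
  have h1 := h (i % L.period) (Int.emod_nonneg _ hp.ne') (Int.emod_lt_of_pos _ hp)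
    ((ϖ : F) ^ (-(i / L.period)) • v) (by
      rw [← L.mem_add_mul_period_iff hϖ, Int.emod_add_mul_ediv]
      exact hv)
  rw [Matrix.mulVec_smul, ← L.mem_add_mul_period_iff hϖ] at h1
  have e : i % L.period + m + L.period * (i / L.period) = i + m := by
    rw [add_right_comm, Int.emod_add_mul_ediv]
  rwa [e] at h1

instance (i : ℤ) : Module.Finite 𝒪[F] (L.lattice i) := Module.Finite.of_fg (L.fg i)

theorem exists_single_mem : ∃ i, ∀ j, (Pi.single j 1 : Fin 2 → F) ∈ L.lattice i := by
  choose i hi using fun j : Fin 2 => L.exists_mem_lattice (Pi.single j 1)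
  exact ⟨min (i 0) (i 1), Fin.forall_fin_two.mpr ⟨L.antitone_lattice (min_le_left _ _) (hi 0),
    L.antitone_lattice (min_le_right _ _) (hi 1)⟩⟩

/-- The two columns embed `𝔓^m` in a finitely generated module over the Noetherian ring `𝒪`. -/
theorem fg_radPowSubmodule (m : ℤ) : (L.radPowSubmodule m).FG := by
  obtain ⟨i, hi⟩ := L.exists_single_mem
  let f : L.radPowSubmodule m →ₗ[𝒪[F]] (Fin 2 → L.lattice (i + m)) :=
    { toFun := fun x j => ⟨x.1.mulVec (Pi.single j 1), x.2 i _ (hi j)⟩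
      map_add' := fun x y => by
        ext j : 2
        exact Matrix.add_mulVec x.1 y.1 _
      map_smul' := fun c x => by
        ext j : 2
        exact Matrix.smul_mulVec (c : F) x.1 _ }
  have hf : Function.Injective f := by
    intro x y h
    refine Subtype.ext (Matrix.ext fun a b => ?_)
    have := congrFun (congrArg Subtype.val (congrFun h b)) a
    simpa [f] using this
  have := isNoetherian_of_injective f hf
  exact Module.Finite.iff_fg.mp inferInstance

/-- Membership amounts to finitely many open conditions, one for each generator of each lattice in
one period. -/
theorem isOpen_radPow (m : ℤ) : IsOpen (L.radPow m : Set (Matrix (Fin 2) (Fin 2) F)) := by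
  choose s hs using L.fg
  have h : (L.radPow m : Set (Matrix (Fin 2) (Fin 2) F)) =
      ⋂ i ∈ Finset.Ico (0 : ℤ) L.period, ⋂ v ∈ s i, {x | x.mulVec v ∈ L.lattice (i + m)} := by
    ext x
    simp only [Set.mem_iInter, Finset.mem_Ico]
    constructor
    · intro hx i _ v hv
      exact hx i v (hs i ▸ Submodule.subset_span hv)
    · intro hx
      refine L.mem_radPow_of_period fun i h1 h2 v hv => ?_
      rw [← hs i] at hv
      induction hv using Submodule.span_induction with
      | mem v hv => exact hx i ⟨h1, h2⟩ v hv
      | zero => simp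
      | add v w _ _ hv hw => rw [Matrix.mulVec_add]; exact add_mem hv hw
      | smul a v _ hv =>
        rw [integer_smul_def, Matrix.mulVec_smul]
        exact (L.lattice _).smul_mem a hv
  rw [h]
  refine isOpen_biInter_finset fun i _ => isOpen_biInter_finset fun v _ => ?_
  exact (isOpen_of_span_eq_top _ (L.span_eq_top _)).preimage
    (continuous_id.matrix_mulVec continuous_const)

theorem exists_radPow_subset {U : Set (Matrix (Fin 2) (Fin 2) F)} (hU : U ∈ nhds 0) :
    ∃ m, (L.radPow m : Set (Matrix (Fin 2) (Fin 2) F)) ⊆ U := by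
  obtain ⟨i, hi⟩ := L.exists_single_mem
  let φ : (Fin 2 → Fin 2 → F) → Matrix (Fin 2) (Fin 2) F := fun f => Matrix.of fun a b => f b a
  have hφ : Continuous φ := by fun_prop
  have h1 : φ ⁻¹' U ∈ nhds (0 : Fin 2 → Fin 2 → F) := hφ.continuousAt.preimage_mem_nhds hU
  rw [nhds_pi, Filter.mem_pi'] at h1
  obtain ⟨I, t, ht, hI⟩ := h1
  choose n hn using fun j => L.exists_lattice_subset (ht j)
  -- The basis vectors lie in `L_i`, so the columns of `x ∈ 𝔓^m` lie in `L_{i+m}`; this `m` makes `i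
  -- + m` at least both `n 0` and `n 1`.
  refine ⟨max (n 0) (n 1) - i, fun x hx => ?_⟩
  have h2 : (fun j => x.mulVec (Pi.single j 1)) ∈ (I : Set (Fin 2)).pi t := by
    intro j _
    refine hn j (L.antitone_lattice ?_ (hx i _ (hi j)))
    rw [add_sub_cancel]
    fin_cases j
    · exact le_max_left _ _
    · exact le_max_right _ _
  have h3 : φ (fun j => x.mulVec (Pi.single j 1)) = x := by
    ext a b
    simp [φ]
  have h4 := hI h2
  rwa [Set.mem_preimage, h3] at h4

theorem unitGroup_antitone : Antitone L.unitGroup := fun _ _ h _ hg =>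
  ⟨L.radPow_antitone (by exact_mod_cast h) hg.1, L.radPow_antitone (by exact_mod_cast h) hg.2⟩

theorem isOpen_unitGroup (m : ℕ) : IsOpen (L.unitGroup m : Set (GL (Fin 2) F)) := by
  have h1 := (L.isOpen_radPow m).preimage
    (f := fun g : GL (Fin 2) F => (g : Matrix (Fin 2) (Fin 2) F) - 1)
    (Units.continuous_val.sub continuous_const)
  have h2 := (L.isOpen_radPow m).preimage
    (f := fun g : GL (Fin 2) F => ((g⁻¹ : GL (Fin 2) F) : Matrix (Fin 2) (Fin 2) F) - 1)
    (Units.continuous_coe_inv.sub continuous_const)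
  exact h1.inter h2

theorem exists_unitGroup_le (U : OpenSubgroup (GL (Fin 2) F)) :
    ∃ m : ℕ, L.unitGroup m ≤ U := by
  have hU : (U : Set (GL (Fin 2) F)) ∈ nhds 1 := U.mem_nhds_one
  -- The topology on units controls both `g` and `g⁻¹`, as does the definition of `unitGroup`.
  rw [Units.isInducing_embedProduct.nhds_eq_comap, Filter.mem_comap] at hU
  obtain ⟨S, hS, hSU⟩ := hU
  rw [Units.embedProduct_apply, nhds_prod_eq, Filter.mem_prod_iff] at hS
  obtain ⟨S₁, h1, S₂, h2, hS12⟩ := hS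
  have h1' : (fun x => 1 + x) ⁻¹' S₁ ∈ nhds (0 : Matrix (Fin 2) (Fin 2) F) :=
    ContinuousAt.preimage_mem_nhds (by fun_prop) (by simpa using h1)
  have h2' : (fun x => MulOpposite.op (1 + x)) ⁻¹' S₂ ∈ nhds (0 : Matrix (Fin 2) (Fin 2) F) :=
    ContinuousAt.preimage_mem_nhds (MulOpposite.continuous_op.comp
      (continuous_const.add continuous_id)).continuousAt (by simpa using h2)
  obtain ⟨m, hm⟩ := L.exists_radPow_subset (Filter.inter_mem h1' h2')
  refine ⟨m.toNat, fun g hg => hSU (hS12 ⟨?_, ?_⟩)⟩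
  · have := (hm (L.radPow_antitone (Int.self_le_toNat m) hg.1)).1
    simpa using this
  · have := (hm (L.radPow_antitone (Int.self_le_toNat m) hg.2)).2
    simpa using this

/-- `1 + x` is invertible for `x ∈ 𝔓^m`, `m ≥ 1`, and lies in `U^m`. -/
theorem exists_mem_unitGroup {m : ℕ} (hm : 1 ≤ m) {x : Matrix (Fin 2) (Fin 2) F}
    (hx : x ∈ L.radPow m) : ∃ g ∈ L.unitGroup m, (g : Matrix (Fin 2) (Fin 2) F) = 1 + x := by
  let f : (Fin 2 → F) →ₗ[𝒪[F]] (Fin 2 → F) := (Matrix.mulVecLin (1 + x)).restrictScalars 𝒪[F]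
  have hf : ∀ v, f v = v + x.mulVec v := fun v => by simp [f]
  -- Writing `v = (1 + x) v - x v` pushes the error at least one step down the chain. After a full
  -- period it lies in `𝔪 L_i`, and Nakayama's lemma applies.
  have h1 : ∀ (i : ℤ) (t : ℕ), L.lattice i ≤ (L.lattice i).map f ⊔ L.lattice (i + t) := by
    intro i t
    induction t with
    | zero => simp
    | succ t ih =>
      refine ih.trans (sup_le le_sup_left fun v hv => ?_)
      have e : v = f v - x.mulVec v := by rw [hf, add_sub_cancel_right]
      rw [e]
      refine sub_mem (Submodule.mem_sup_left ⟨v, L.antitone_lattice (by simp) hv, rfl⟩)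
        (Submodule.mem_sup_right (L.antitone_lattice ?_ (hx _ v hv)))
      push_cast
      have : (1 : ℤ) ≤ m := by exact_mod_cast hm
      linarith
  have h2 : ∀ i, L.lattice i ≤ (L.lattice i).map f := fun i => by
    refine Submodule.le_of_le_smul_of_le_jacobson_bot (I := 𝓂[F]) (L.fg i)
      (IsLocalRing.maximalIdeal_le_jacobson _) ?_
    rw [← L.lattice_add_period]
    exact h1 i L.period
  have h3 : Function.Surjective (1 + x).mulVec := by
    intro v
    obtain ⟨i, hi⟩ := L.exists_mem_lattice v
    obtain ⟨w, -, hw⟩ := h2 i hi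
    exact ⟨w, hw⟩
  obtain ⟨g, hg⟩ := Matrix.mulVec_surjective_iff_isUnit.mp h3
  have h4 : ((g⁻¹ : GL (Fin 2) F) : Matrix (Fin 2) (Fin 2) F) ∈ L.radPow 0 := by
    intro i v hv
    obtain ⟨w, hw, rfl⟩ := h2 i hv
    have e : f w = (g : Matrix (Fin 2) (Fin 2) F).mulVec w := by rw [hg]; rfl
    rw [e, Matrix.mulVec_mulVec, Units.inv_mul, Matrix.one_mulVec, add_zero]
    exact hw
  refine ⟨g, ⟨?_, ?_⟩, hg⟩
  · rwa [hg, add_sub_cancel_left]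
  · have e : ((g⁻¹ : GL (Fin 2) F) : Matrix (Fin 2) (Fin 2) F) - 1 =
        -(((g⁻¹ : GL (Fin 2) F) : Matrix (Fin 2) (Fin 2) F) * x) := by
      have : x = g - 1 := by rw [hg, add_sub_cancel_left]
      rw [this, mul_sub, Units.inv_mul, mul_one, neg_sub]
    rw [e]
    exact neg_mem (L.mul_mem_radPow' h4 hx (by simp))

theorem mem_unitGroup_iff {m : ℕ} (hm : 1 ≤ m) {g : GL (Fin 2) F} :
    g ∈ L.unitGroup m ↔ (g : Matrix (Fin 2) (Fin 2) F) - 1 ∈ L.radPow m := by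
  refine ⟨fun h => h.1, fun h => ?_⟩
  obtain ⟨g', hg', e⟩ := L.exists_mem_unitGroup hm h
  rw [add_sub_cancel] at e
  rwa [← Units.ext e]

theorem coe_mem_radPow_zero {m : ℕ} {g : GL (Fin 2) F} (hg : g ∈ L.unitGroup m) :
    (g : Matrix (Fin 2) (Fin 2) F) ∈ L.radPow 0 := by
  rw [← sub_add_cancel (g : Matrix (Fin 2) (Fin 2) F) 1]
  exact add_mem (L.radPow_antitone (by positivity) hg.1) L.one_mem_radPow

/-- The indices of the open subgroups of `U^m` are powers of `p`, for `m ≥ 1`. -/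
theorem exists_relIndex_unitGroup_succ (p : ℕ) [Fact p.Prime] [CharP 𝓀[F] p] {m : ℕ}
    (hm : 1 ≤ m) : ∃ n, (L.unitGroup (m + 1)).relIndex (L.unitGroup m) = p ^ n := by
  let P := L.radPowSubmodule m
  let Q : Submodule 𝒪[F] P := (L.radPowSubmodule ((m + 1 : ℕ) : ℤ)).comap P.subtype
  have hpQ : 𝓂[F] • (⊤ : Submodule 𝒪[F] P) ≤ Q := by
    rw [Submodule.smul_le]
    rintro c hc ⟨x, hx⟩ -
    change (c : F) • x ∈ L.radPow _
    intro i v hv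
    rw [Matrix.smul_mulVec]
    have h1 := Submodule.smul_mem_smul hc (hx i v hv)
    rw [← L.lattice_add_period] at h1
    refine L.antitone_lattice ?_ h1
    have : (1 : ℤ) ≤ L.period := by exact_mod_cast L.period_pos
    push_cast
    linarith
  have : Finite (𝒪[F] ⧸ 𝓂[F]) := inferInstanceAs (Finite 𝓀[F])
  have : Module.Finite 𝒪[F] P := Module.Finite.of_fg (L.fg_radPowSubmodule m)
  have : Finite (P ⧸ (𝓂[F] • (⊤ : Submodule 𝒪[F] P))) :=
    Submodule.finite_quotient_smul 𝓂[F] Module.Finite.fg_top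
  have hfin : Finite (P ⧸ Q) := Finite.of_surjective _ (Submodule.factor_surjective hpQ)
  have hp : (p : 𝒪[F]) ∈ 𝓂[F] := by
    rw [← IsLocalRing.residue_eq_zero_iff, map_natCast]
    exact CharP.cast_eq_zero _ _
  have hpgroup : IsPGroup p (Multiplicative (P ⧸ Q)) := by
    intro q
    refine ⟨1, ?_⟩
    obtain ⟨x, hx⟩ := Submodule.Quotient.mk_surjective Q q.toAdd
    refine Multiplicative.toAdd.injective ?_
    rw [pow_one, toAdd_pow, toAdd_one, ← hx, ← Submodule.Quotient.mk_smul,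
      Submodule.Quotient.mk_eq_zero, ← Nat.cast_smul_eq_nsmul 𝒪[F]]
    exact hpQ (Submodule.smul_mem_smul hp trivial)
  -- The map `1 + x ↦ x` is multiplicative modulo `𝔓^{m+1}`, since `(1+x)(1+y) - 1 - x - y = x y`
  -- lies in `𝔓^{2m}` and `m ≥ 1`. Its target `𝔓^m / 𝔓^{m+1}` is finite and killed by `p`.
  let f : L.unitGroup m →* Multiplicative (P ⧸ Q) :=
    { toFun := fun g => Multiplicative.ofAdd (Submodule.Quotient.mk ⟨_, g.2.1⟩)
      map_one' := by
        refine Multiplicative.toAdd.injective ?_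
        rw [toAdd_ofAdd, toAdd_one, Submodule.Quotient.mk_eq_zero]
        change ((1 : GL (Fin 2) F) : Matrix (Fin 2) (Fin 2) F) - 1 ∈ L.radPow _
        rw [Units.val_one, sub_self]
        exact zero_mem _
      map_mul' := fun a b => by
        refine Multiplicative.toAdd.injective ?_
        rw [toAdd_mul, toAdd_ofAdd, toAdd_ofAdd, toAdd_ofAdd, ← Submodule.Quotient.mk_add,
          Submodule.Quotient.eq]
        change (a.1 * b.1 - 1 : Matrix (Fin 2) (Fin 2) F) - (a.1 - 1 + (b.1 - 1)) ∈ L.radPow _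
        have e : (a.1 * b.1 - 1 : Matrix (Fin 2) (Fin 2) F) - (a.1 - 1 + (b.1 - 1)) =
            (a.1 - 1) * (b.1 - 1) := by noncomm_ring
        rw [e]
        refine L.mul_mem_radPow' a.2.1 b.2.1 ?_
        push_cast
        have : (1 : ℤ) ≤ m := by exact_mod_cast hm
        linarith }
  have hker : f.ker = (L.unitGroup (m + 1)).subgroupOf (L.unitGroup m) := by
    ext g
    rw [Subgroup.mem_subgroupOf, L.mem_unitGroup_iff (by lia), MonoidHom.mem_ker]
    change Multiplicative.ofAdd _ = Multiplicative.ofAdd 0 ↔ _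
    rw [Multiplicative.ofAdd.injective.eq_iff, Submodule.Quotient.mk_eq_zero]
    rfl
  rw [Subgroup.relIndex, ← hker, Subgroup.index_ker]
  have : Finite f.range := Subtype.finite
  exact IsPGroup.iff_card.mp (hpgroup.to_subgroup f.range)

theorem exists_relIndex_unitGroup_add (p : ℕ) [Fact p.Prime] [CharP 𝓀[F] p] {m : ℕ}
    (hm : 1 ≤ m) (t : ℕ) : ∃ n, (L.unitGroup (m + t)).relIndex (L.unitGroup m) = p ^ n := by
  induction t with
  | zero => exact ⟨0, by simp⟩
  | succ t ih =>
    obtain ⟨n, hn⟩ := ih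
    obtain ⟨n', hn'⟩ := L.exists_relIndex_unitGroup_succ p (m := m + t) (by lia)
    refine ⟨n' + n, ?_⟩
    rw [← Subgroup.relIndex_mul_relIndex (L.unitGroup (m + (t + 1))) (L.unitGroup (m + t)) _
      (L.unitGroup_antitone (by lia)) (L.unitGroup_antitone (by lia)), hn, ← add_assoc, hn', pow_add]

/-- The open subgroup contains some `U^{m+t}`, so its index divides a power of `p`. -/
theorem coprime_relIndex (p l : ℕ) [Fact p.Prime] [CharP 𝓀[F] p] (hl : l.Prime) (hlp : l ≠ p)
    {m : ℕ} (hm : 1 ≤ m) (U : OpenSubgroup (GL (Fin 2) F)) :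
    ((U : Subgroup (GL (Fin 2) F)).relIndex (L.unitGroup m)).Coprime l := by
  obtain ⟨t, ht⟩ := L.exists_unitGroup_le U
  obtain ⟨n, hn⟩ := L.exists_relIndex_unitGroup_add p hm t
  have h1 : (U : Subgroup (GL (Fin 2) F)).relIndex (L.unitGroup m) ∣ p ^ n := by
    rw [← hn]
    exact Subgroup.relIndex_dvd_of_le_left _ ((L.unitGroup_antitone (by lia)).trans ht)
  exact Nat.Coprime.coprime_dvd_left h1
    (Nat.Coprime.pow_left n ((Nat.coprime_primes Fact.out hl).mpr hlp.symm))

end LatticeChain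

/-! ### Separation from lattices and duality for the trace form -/

section Separation

variable {F : Type u} [Field F] [ValuativeRel F]

theorem mem_maximalIdeal_iff_valuation_lt_one {x : 𝒪[F]} : x ∈ 𝓂[F] ↔ valuation F x < 1 := by
  rw [IsLocalRing.mem_maximalIdeal, mem_nonunits_iff,
    Valuation.integer.integers (valuation F) |>.isUnit_iff_valuation_eq_one]
  exact (lt_iff_le_and_ne.trans (and_iff_right x.2)).symm

variable [TopologicalSpace F] [IsNonarchimedeanLocalField F]

theorem exists_eq_mul_of_valuation_lt_one {ϖ : 𝒪[F]} (hϖ : Irreducible ϖ) {x : F}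
    (hx : valuation F x < 1) : ∃ c : 𝒪[F], x = ϖ * c := by
  have h1 : (⟨x, hx.le⟩ : 𝒪[F]) ∈ 𝓂[F] := mem_maximalIdeal_iff_valuation_lt_one.mpr hx
  rw [hϖ.maximalIdeal_eq, Ideal.mem_span_singleton] at h1
  obtain ⟨c, hc⟩ := h1
  exact ⟨c, congrArg Subtype.val hc⟩

/-- A point outside a finitely generated `𝒪`-submodule can be separated from it by a linear form
that is small on the submodule. -/
theorem exists_separating_form {W : Type*} [AddCommGroup W] [Module F W]
    {N : Submodule 𝒪[F] W} (hN : N.FG) {w : W} (hw : w ∉ N) :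
    ∃ f : W →ₗ[F] F, f w = 1 ∧ ∀ x ∈ N, valuation F (f x) < 1 := by
  have : Module.Finite 𝒪[F] N := Module.Finite.of_fg hN
  have : Module.IsTorsionFree 𝒪[F] W := Module.IsTorsionFree.trans_faithfulSMul 𝒪[F] F W
  -- A basis of `N` over `𝒪` is extended to a basis of `W` over `F`. Then `N` consists of the
  -- vectors with integral coordinates along `b` and zero coordinates elsewhere.
  let b := Module.Free.chooseBasis 𝒪[F] N
  have hb : LinearIndependent F (fun i => (b i : W)) :=
    (LinearIndependent.iff_fractionRing 𝒪[F] F).mp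
      (b.linearIndependent.map' N.subtype N.ker_subtype)
  let B := Module.Basis.sumExtend hb
  have hB : ∀ i, B (Sum.inl i) = b i := fun i => by
    simp only [B, Module.Basis.sumExtend, Module.Basis.reindex_apply,
      Module.Basis.extend_apply_self]
    rfl
  have hrepr : ∀ x : N, B.repr x = Finsupp.mapDomain Sum.inl
      ((b.repr x).mapRange (algebraMap 𝒪[F] F) (map_zero _)) := by
    intro x
    refine B.repr.symm.injective ?_
    rw [LinearEquiv.symm_apply_apply, Module.Basis.repr_symm_apply,
      Finsupp.linearCombination_mapDomain]
    have h1 := congrArg Subtype.val (b.linearCombination_repr x)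
    rw [Finsupp.linearCombination_apply, Finsupp.sum, AddSubmonoidClass.coe_finsetSum] at h1
    rw [Finsupp.linearCombination_apply, Finsupp.sum_mapRange_index (by simp), Finsupp.sum, ← h1]
    refine Finset.sum_congr rfl fun i _ => ?_
    rw [Function.comp_apply, hB]
    rfl
  -- If no coordinate of `w` dominated that coordinate on all of `N`, those along `b` would be
  -- integral and the others zero, so `w` would lie in `N`.
  have key : ∃ j, B.repr w j ≠ 0 ∧
      ∀ x ∈ N, valuation F (B.repr x j) < valuation F (B.repr w j) := by
    by_contra! hcon
    have h1 : ∀ i, B.repr w (Sum.inr i) = 0 := by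
      intro i
      by_contra h
      obtain ⟨x, hx, hlt⟩ := hcon _ h
      rw [hrepr ⟨x, hx⟩, Finsupp.mapDomain_of_notMem_range _ _ (by simp), map_zero] at hlt
      exact h ((map_eq_zero _).mp (le_zero_iff.mp hlt))
    have h2 : ∀ i, B.repr w (Sum.inl i) ∈ 𝒪[F] := by
      intro i
      by_cases h : B.repr w (Sum.inl i) = 0
      · rw [h]
        exact zero_mem _
      obtain ⟨x, hx, hlt⟩ := hcon _ h
      rw [hrepr ⟨x, hx⟩, Finsupp.mapDomain_apply Sum.inl_injective, Finsupp.mapRange_apply] at hlt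
      exact hlt.trans (show valuation F (b.repr ⟨x, hx⟩ i : F) ≤ 1 from (b.repr ⟨x, hx⟩ i).2)
    refine hw ?_
    rw [← B.linearCombination_repr w, Finsupp.linearCombination_apply]
    refine Submodule.sum_mem _ fun j _ => ?_
    beta_reduce
    rcases j with i | i
    · rw [hB]
      exact N.smul_mem ⟨_, h2 i⟩ (b i).2
    · rw [h1, zero_smul]
      exact zero_mem _
  obtain ⟨j, hj, hlt⟩ := key
  refine ⟨(B.repr w j)⁻¹ • B.coord j, ?_, fun x hx => ?_⟩
  · simp [hj]
  · rw [LinearMap.smul_apply, Module.Basis.coord_apply, smul_eq_mul, map_mul, map_inv₀,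
      inv_mul_lt_iff₀ (zero_lt_iff.mpr ((Valuation.ne_zero_iff _).mpr hj)), mul_one]
    exact hlt x hx

end Separation

namespace LatticeChain

variable {F : Type u} [Field F] [ValuativeRel F] [TopologicalSpace F]
  [IsNonarchimedeanLocalField F] (L : LatticeChain F)

/-- The dual of `𝔓^m` for the trace form is `𝔓^{1-m}`. -/
theorem mem_radPow_of_trace {m : ℤ} {y : Matrix (Fin 2) (Fin 2) F}
    (hy : ∀ x ∈ L.radPow m, valuation F (y * x).trace < 1) : y ∈ L.radPow (1 - m) := by
  obtain ⟨ϖ, hϖ⟩ := IsDiscreteValuationRing.exists_irreducible 𝒪[F]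
  have h0 := irreducible_coe_ne_zero hϖ
  intro i v hv
  by_contra hcon
  obtain ⟨f, hf1, hf⟩ := exists_separating_form (L.fg _) hcon
  -- The rank one operator `w ↦ f(w) v`, for which `tr(y x) = f(y v) = 1`. It remains to see that it
  -- lies in `𝔓^m`.
  let x : Matrix (Fin 2) (Fin 2) F := Matrix.vecMulVec v fun b => f (Pi.single b 1)
  have hfw : ∀ w, f w = w ⬝ᵥ fun b => f (Pi.single b 1) := by
    intro w
    conv_lhs => rw [← Finset.univ_sum_single w, map_sum]
    refine Finset.sum_congr rfl fun b _ => ?_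
    rw [← smul_eq_mul, ← map_smul, ← Pi.single_smul, smul_eq_mul, mul_one]
  have hx : ∀ w, x.mulVec w = f w • v := by
    intro w
    rw [Matrix.vecMulVec_mulVec, hfw, dotProduct_comm, op_smul_eq_smul]
  have htr : (y * x).trace = 1 := by
    rw [← hf1, Matrix.mul_vecMulVec, Matrix.trace_vecMulVec, hfw]
  refine (hy x fun j w hw => ?_).ne (by rw [htr, map_one])
  have hp : (0 : ℤ) < L.period := by exact_mod_cast L.period_pos
  -- The largest `t` with `L_j ⊆ ϖ^t L_{i+1-m}`, as read off the indices. Then `f(w) ∈ ϖ^{t+1} 𝒪`,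
  -- and `ϖ^{t+1} v` is deep enough because `j < i + 1 - m + e(t + 1)`, `e` being the period.
  let t := (j - (i + (1 - m))) / L.period
  have ht1 : (i + (1 - m)) + L.period * t ≤ j := by
    have := Int.mul_ediv_self_le (x := j - (i + (1 - m))) hp.ne'
    linarith
  have ht2 : j < (i + (1 - m)) + L.period * t + L.period := by
    have := Int.lt_mul_ediv_self_add (x := j - (i + (1 - m))) hp
    linarith
  have h1 := L.antitone_lattice ht1 hw
  rw [L.mem_add_mul_period_iff hϖ] at h1
  obtain ⟨c, hc⟩ := exists_eq_mul_of_valuation_lt_one hϖ (hf _ h1)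
  have h2 : f w • v = (ϖ : F) ^ (t + 1) • (c • v) := by
    rw [map_smul, smul_eq_mul, zpow_neg, inv_mul_eq_iff_eq_mul₀ (zpow_ne_zero _ h0)] at hc
    rw [hc, integer_smul_def, smul_smul, zpow_add_one₀ h0, mul_assoc]
  rw [hx, h2]
  refine L.antitone_lattice ?_
    ((L.smul_zpow_mem_iff hϖ i (t + 1) _).mpr ((L.lattice i).smul_mem c hv))
  linarith

/-- The dual of an intersection is the sum of the duals. A linear form separating `z` from `𝔓^{1-m}
+ g⁻¹ 𝔓^{1-m} g` is `tr(y ·)`; duality puts `y` in both `𝔓^m` and `g⁻¹ 𝔓^m g`, while `tr(z y) = 1`.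
-/
theorem exists_eq_add_conj {m : ℤ} (g : GL (Fin 2) F) {z : Matrix (Fin 2) (Fin 2) F}
    (hz : ∀ x ∈ L.radPow m, g.1 * x * (g⁻¹).1 ∈ L.radPow m → valuation F (z * x).trace < 1) :
    ∃ a ∈ L.radPow (1 - m), ∃ b ∈ L.radPow (1 - m), z = (g⁻¹).1 * b * g.1 - a := by
  let φ : Matrix (Fin 2) (Fin 2) F →ₗ[𝒪[F]] Matrix (Fin 2) (Fin 2) F :=
    ((LinearMap.mulRight F g.1) ∘ₗ (LinearMap.mulLeft F (g⁻¹).1)).restrictScalars 𝒪[F]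
  have hφ : ∀ b, φ b = (g⁻¹).1 * b * g.1 := fun b => rfl
  let P := L.radPowSubmodule (1 - m)
  by_contra hcon
  have hzN : z ∉ P ⊔ P.map φ := by
    intro h
    obtain ⟨a, ha, _, ⟨b, hb, rfl⟩, rfl⟩ := Submodule.mem_sup.mp h
    exact hcon ⟨-a, neg_mem (show a ∈ L.radPow _ from ha), b, hb, by rw [hφ]; abel⟩
  have hfg := L.fg_radPowSubmodule (1 - m)
  obtain ⟨f, hf1, hf⟩ := exists_separating_form (hfg.sup (hfg.map φ)) hzN
  let y : Matrix (Fin 2) (Fin 2) F := Matrix.of fun a b => f (Matrix.single b a 1)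
  have hfy : ∀ x, (y * x).trace = f x := by
    intro x
    conv_rhs => rw [Matrix.matrix_eq_sum_single x]
    simp only [map_sum, Matrix.trace, Matrix.diag, Matrix.mul_apply]
    rw [Finset.sum_comm]
    refine Finset.sum_congr rfl fun i _ => Finset.sum_congr rfl fun j _ => ?_
    have e : Matrix.single i j (x i j) = x i j • Matrix.single i j (1 : F) := by
      rw [Matrix.smul_single, smul_eq_mul, mul_one]
    rw [e, map_smul, smul_eq_mul, mul_comm]
    rfl
  have hy1 : y ∈ L.radPow m := by
    have := L.mem_radPow_of_trace (m := 1 - m) (y := y) fun x hx => by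
      rw [hfy]
      exact hf x (Submodule.mem_sup_left hx)
    rwa [sub_sub_cancel] at this
  have hy2 : g.1 * y * (g⁻¹).1 ∈ L.radPow m := by
    have := L.mem_radPow_of_trace (m := 1 - m) (y := g.1 * y * (g⁻¹).1) fun x hx => by
      rw [mul_assoc, mul_assoc, Matrix.trace_mul_comm, mul_assoc, hfy]
      exact hf _ (Submodule.mem_sup_right ⟨x, hx, hφ x⟩)
    rwa [sub_sub_cancel] at this
  have h1 := hz y hy1 hy2
  rw [Matrix.trace_mul_comm, hfy, hf1, map_one] at h1
  exact lt_irrefl _ h1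

variable {k : Type v} [Field k] {ψ : AddChar F k}

/-- Otherwise `𝒪 ⊆ 𝒪 t`, and `ψ` would be trivial on `𝒪`. -/
theorem valuation_lt_one_of_isLevelOne (hψ : IsLevelOne ψ) {t : F}
    (ht : ∀ c : 𝒪[F], ψ (c * t) = 1) : valuation F t < 1 := by
  by_contra! h
  obtain ⟨-, x, hx⟩ := hψ
  have ht0 : t ≠ 0 := by
    rintro rfl
    simp at h
  have hmem : (x : F) * t⁻¹ ∈ 𝒪[F] := by
    change valuation F _ ≤ 1
    rw [map_mul, map_inv₀]
    exact mul_le_one' x.2 (inv_le_one_of_one_le₀ h)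
  have := ht ⟨_, hmem⟩
  rw [inv_mul_cancel_right₀ ht0] at this
  exact hx this

end LatticeChain

/-! ### Elements that determine the lattice chain -/

namespace LatticeChain

variable {F : Type u} [Field F] [ValuativeRel F] [TopologicalSpace F]
  [IsNonarchimedeanLocalField F] (L : LatticeChain F)

/-- For every `v ∈ L_i`, `v ∉ L_{i+1}`, the vectors `v`, `γ v` are elements of `L_i` whose images in
`L_i / 𝔪 L_i` are linearly independent. -/
def Generates (γ : Matrix (Fin 2) (Fin 2) F) : Prop :=
  γ ∈ L.radPow 0 ∧ ∀ i, ∀ v ∈ L.lattice i, v ∉ L.lattice (i + 1) → ∀ x y : 𝒪[F],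
    x • v + y • γ.mulVec v ∈ L.lattice (i + L.period) → x ∈ 𝓂[F] ∧ y ∈ 𝓂[F]

variable {L}

/-- Dividing by the larger coefficient leaves integral coefficients, one of which is `1`. Such a
combination is nonzero modulo `𝔪 L_i`. -/
theorem Generates.inv_smul_notMem {γ : Matrix (Fin 2) (Fin 2) F} (hγ : L.Generates γ) {i : ℤ}
    {v : Fin 2 → F} (hv : v ∈ L.lattice i) (hv' : v ∉ L.lattice (i + 1)) {x y c : F} (hc : c ≠ 0)
    (hx : valuation F x ≤ valuation F c) (hy : valuation F y ≤ valuation F c)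
    (hcxy : c = x ∨ c = y) : c⁻¹ • (x • v + y • γ.mulVec v) ∉ L.lattice (i + L.period) := by
  have hmem : ∀ z, valuation F z ≤ valuation F c → c⁻¹ * z ∈ 𝒪[F] := by
    intro z hz
    change valuation F _ ≤ 1
    rw [map_mul, map_inv₀, inv_mul_le_iff₀ (zero_lt_iff.mpr ((Valuation.ne_zero_iff _).mpr hc)),
      mul_one]
    exact hz
  intro h
  rw [smul_add, smul_smul, smul_smul] at h
  obtain ⟨h1, h2⟩ := hγ.2 i v hv hv' ⟨_, hmem x hx⟩ ⟨_, hmem y hy⟩ h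
  rw [mem_maximalIdeal_iff_valuation_lt_one] at h1 h2
  rcases hcxy with rfl | rfl
  · simp [hc] at h1
  · simp [hc] at h2

/-- The vectors `v`, `γ v` form a basis of `F²`. A nonintegral coefficient of `w ∈ L_i` is
impossible, since dividing by the larger one would put a combination with a coefficient `1` into `𝔪
L_i`. -/
theorem Generates.exists_eq {γ : Matrix (Fin 2) (Fin 2) F} (hγ : L.Generates γ) {i : ℤ}
    {v : Fin 2 → F} (hv : v ∈ L.lattice i) (hv' : v ∉ L.lattice (i + 1)) {w : Fin 2 → F}
    (hw : w ∈ L.lattice i) : ∃ x y : 𝒪[F], w = x • v + y • γ.mulVec v := by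
  have hli : LinearIndependent F ![v, γ.mulVec v] := by
    rw [LinearIndependent.pair_iff]
    intro x y hxy
    by_contra hne
    rcases le_total (valuation F x) (valuation F y) with h | h
    · have hy : y ≠ 0 := by
        rintro rfl
        rw [map_zero, le_zero_iff, map_eq_zero] at h
        exact hne ⟨h, rfl⟩
      refine hγ.inv_smul_notMem hv hv' hy h le_rfl (Or.inr rfl) ?_
      rw [hxy, smul_zero]
      exact zero_mem _
    · have hx : x ≠ 0 := by
        rintro rfl
        rw [map_zero, le_zero_iff, map_eq_zero] at h
        exact hne ⟨rfl, h⟩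
      refine hγ.inv_smul_notMem hv hv' hx le_rfl h (Or.inl rfl) ?_
      rw [hxy, smul_zero]
      exact zero_mem _
  have hspan := hli.span_eq_top_of_card_eq_finrank (by simp)
  have hw' : w ∈ Submodule.span F (Set.range ![v, γ.mulVec v]) := hspan ▸ Submodule.mem_top
  rw [Matrix.range_cons, Matrix.range_cons, Matrix.range_empty, Set.union_empty,
    Set.singleton_union, Submodule.mem_span_pair] at hw'
  obtain ⟨x, y, rfl⟩ := hw'
  have key : ∀ c : F, (c = x ∨ c = y) → valuation F x ≤ valuation F c →
      valuation F y ≤ valuation F c → valuation F c ≤ 1 := by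
    intro c hc hx hy
    by_contra! h1
    have hc0 : c ≠ 0 := by
      rintro rfl
      simp at h1
    refine hγ.inv_smul_notMem hv hv' hc0 hx hy hc ?_
    have h2 : valuation F c⁻¹ < 1 := by
      rw [map_inv₀]
      exact inv_lt_one_of_one_lt₀ h1
    rw [L.lattice_add_period]
    exact Submodule.smul_mem_smul
      (mem_maximalIdeal_iff_valuation_lt_one.mpr h2 : (⟨c⁻¹, h2.le⟩ : 𝒪[F]) ∈ 𝓂[F]) hw
  have hxy : valuation F x ≤ 1 ∧ valuation F y ≤ 1 := by
    rcases le_total (valuation F x) (valuation F y) with h | h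
    · have := key y (Or.inr rfl) h le_rfl
      exact ⟨h.trans this, this⟩
    · have := key x (Or.inl rfl) le_rfl h
      exact ⟨this, h.trans this⟩
  exact ⟨⟨x, hxy.1⟩, ⟨y, hxy.2⟩, rfl⟩

/-- Take the smallest `L_i` containing `M`. A vector `v` of `M` outside `L_{i+1}` generates `L_i`
together with `γ v`, and both lie in `M`. -/
theorem Generates.exists_lattice_eq {γ : Matrix (Fin 2) (Fin 2) F} (hγ : L.Generates γ)
    {M : Submodule 𝒪[F] (Fin 2 → F)} (hM : M.FG) (hM0 : M ≠ ⊥) (hγM : ∀ v ∈ M, γ.mulVec v ∈ M) :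
    ∃ i, M = L.lattice i := by
  obtain ⟨v₀, hv₀, hne⟩ := M.ne_bot_iff.mp hM0
  obtain ⟨i₁, hi₁⟩ : ∃ i, v₀ ∉ L.lattice i := by
    by_contra! h
    exact hne (L.eq_zero_of_forall_mem_lattice h)
  obtain ⟨i, hi, himax⟩ := Int.exists_greatest_of_bdd (P := fun i => M ≤ L.lattice i)
    ⟨i₁, fun i hi => by
      by_contra! h
      exact hi₁ (L.antitone_lattice h.le (hi hv₀))⟩ (L.exists_lattice_le M hM)
  refine ⟨i, le_antisymm hi ?_⟩
  have h1 : ¬ M ≤ L.lattice (i + 1) := fun h => by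
    have := himax _ h
    lia
  obtain ⟨v, hv, hv'⟩ := SetLike.not_le_iff_exists.mp h1
  intro w hw
  obtain ⟨x, y, rfl⟩ := hγ.exists_eq (hi hv) hv' hw
  exact add_mem (M.smul_mem _ hv) (M.smul_mem _ (hγM v hv))

theorem lattice_ne_bot (i : ℤ) : L.lattice i ≠ ⊥ := fun h => by
  have := L.strictAnti (lt_add_one i)
  rw [h] at this
  exact not_lt_bot this

theorem exists_mem_lattice_notMem (i : ℤ) : ∃ v ∈ L.lattice i, v ∉ L.lattice (i + 1) :=
  SetLike.exists_of_lt (L.strictAnti (lt_add_one i))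

/-- An element that conjugates generating elements of the chain order permutes the chain. -/
theorem Generates.exists_shift {γ γ' : Matrix (Fin 2) (Fin 2) F} (hper : L.period ≤ 2)
    (hγ' : L.Generates γ') (hγ : γ ∈ L.radPow 0) (g : GL (Fin 2) F)
    (hg : g.1 * γ = γ' * g.1) : ∃ i : ℤ, g.1 ∈ L.radPow i ∧ (g⁻¹).1 ∈ L.radPow (-i) := by
  let e : (Fin 2 → F) →ₗ[𝒪[F]] (Fin 2 → F) := (Matrix.mulVecLin g.1).restrictScalars 𝒪[F]
  have he : ∀ v, e v = g.1.mulVec v := fun v => rfl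
  have hinj : Function.Injective e := fun v w h => by
    have := congrArg (g⁻¹).1.mulVec h
    rwa [he, he, Matrix.mulVec_mulVec, Matrix.mulVec_mulVec, Units.inv_mul, Matrix.one_mulVec,
      Matrix.one_mulVec] at this
  -- The image `g L_j` is stable under `γ'`, because `γ` preserves `L_j`.
  have hex : ∀ j, ∃ i, (L.lattice j).map e = L.lattice i := fun j => by
    refine hγ'.exists_lattice_eq ((L.fg j).map e) ?_ ?_
    · intro h
      refine lattice_ne_bot (L := L) j ((Submodule.eq_bot_iff _).mpr fun v hv => hinj ?_)
      rw [map_zero]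
      exact (Submodule.eq_bot_iff _).mp h _ ⟨v, hv, rfl⟩
    · rintro _ ⟨v, hv, rfl⟩
      rw [he, Matrix.mulVec_mulVec, ← hg, ← Matrix.mulVec_mulVec]
      have := hγ j v hv
      rw [add_zero] at this
      exact ⟨_, this, rfl⟩
  choose s hs using hex
  have hmono : StrictMono s := fun j j' h => by
    have h1 : (L.lattice j').map e < (L.lattice j).map e :=
      Submodule.map_strictMono_of_injective hinj (L.strictAnti h)
    rw [hs, hs] at h1
    exact L.strictAnti.lt_iff_gt.mp h1
  have hsper : ∀ j, s (j + L.period) = s j + L.period := fun j => by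
    refine L.strictAnti.injective ?_
    rw [← hs, L.lattice_add_period, L.lattice_add_period, Submodule.map_smul'', hs]
  -- A strictly increasing `s` with `s(j + e) = s(j) + e` has unit steps when `e ≤ 2`: there is no
  -- room for a larger jump.
  have hsucc : ∀ j, s (j + 1) = s j + 1 := fun j => by
    have h1 := hmono (lt_add_one j)
    have h2 := hsper j
    have h3 := L.period_pos
    obtain h4 | h4 : L.period = 1 ∨ L.period = 2 := by lia
    · simpa [h4] using h2
    · rw [h4] at h2
      have h5 := hmono (show j + 1 < j + ((2 : ℕ) : ℤ) by push_cast; lia)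
      push_cast at h2 h5
      lia
  have hsj : ∀ j, s j = j + s 0 := fun j => by
    induction j using Int.induction_on with
    | zero => simp
    | succ j ih => rw [hsucc, ih]; ring
    | pred j ih =>
      have := hsucc (-j - 1)
      rw [sub_add_cancel] at this
      lia
  refine ⟨s 0, fun j v hv => ?_, fun j v hv => ?_⟩
  · rw [← hsj, ← hs]
    exact ⟨v, hv, rfl⟩
  · have e1 : j = s (j + -s 0) := by rw [hsj]; ring
    rw [e1, ← hs] at hv
    obtain ⟨w, hw, rfl⟩ := hv
    rwa [he, Matrix.mulVec_mulVec, Units.inv_mul, Matrix.one_mulVec]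

/-- Choose `c = t + s γ` with `y v = c v`. Then `y - c` kills `v`, and it sends `γ v` into `𝔪 L_0`
because `y` commutes with `γ` up to `𝔓^e`, `e` the period. So it maps `L_0` into `L_e`, which is
enough for `𝔓`. -/
theorem Generates.exists_sub_mem {γ y : Matrix (Fin 2) (Fin 2) F} (hγ : L.Generates γ)
    (hy : y ∈ L.radPow 0) (hcomm : γ * y - y * γ ∈ L.radPow L.period) :
    ∃ t s : 𝒪[F], y - ((t : F) • (1 : Matrix (Fin 2) (Fin 2) F) + (s : F) • γ) ∈ L.radPow 1 := by
  obtain ⟨v, hv, hv'⟩ := L.exists_mem_lattice_notMem 0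
  have hyv := hy 0 v hv
  rw [add_zero] at hyv
  obtain ⟨t, s, hts⟩ := hγ.exists_eq hv hv' hyv
  refine ⟨t, s, L.mem_radPow_of_period fun i h0 hi w hw => ?_⟩
  set c := (t : F) • (1 : Matrix (Fin 2) (Fin 2) F) + (s : F) • γ with hc
  have hcv : (y - c).mulVec v = 0 := by
    rw [Matrix.sub_mulVec, hts, hc, Matrix.add_mulVec, Matrix.smul_mulVec, Matrix.smul_mulVec,
      Matrix.one_mulVec, integer_smul_def, integer_smul_def, sub_self]
  have hcγ : γ * c = c * γ := by
    rw [hc, mul_add, add_mul, mul_smul_comm, smul_mul_assoc, mul_one, one_mul, mul_smul_comm,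
      smul_mul_assoc]
  have hcγv : (y - c).mulVec (γ.mulVec v) = -((γ * y - y * γ).mulVec v) := by
    have e : (y - c) * γ = γ * (y - c) - (γ * y - y * γ) := by
      rw [sub_mul, mul_sub, hcγ]
      abel
    rw [Matrix.mulVec_mulVec, e, Matrix.sub_mulVec, ← Matrix.mulVec_mulVec, hcv,
      Matrix.mulVec_zero, zero_sub]
  obtain ⟨a, b, rfl⟩ := hγ.exists_eq hv hv' (L.antitone_lattice h0 hw)
  rw [Matrix.mulVec_add, integer_smul_def, integer_smul_def, Matrix.mulVec_smul,
    Matrix.mulVec_smul, hcv, hcγv, smul_zero, zero_add]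
  refine L.antitone_lattice (show i + 1 ≤ 0 + (L.period : ℤ) by lia) ?_
  exact (L.lattice _).smul_mem b (neg_mem (hcomm 0 v hv))

theorem smul_pow_mem_radPow {ϖ : 𝒪[F]} (hϖ : Irreducible ϖ) {m : ℤ} (r : ℕ)
    {x : Matrix (Fin 2) (Fin 2) F} (hx : x ∈ L.radPow m) :
    (ϖ : F) ^ r • x ∈ L.radPow (m + L.period * r) := by
  have := L.smul_zpow_mem_radPow hϖ r hx
  rwa [zpow_natCast] at this

theorem aeval_mem_radPow {γ : Matrix (Fin 2) (Fin 2) F} (hγ : γ ∈ L.radPow 0)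
    (f : Polynomial 𝒪[F]) : Polynomial.aeval γ f ∈ L.radPow 0 := by
  induction f using Polynomial.induction_on' with
  | add p q hp hq => rw [map_add]; exact add_mem hp hq
  | monomial n a =>
    rw [Polynomial.aeval_monomial, ← Algebra.smul_def]
    refine L.smul_mem_radPow a ?_
    induction n with
    | zero => rw [pow_zero]; exact L.one_mem_radPow
    | succ n ih => rw [pow_succ]; exact L.mul_mem_radPow' ih hγ (by simp)

/-- A dependence between `v` and `γ v` modulo `𝔪 L_i` would give `γ₀ v ≡ c v`. Since `f(γ₀) = 0` and
`X - c` divides `f - f(c)`, the residue of `c` would be a root of an irreducible quadratic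
polynomial. -/
theorem generates_of_irreducible (hper : L.period = 1) {γ₀ γ : Matrix (Fin 2) (Fin 2) F}
    (h0 : γ₀ ∈ L.radPow 0) (hsub : γ - γ₀ ∈ L.radPow 1) {f : Polynomial 𝒪[F]}
    (hf : f.map (algebraMap 𝒪[F] F) = γ₀.charpoly)
    (hirr : Irreducible (f.map (IsLocalRing.residue 𝒪[F]))) : L.Generates γ := by
  have hγ : γ ∈ L.radPow 0 := by
    rw [← sub_add_cancel γ γ₀]
    exact add_mem (L.radPow_antitone zero_le_one hsub) h0
  have hinj : Function.Injective (algebraMap 𝒪[F] F) := Subtype.val_injective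
  have hmonic : f.Monic := by
    refine Polynomial.monic_of_injective hinj ?_
    rw [hf]
    exact Matrix.charpoly_monic _
  have hdeg : (f.map (IsLocalRing.residue 𝒪[F])).degree = 2 := by
    rw [hmonic.degree_map, ← Polynomial.degree_map_eq_of_injective hinj, hf,
      Matrix.charpoly_degree_eq_dim]
    simp
  have hf0 : Polynomial.aeval γ₀ f = 0 := by
    rw [← Polynomial.aeval_map_algebraMap F, hf, Matrix.aeval_self_charpoly]
  refine ⟨hγ, fun i v hv hv' x y hxy => ?_⟩
  rw [hper, Nat.cast_one] at hxy
  have hmod : ∀ z ∈ 𝓂[F], ∀ w ∈ L.lattice i, z • w ∈ L.lattice (i + 1) := fun z hz w hw => by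
    have := Submodule.smul_mem_smul hz hw
    rwa [← L.lattice_add_period, hper, Nat.cast_one] at this
  have hγv : γ.mulVec v ∈ L.lattice i := by simpa using hγ i v hv
  have hy : y ∈ 𝓂[F] := by
    by_contra hy
    obtain ⟨u, rfl⟩ : IsUnit y := by simpa using hy
    let c : 𝒪[F] := -(↑u⁻¹ * x)
    have h1 : (γ₀ - algebraMap 𝒪[F] _ c).mulVec v ∈ L.lattice (i + 1) := by
      have h2 := (L.lattice (i + 1)).smul_mem (↑u⁻¹ : 𝒪[F]) hxy
      rw [smul_add, smul_smul, smul_smul, Units.inv_mul, one_smul] at h2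
      have h3 := sub_mem h2 (hsub i v hv)
      have e : (γ₀ - algebraMap 𝒪[F] _ c).mulVec v =
          (↑u⁻¹ * x) • v + γ.mulVec v - (γ - γ₀).mulVec v := by
        rw [Matrix.sub_mulVec, Matrix.sub_mulVec, Algebra.algebraMap_eq_smul_one]
        change _ - ((c : F) • (1 : Matrix (Fin 2) (Fin 2) F)).mulVec v = _
        rw [Matrix.smul_mulVec, Matrix.one_mulVec, ← integer_smul_def, neg_smul]
        abel
      rw [e]
      exact h3
    obtain ⟨q, hq⟩ := Polynomial.X_sub_C_dvd_sub_C_eval (a := c) (p := f)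
    have h2 : (Polynomial.aeval γ₀ (f - Polynomial.C (f.eval c))).mulVec v ∈ L.lattice (i + 1) := by
      rw [hq, mul_comm, map_mul, ← Matrix.mulVec_mulVec, map_sub, Polynomial.aeval_X,
        Polynomial.aeval_C]
      have := aeval_mem_radPow h0 q _ _ h1
      rwa [add_zero] at this
    rw [map_sub, hf0, Polynomial.aeval_C, zero_sub, Matrix.neg_mulVec, neg_mem_iff,
      Algebra.algebraMap_eq_smul_one] at h2
    have h3 : f.eval c • v ∈ L.lattice (i + 1) := by
      change (((f.eval c : 𝒪[F]) : F) • (1 : Matrix (Fin 2) (Fin 2) F)).mulVec v ∈ _ at h2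
      rwa [Matrix.smul_mulVec, Matrix.one_mulVec] at h2
    have h4 : f.eval c ∈ 𝓂[F] := by
      by_contra hu
      obtain ⟨w, hw⟩ : IsUnit (f.eval c) := by simpa using hu
      have := (L.lattice (i + 1)).smul_mem (↑w⁻¹ : 𝒪[F]) h3
      rw [← hw, smul_smul, Units.inv_mul, one_smul] at this
      exact hv' this
    have h5 : (f.map (IsLocalRing.residue 𝒪[F])).IsRoot (IsLocalRing.residue 𝒪[F] c) := by
      rw [Polynomial.IsRoot, Polynomial.eval_map_apply, IsLocalRing.residue_eq_zero_iff]
      exact h4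
    have h6 := Polynomial.degree_eq_one_of_irreducible_of_root hirr h5
    rw [hdeg] at h6
    exact absurd h6 (by decide)
  refine ⟨?_, hy⟩
  by_contra hx
  obtain ⟨u, rfl⟩ : IsUnit x := by simpa using hx
  have h1 := sub_mem hxy (hmod y hy _ hγv)
  rw [add_sub_cancel_right] at h1
  have h2 := (L.lattice (i + 1)).smul_mem (↑u⁻¹ : 𝒪[F]) h1
  rw [smul_smul, Units.inv_mul, one_smul] at h2
  exact hv' h2

/-- The vectors `v` and `γ v` have nonzero images in the two successive quotients `L_i / L_{i+1}`
and `L_{i+1} / L_{i+2}`. -/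
theorem generates_of_shift (hper : L.period = 2) {γ : Matrix (Fin 2) (Fin 2) F}
    (h1 : γ ∈ L.radPow 1)
    (h2 : ∀ i, ∀ v ∈ L.lattice i, v ∉ L.lattice (i + 1) → γ.mulVec v ∉ L.lattice (i + 2)) :
    L.Generates γ := by
  refine ⟨L.radPow_antitone zero_le_one h1, fun i v hv hv' x y hxy => ?_⟩
  rw [hper, Nat.cast_ofNat] at hxy
  have hγv := h1 i v hv
  have hx : x ∈ 𝓂[F] := by
    by_contra hx
    obtain ⟨u, rfl⟩ : IsUnit x := by simpa using hx
    have h3 := sub_mem (L.antitone_lattice (show i + 1 ≤ i + 2 by lia) hxy)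
      ((L.lattice (i + 1)).smul_mem y hγv)
    rw [add_sub_cancel_right] at h3
    have h4 := (L.lattice (i + 1)).smul_mem (↑u⁻¹ : 𝒪[F]) h3
    rw [smul_smul, Units.inv_mul, one_smul] at h4
    exact hv' h4
  refine ⟨hx, ?_⟩
  by_contra hy
  obtain ⟨u, rfl⟩ : IsUnit y := by simpa using hy
  have h3 := Submodule.smul_mem_smul hx hv
  rw [← L.lattice_add_period, hper, Nat.cast_ofNat] at h3
  have h4 := sub_mem hxy h3
  rw [add_sub_cancel_left] at h4
  have h5 := (L.lattice (i + 2)).smul_mem (↑u⁻¹ : 𝒪[F]) h4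
  rw [smul_smul, Units.inv_mul, one_smul] at h5
  exact h2 i v hv hv' h5

end LatticeChain

section Adjoin

variable {F : Type u} [Field F]

theorem mem_unitsAdjoin_iff {α : Matrix (Fin 2) (Fin 2) F} {g : GL (Fin 2) F} :
    g ∈ unitsAdjoin α ↔ g.1 ∈ Algebra.adjoin F {α} := by
  refine ⟨fun h => (Submonoid.mem_units_iff _ _).mp h |>.1, fun h => ?_⟩
  refine (Submonoid.mem_units_iff _ _).mpr ⟨h, ?_⟩
  rw [Matrix.coe_units_inv, Matrix.inv_def]
  refine Subalgebra.smul_mem _ ?_ _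
  -- For `2 × 2` matrices this makes the inverse a polynomial in `g`.
  have e : g.1.adjugate = g.1.trace • (1 : Matrix (Fin 2) (Fin 2) F) - g.1 := by
    rw [Matrix.adjugate_fin_two]
    ext i j
    fin_cases i <;> fin_cases j <;> simp [Matrix.trace_fin_two]
  rw [e]
  exact sub_mem (Subalgebra.smul_mem _ (one_mem _) _) h

theorem commute_of_mem_adjoin {α c : Matrix (Fin 2) (Fin 2) F}
    (hc : c ∈ Algebra.adjoin F {α}) : Commute α c :=
  Algebra.commute_of_mem_adjoin_singleton_of_commute hc (Commute.refl α)

end Adjoin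

/-! ### Intertwining of the character `ψ_α` of a simple stratum -/

namespace LatticeChain

variable {F : Type u} [Field F] [ValuativeRel F] [TopologicalSpace F]
  [IsNonarchimedeanLocalField F] {L : LatticeChain F} {n : ℕ} {α : Matrix (Fin 2) (Fin 2) F}

theorem pow_mem_radPow {δ : Matrix (Fin 2) (Fin 2) F} {m : ℤ} (hδ : δ ∈ L.radPow m) (s : ℕ) :
    δ ^ s ∈ L.radPow (s * m) := by
  induction s with
  | zero => simpa using L.one_mem_radPow
  | succ s ih =>
    rw [pow_succ]
    exact L.mul_mem_radPow' ih hδ (by push_cast; linarith)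

theorem zpow_mem_radPow {δ : GL (Fin 2) F} (h1 : δ.1 ∈ L.radPow 1)
    (h2 : (δ⁻¹).1 ∈ L.radPow (-1)) (i : ℤ) : (δ ^ i).1 ∈ L.radPow i := by
  obtain ⟨s, rfl | rfl⟩ := i.eq_nat_or_neg
  · have := pow_mem_radPow h1 s
    rw [mul_one] at this
    rwa [zpow_natCast, Units.val_pow_eq_pow_val]
  · have := pow_mem_radPow h2 s
    rw [mul_neg, mul_one] at this
    rwa [zpow_neg, zpow_natCast, ← inv_pow, Units.val_pow_eq_pow_val]

/-- For a simple stratum `(𝔄, n, α)`, suitable multiples of the elements of `α + 𝔓^{1-n}` generate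
the chain, and `F[α]` contains an element of valuation one for the chain. -/
theorem IsSimpleStratum.exists_generates (h : L.IsSimpleStratum n α) :
    ∃ (ϖ : 𝒪[F]) (r : ℕ), Irreducible ϖ ∧ L.period ≤ 2 ∧
      (L.period * r : ℤ) = n + L.period - 1 ∧
      (∀ b ∈ L.radPow (1 - n), L.Generates ((ϖ : F) ^ r • (α + b))) ∧
      ∃ δ : GL (Fin 2) F, δ ∈ unitsAdjoin α ∧ δ.1 ∈ L.radPow 1 ∧ (δ⁻¹).1 ∈ L.radPow (-1) := by
  obtain ⟨hn, hα, ⟨hper, ϖ, hϖ, f, hf, hirr⟩ | ⟨hper, hodd, β, hβ, hαβ⟩⟩ := h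
  · have h0 := irreducible_coe_ne_zero hϖ
    -- Unramified case: `ϖ^n α` has irreducible reduction and `ϖ^n b ∈ 𝔓`, while `ϖ` itself serves
    -- as `δ`.
    refine ⟨ϖ, n, hϖ, by lia, by simp [hper], fun b hb => ?_, ?_⟩
    · refine generates_of_irreducible hper (L.radPow_antitone ?_ (smul_pow_mem_radPow hϖ n hα))
        ?_ hf hirr
      · simp [hper]
      · rw [smul_add, add_sub_cancel_left]
        exact L.radPow_antitone (by simp [hper]) (smul_pow_mem_radPow hϖ n hb)
    · let δ : GL (Fin 2) F := ⟨(ϖ : F) • 1, (ϖ : F)⁻¹ • 1, by simp [h0], by simp [h0]⟩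
      refine ⟨δ, mem_unitsAdjoin_iff.mpr (Subalgebra.smul_mem _ (one_mem _) _), ?_, ?_⟩
      · have := L.smul_zpow_mem_radPow hϖ 1 L.one_mem_radPow
        simpa [hper] using this
      · have := L.smul_zpow_mem_radPow hϖ (-1) L.one_mem_radPow
        change (ϖ : F)⁻¹ • (1 : Matrix (Fin 2) (Fin 2) F) ∈ _
        simpa [hper] using this
  · obtain ⟨ϖ, hϖ⟩ := IsDiscreteValuationRing.exists_irreducible 𝒪[F]
    have h0 := irreducible_coe_ne_zero hϖ
    obtain ⟨m, rfl⟩ := hodd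
    have hβα : β * α = 1 := mul_eq_one_comm.mp hαβ
    push_cast at hα hβ ⊢
    have hmem : ∀ b ∈ L.radPow (-(2 * m + 1)), (ϖ : F) ^ (m + 1) • b ∈ L.radPow 1 :=
      fun b hb => L.radPow_antitone (by rw [hper]; push_cast; linarith)
        (smul_pow_mem_radPow hϖ (m + 1) hb)
    have hβ' : ((ϖ : F) ^ (m + 1))⁻¹ • β ∈ L.radPow (-1) := by
      have := L.smul_zpow_mem_radPow hϖ (-((m + 1 : ℕ) : ℤ)) hβ
      rw [zpow_neg, zpow_natCast] at this
      refine L.radPow_antitone ?_ this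
      rw [hper]
      push_cast
      linarith
    -- Ramified case with `n = 2m + 1`: `ϖ^{m+1} α` shifts the chain by `2(m+1) - n = 1`, so it also
    -- serves as `δ`.
    refine ⟨ϖ, m + 1, hϖ, by lia, by rw [hper]; push_cast; ring, fun b hb => ?_, ?_⟩
    · refine generates_of_shift hper (hmem _ (add_mem hα (L.radPow_antitone (by linarith) hb)))
        fun i v hv hv' hcon => hv' ?_
      have hb' : (ϖ : F) ^ (m + 1) • b ∈ L.radPow 2 :=
        L.radPow_antitone (by rw [hper]; push_cast; linarith) (smul_pow_mem_radPow hϖ (m + 1) hb)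
      have h1 := sub_mem hcon (hb' i v hv)
      rw [← Matrix.sub_mulVec, smul_add, add_sub_cancel_right] at h1
      have h2 := hβ' _ _ h1
      rw [Matrix.mulVec_mulVec, smul_mul_smul_comm, inv_mul_cancel₀ (pow_ne_zero _ h0), hβα,
        one_smul, Matrix.one_mulVec] at h2
      exact L.antitone_lattice (by linarith) h2
    · let δ : GL (Fin 2) F := ⟨(ϖ : F) ^ (m + 1) • α, ((ϖ : F) ^ (m + 1))⁻¹ • β,
        by simp [h0, hαβ, smul_smul], by simp [h0, hβα, smul_smul]⟩
      have hδ : ((δ⁻¹ : GL (Fin 2) F) : Matrix (Fin 2) (Fin 2) F) ∈ L.radPow (-1) := hβ'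
      exact ⟨δ, mem_unitsAdjoin_iff.mpr
        (Subalgebra.smul_mem _ (Algebra.self_mem_adjoin_singleton F α) _), hmem _ hα,
        by simpa using hδ⟩

/-- Successive approximation. Write the error as `δ^s y`; as `δ ∈ F[α]`, the commutator of `y` with
`α` lies in `𝔓^{1-n}`. Scaling by `ϖ^r` moves it to `𝔓^e`, with `e` the period, so `y` is congruent
modulo `𝔓` to an element of `F[α]`. -/
theorem IsSimpleStratum.exists_approx (h : L.IsSimpleStratum n α) (s : ℕ)
    {x : Matrix (Fin 2) (Fin 2) F} (hx : x ∈ L.radPow 0)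
    (hcomm : α * x - x * α ∈ L.radPow (-n + s)) :
    ∃ c ∈ Algebra.adjoin F {α}, x - c ∈ L.radPow s := by
  obtain ⟨ϖ, r, hϖ, hper, hr, hgen, δ, hδ, h1, h2⟩ := h.exists_generates
  have hγ : L.Generates ((ϖ : F) ^ r • α) := by simpa using hgen 0 (zero_mem _)
  rw [mem_unitsAdjoin_iff] at hδ
  induction s with
  | zero => exact ⟨0, zero_mem _, by simpa using hx⟩
  | succ s ih =>
    obtain ⟨c, hc, hxc⟩ := ih (L.radPow_antitone (by push_cast; linarith) hcomm)
    have hd1 := zpow_mem_radPow h1 h2 (-s : ℤ)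
    have hd2 := zpow_mem_radPow h1 h2 (s : ℤ)
    have hdd : (δ ^ (s : ℤ)).1 * (δ ^ (-s : ℤ)).1 = 1 := by
      rw [← Units.val_mul, ← zpow_add, add_neg_cancel, zpow_zero, Units.val_one]
    have hdc : ∀ i : ℤ, (δ ^ i).1 ∈ Algebra.adjoin F {α} := fun i =>
      mem_unitsAdjoin_iff.mp ((unitsAdjoin α).zpow_mem (mem_unitsAdjoin_iff.mpr hδ) i)
    set y := (δ ^ (-s : ℤ)).1 * (x - c) with hy
    have hy0 : y ∈ L.radPow 0 := L.mul_mem_radPow' hd1 hxc (by simp)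
    have hyx : (δ ^ (s : ℤ)).1 * y = x - c := by rw [hy, ← mul_assoc, hdd, one_mul]
    have hαy : α * y - y * α = (δ ^ (-s : ℤ)).1 * (α * x - x * α) := by
      have e1 : α * (δ ^ (-s : ℤ)).1 = (δ ^ (-s : ℤ)).1 * α := commute_of_mem_adjoin (hdc _)
      have e2 : α * c = c * α := commute_of_mem_adjoin hc
      rw [hy, ← mul_assoc, e1, mul_assoc, mul_assoc, ← mul_sub, mul_sub α, sub_mul x, e2,
        sub_sub_sub_cancel_right]
    have hαy' : α * y - y * α ∈ L.radPow (1 - n) := by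
      rw [hαy]
      exact L.mul_mem_radPow' hd1 hcomm (by push_cast; linarith)
    obtain ⟨t, u, htu⟩ := hγ.exists_sub_mem hy0 (by
      rw [smul_mul_assoc, mul_smul_comm, ← smul_sub]
      exact L.radPow_antitone (by linarith) (smul_pow_mem_radPow hϖ r hαy'))
    refine ⟨c + (δ ^ (s : ℤ)).1 * ((t : F) • 1 + (u : F) • (ϖ : F) ^ r • α), ?_, ?_⟩
    · refine add_mem hc (mul_mem (hdc _) (add_mem (Subalgebra.smul_mem _ (one_mem _) _)
        (Subalgebra.smul_mem _ (Subalgebra.smul_mem _ ?_ _) _)))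
      exact Algebra.self_mem_adjoin_singleton F α
    · rw [← sub_sub, ← hyx, ← mul_sub]
      exact L.mul_mem_radPow' hd2 htu (by push_cast; linarith)

/-- If two elements of `α + 𝔓^{-[n/2]}` are conjugate by `g`, then `g ∈ Eˣ U^{[(n+1)/2]}`. -/
theorem IsSimpleStratum.mem_of_conj (h : L.IsSimpleStratum n α) (g : GL (Fin 2) F)
    {a b : Matrix (Fin 2) (Fin 2) F} (ha : a ∈ L.radPow (-(n / 2 : ℕ)))
    (hb : b ∈ L.radPow (-(n / 2 : ℕ))) (hg : g.1 * (α + a) = (α + b) * g.1) :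
    g ∈ unitsAdjoin α ⊔ L.unitGroup ((n + 1) / 2) := by
  obtain ⟨ϖ, r, hϖ, hper, hr, hgen, δ, hδ, h1, h2⟩ := h.exists_generates
  have hn := h.1
  have hle : (1 - n : ℤ) ≤ -(n / 2 : ℕ) := by lia
  obtain ⟨i, hi, hi'⟩ := Generates.exists_shift hper (hgen b (L.radPow_antitone hle hb))
    (hgen a (L.radPow_antitone hle ha)).1 g (by rw [mul_smul_comm, hg, smul_mul_assoc])
  -- Removing a power of `δ ∈ Eˣ` leaves a unit of the chain order.
  set g' := δ ^ (-i) * g with hg'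
  have hg'0 : g'.1 ∈ L.radPow 0 := by
    rw [hg', Units.val_mul]
    exact L.mul_mem_radPow' (zpow_mem_radPow h1 h2 (-i)) hi (by simp)
  have hg'1 : (g'⁻¹).1 ∈ L.radPow 0 := by
    rw [hg', mul_inv_rev, ← zpow_neg, neg_neg, Units.val_mul]
    exact L.mul_mem_radPow' hi' (zpow_mem_radPow h1 h2 i) (by simp)
  have hδi : δ ^ (-i) ∈ unitsAdjoin α := (unitsAdjoin α).zpow_mem hδ _
  -- The commutator is `δ^{-i}(g a - b g)`, which lies in `𝔓^{-[n/2]}`, and `n = [n/2] + [(n+1)/2]`.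
  have hcomm : α * g'.1 - g'.1 * α ∈ L.radPow (-n + ((n + 1) / 2 : ℕ)) := by
    have e1 : α * (δ ^ (-i)).1 = (δ ^ (-i)).1 * α :=
      commute_of_mem_adjoin (mem_unitsAdjoin_iff.mp hδi)
    have e2 : α * g'.1 - g'.1 * α = (δ ^ (-i)).1 * (g.1 * a - b * g.1) := by
      rw [hg', Units.val_mul, ← mul_assoc, e1, mul_assoc, mul_assoc, ← mul_sub]
      congr 1
      rw [mul_add, add_mul] at hg
      rw [sub_eq_sub_iff_add_eq_add, ← hg]
      abel
    rw [e2]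
    refine L.mul_mem_radPow' (b := i - (n / 2 : ℕ)) (zpow_mem_radPow h1 h2 (-i)) (sub_mem
      (L.mul_mem_radPow' hi ha ?_) (L.mul_mem_radPow' hb hi ?_)) ?_ <;> lia
  obtain ⟨c, hc, hgc⟩ := h.exists_approx _ hg'0 hcomm
  -- The element `u` is chosen so that `g' u = c` lies in `F[α]`.
  obtain ⟨u, hu, hu'⟩ := L.exists_mem_unitGroup (m := (n + 1) / 2) (by lia)
    (x := (g'⁻¹).1 * (c - g'.1)) (L.mul_mem_radPow' hg'1 (by
      rw [← neg_sub]
      exact neg_mem hgc) (by simp))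
  have hcu : (g' * u).1 = c := by
    rw [Units.val_mul, hu', mul_sub, Units.inv_mul, add_sub_cancel, ← mul_assoc, Units.mul_inv,
      one_mul]
  have e : g = (δ ^ (-i))⁻¹ * (g' * u) * u⁻¹ := by rw [hg']; group
  rw [e]
  exact Subgroup.mul_mem_sup ((unitsAdjoin α).mul_mem ((unitsAdjoin α).inv_mem hδi)
    (mem_unitsAdjoin_iff.mpr (hcu ▸ hc))) ((L.unitGroup _).inv_mem hu)

/-- `Eˣ U^{[(n+1)/2]}` normalizes `U^m`. -/
theorem IsSimpleStratum.conj_mem (h : L.IsSimpleStratum n α) {m : ℕ} {j g : GL (Fin 2) F}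
    (hj : j ∈ unitsAdjoin α ⊔ L.unitGroup ((n + 1) / 2)) (hg : g ∈ L.unitGroup m) :
    j⁻¹ * g * j ∈ L.unitGroup m := by
  have key : ∀ (x : GL (Fin 2) F) (i : ℤ), x.1 ∈ L.radPow i → (x⁻¹).1 ∈ L.radPow (-i) →
      ∀ y ∈ L.unitGroup m, x * y * x⁻¹ ∈ L.unitGroup m := by
    intro x i hx hx' y hy
    have h1 : ∀ z : GL (Fin 2) F, z.1 - 1 ∈ L.radPow m → (x * z * x⁻¹).1 - 1 ∈ L.radPow m := by
      intro z hz
      have e : (x * z * x⁻¹).1 - 1 = x.1 * (z.1 - 1) * (x⁻¹).1 := by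
        rw [mul_sub, sub_mul, mul_one, Units.mul_inv, Units.val_mul, Units.val_mul]
      rw [e]
      exact L.mul_mem_radPow' (L.mul_mem_radPow hx hz) hx' (by linarith)
    refine ⟨h1 y hy.1, ?_⟩
    have e : (x * y * x⁻¹)⁻¹ = x * y⁻¹ * x⁻¹ := by group
    rw [e]
    exact h1 _ hy.2
  have hle : unitsAdjoin α ⊔ L.unitGroup ((n + 1) / 2) ≤ Subgroup.normalizer (L.unitGroup m) := by
    refine sup_le (fun x hx => ?_) fun x hx => ?_
    · obtain ⟨ϖ, r, hϖ, hper, hr, hgen, -⟩ := h.exists_generates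
      have hγ := hgen 0 (zero_mem _)
      rw [add_zero] at hγ
      -- An element of `Eˣ` commutes with the generating element `ϖ^r α`, so it shifts the chain.
      have e : x.1 * α = α * x.1 := (commute_of_mem_adjoin (mem_unitsAdjoin_iff.mp hx)).symm
      obtain ⟨i, hi, hi'⟩ := Generates.exists_shift hper hγ hγ.1 x
        (by rw [mul_smul_comm, e, smul_mul_assoc])
      rw [Subgroup.mem_normalizer_iff]
      refine fun y => ⟨key x i hi hi' y, fun hy => ?_⟩
      have := key x⁻¹ (-i) hi' (by simpa using hi) _ hy
      simpa [mul_assoc] using this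
    · have h1 := L.coe_mem_radPow_zero hx
      have h2 := L.coe_mem_radPow_zero (inv_mem hx)
      rw [Subgroup.mem_normalizer_iff]
      refine fun y => ⟨key x 0 h1 (by simpa using h2) y, fun hy => ?_⟩
      have := key x⁻¹ 0 h2 (by simpa using h1) _ hy
      simpa [mul_assoc] using this
  have := (Subgroup.mem_normalizer_iff.mp (inv_mem (hle hj)) g).mp hg
  rwa [inv_inv] at this

variable {k : Type v} [Field k] {ψ : AddChar F k}

/-- The elements that intertwine `ψ_α` on `U^{[n/2]+1}` lie in `Eˣ U^{[(n+1)/2]}`. -/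
theorem IsSimpleStratum.mem_of_intertwines (h : L.IsSimpleStratum n α) (hψ : IsLevelOne ψ)
    (g : GL (Fin 2) F) (hg : ∀ u ∈ L.unitGroup (n / 2 + 1), g * u * g⁻¹ ∈ L.unitGroup (n / 2 + 1) →
      ψ (α * ((g * u * g⁻¹).1 - 1)).trace = ψ (α * (u.1 - 1)).trace) :
    g ∈ unitsAdjoin α ⊔ L.unitGroup ((n + 1) / 2) := by
  -- Intertwining, applied to `1 + c x` for all `c ∈ 𝒪`, says that `ψ` is trivial on `𝒪 tr(z x)` for
  -- `z = α - g⁻¹ α g`. Level one and duality then split `z`.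
  obtain ⟨a, ha, b, hb, hab⟩ := L.exists_eq_add_conj (m := (n / 2 + 1 : ℕ)) g
    (z := α - (g⁻¹).1 * α * g.1) fun x hx hx' => by
      refine valuation_lt_one_of_isLevelOne hψ fun c => ?_
      obtain ⟨u, hu, hux⟩ := L.exists_mem_unitGroup (by lia) (L.smul_mem_radPow c hx)
      have e1 : (g * u * g⁻¹).1 - 1 = (c : F) • (g.1 * x * (g⁻¹).1) := by
        rw [Units.val_mul, Units.val_mul, hux, mul_add, add_mul, mul_one, Units.mul_inv,
          add_sub_cancel_left, mul_smul_comm, smul_mul_assoc]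
      have hu' : g * u * g⁻¹ ∈ L.unitGroup (n / 2 + 1) := by
        rw [L.mem_unitGroup_iff (by lia), e1]
        exact L.smul_mem_radPow c hx'
      have h1 := hg u hu hu'
      rw [e1, hux, add_sub_cancel_left, mul_smul_comm, mul_smul_comm, Matrix.trace_smul,
        Matrix.trace_smul, smul_eq_mul, smul_eq_mul] at h1
      have e2 : (α * (g.1 * x * (g⁻¹).1)).trace = ((g⁻¹).1 * α * g.1 * x).trace := by
        rw [← mul_assoc, Matrix.trace_mul_comm, ← mul_assoc, ← mul_assoc]
      rw [sub_mul, Matrix.trace_sub, mul_sub, AddChar.map_sub_eq_div, ← e2, h1, div_self]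
      exact (AddChar.val_isUnit ψ _).ne_zero
  have hm : (1 - (n / 2 + 1 : ℕ) : ℤ) = -(n / 2 : ℕ) := by push_cast; ring
  rw [hm] at ha hb
  refine h.mem_of_conj g ha hb ?_
  have e : α + a = (g⁻¹).1 * (α + b) * g.1 := by
    rw [mul_add, add_mul, add_comm (_ * α * _)]
    exact sub_eq_sub_iff_add_eq_add.mp hab
  rw [e, ← mul_assoc, ← mul_assoc, Units.mul_inv, one_mul]

end LatticeChain

/-! ### Unipotent fixed vectors and supercuspidality over a finite field -/

section FiniteGroup

variable {K : Type*} [Field K]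

/-- The invertible upper triangular matrices. -/
def upperTri (a d : Kˣ) (b : K) : GL (Fin 2) K where
  val := !![(a : K), b; 0, (d : K)]
  inv := !![(↑a⁻¹ : K), -(↑a⁻¹ * b * ↑d⁻¹); 0, (↑d⁻¹ : K)]
  val_inv := by
    ext i j
    fin_cases i <;> fin_cases j <;> simp [Matrix.mul_apply, Fin.sum_univ_two, mul_assoc]
  inv_val := by
    ext i j
    fin_cases i <;> fin_cases j <;> simp [Matrix.mul_apply, Fin.sum_univ_two, mul_assoc]

theorem upperTri_mul (a d a' d' : Kˣ) (b b' : K) :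
    upperTri a d b * upperTri a' d' b' = upperTri (a * a') (d * d') (a * b' + b * d') := by
  refine Units.ext ?_
  simp [upperTri]

theorem upperTri_one : upperTri (1 : Kˣ) 1 0 = 1 := by
  refine Units.ext ?_
  simp [upperTri, Matrix.one_fin_two]

variable {k : Type*} [Field k] {V : Type*} [AddCommGroup V] [Module k V]

theorem Module.End.exists_inf_eigenspace_ne_bot [IsAlgClosed k] [FiniteDimensional k V]
    {S : Submodule k V} (hS : S ≠ ⊥) {T : Module.End k V} (hT : ∀ v ∈ S, T v ∈ S) :
    ∃ c, S ⊓ T.eigenspace c ≠ ⊥ := by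
  have : Nontrivial S := Submodule.nontrivial_iff_ne_bot.mpr hS
  obtain ⟨c, hc⟩ := Module.End.exists_eigenvalue (T.restrict hT)
  obtain ⟨v, hv⟩ := hc.exists_hasEigenvector
  refine ⟨c, (Submodule.ne_bot_iff _).mpr ⟨v, ⟨v.2, ?_⟩, fun h => hv.2 (Subtype.ext h)⟩⟩
  exact Module.End.mem_eigenspace_iff.mpr (congrArg Subtype.val hv.apply_eq_smul)

theorem Representation.IsIrreducible.finiteDimensional {G : Type*} [Group G] [Finite G]
    {σ : Representation k G V} (hσ : σ.IsIrreducible) {v : V} (hv : v ≠ 0) :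
    FiniteDimensional k V := by
  let P : Subrepresentation σ :=
    { toSubmodule := Submodule.span k (Set.range fun g => σ g v)
      apply_mem_toSubmodule := by
        intro g w hw
        induction hw using Submodule.span_induction with
        | mem w hw =>
          obtain ⟨h, rfl⟩ := hw
          refine Submodule.subset_span ⟨g * h, ?_⟩
          simp
        | zero => rw [map_zero]; exact zero_mem _
        | add x y _ _ hx hy => rw [map_add]; exact add_mem hx hy
        | smul a x _ hx => rw [map_smul]; exact Submodule.smul_mem _ a hx }
  have hvP : v ∈ P.toSubmodule := Submodule.subset_span ⟨1, by simp⟩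
  have hP : P = ⊤ := by
    refine (hσ.eq_bot_or_eq_top P).resolve_left fun h => hv ?_
    rw [h] at hvP
    exact hvP
  have hP' : P.toSubmodule = ⊤ := by rw [hP]; rfl
  exact Module.Finite.of_fg_top (hP' ▸ Submodule.fg_span (Set.finite_range _))

/-- The embedding of the diagonal torus. -/
def torusHom : Kˣ × Kˣ →* GL (Fin 2) K where
  toFun x := upperTri x.1 x.2 0
  map_one' := upperTri_one
  map_mul' x y := by simp [upperTri_mul]

theorem upperTri_eq (a d : Kˣ) (b : K) :
    upperTri a d b = upperTri 1 1 (b * ↑d⁻¹) * (torusHom (a, 1) * torusHom (1, d)) := by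
  simp [torusHom, upperTri_mul]

/-- The stabilizer of the line spanned by a nonzero vector. -/
def lineStabilizer {G : Type*} [Group G] (σ : Representation k G V) {v : V} (hv : v ≠ 0) :
    Subgroup G where
  carrier := {g | ∃ c : k, σ g v = c • v}
  one_mem' := ⟨1, by simp⟩
  mul_mem' := by
    rintro x y ⟨c, hc⟩ ⟨d, hd⟩
    exact ⟨d * c, by rw [map_mul, Module.End.mul_apply, hd, map_smul, hc, smul_smul]⟩
  inv_mem' := by
    rintro x ⟨c, hc⟩
    have h1 : v = c • σ x⁻¹ v := by
      rw [← map_smul, ← hc, ← Module.End.mul_apply, ← map_mul]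
      simp
    have hc0 : c ≠ 0 := by
      rintro rfl
      rw [zero_smul] at h1
      exact hv h1
    exact ⟨c⁻¹, by rw [eq_inv_smul_iff₀ hc0]; exact h1.symm⟩

theorem exists_lineStabilizer_char {G : Type*} [Group G] (σ : Representation k G V) {v : V}
    (hv : v ≠ 0) : ∃ χ : lineStabilizer σ hv →* k,
    ∀ g : lineStabilizer σ hv, σ g v = χ g • v := by
  choose c hc using fun g : lineStabilizer σ hv => g.2
  refine ⟨{ toFun := c, map_one' := ?_, map_mul' := fun a b => ?_ }, hc⟩
  · refine smul_left_injective k hv ?_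
    change c 1 • v = (1 : k) • v
    rw [← hc, Subgroup.coe_one, map_one, one_smul, Module.End.one_apply]
  · refine smul_left_injective k hv ?_
    change c (a * b) • v = (c a * c b) • v
    rw [← hc, Subgroup.coe_mul, map_mul, Module.End.mul_apply, hc, map_smul, hc, smul_smul,
      mul_comm]

/-- An irreducible representation with a vector that spans a line stable under the upper triangular
matrices, on which the unipotent ones act trivially, is a quotient of a representation induced from
the upper triangular matrices. -/
theorem exists_isSubquotientOfFunctions {σ : Representation k (GL (Fin 2) K) V}
    (hσ : σ.IsIrreducible) {v : V} (hv : v ≠ 0) (hT : ∀ x, torusHom x ∈ lineStabilizer σ hv)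
    (hN : ∀ b, σ (upperTri 1 1 b) v = v) :
    ∃ χ₁ χ₂ : Kˣ →* kˣ, IsSubquotientOfFunctions σ (borelFunctions χ₁ χ₂) := by
  -- The discrete topology makes Frobenius reciprocity for compact induction available. The
  -- induction is from the full stabilizer of the line; as this contains the Borel subgroup, the
  -- induced functions lie in `borelFunctions`.
  let _ : TopologicalSpace (GL (Fin 2) K) := ⊥
  have : DiscreteTopology (GL (Fin 2) K) := ⟨rfl⟩
  obtain ⟨χ, hχ⟩ := exists_lineStabilizer_char σ hv
  let ρ : Representation k (lineStabilizer σ hv) k :=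
    (Algebra.lmul k k).toRingHom.toMonoidHom.comp χ
  have hρ : ∀ j (x : k), ρ j x = χ j * x := fun j x => rfl
  have hJ : IsOpen (lineStabilizer σ hv : Set (GL (Fin 2) K)) := isOpen_discrete _
  have hρs : IsSmoothRep ρ := fun x => isOpen_discrete _
  obtain ⟨Ψ, hΨ, hΨ1⟩ := exists_cInd_lift hJ hρs σ (LinearMap.toSpanSingleton k V v) fun j x => by
    rw [hρ, LinearMap.toSpanSingleton_apply, LinearMap.toSpanSingleton_apply, map_smul, hχ,
      smul_smul, mul_comm]
  let τ : Kˣ × Kˣ →* k := χ.comp (torusHom.codRestrict (lineStabilizer σ hv) hT)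
  let f : (cIndSub (lineStabilizer σ hv) ρ).toRepresentation.IntertwiningMap σ :=
    { Ψ with isIntertwining' := fun g => LinearMap.ext fun f => hΨ g f }
  refine ⟨(τ.comp (MonoidHom.inl _ _)).toHomUnits, (τ.comp (MonoidHom.inr _ _)).toHomUnits,
    cIndSub (lineStabilizer σ hv) ρ, fun φ hφ a d b t g ht => ?_, f,
    (Representation.IsIrreducible.surjective_or_eq_zero f).resolve_right fun h => hv ?_⟩
  · have ht' : t = upperTri a d b := Units.ext ht
    have hNm : upperTri 1 1 (b * ↑d⁻¹) ∈ lineStabilizer σ hv := ⟨1, by rw [hN, one_smul]⟩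
    have h1 : χ ⟨_, hNm⟩ = 1 := smul_left_injective k hv (by
      change χ ⟨_, hNm⟩ • v = (1 : k) • v
      rw [← hχ, hN, one_smul])
    have h2 : t = ((⟨_, hNm⟩ * (⟨_, hT (a, 1)⟩ * ⟨_, hT (1, d)⟩) : lineStabilizer σ hv) :
        GL (Fin 2) K) := by
      rw [ht', upperTri_eq]
      rfl
    rw [h2, hφ.1, hρ, map_mul, map_mul, h1, one_mul]
    rfl
  · have h1 : f (cIndSingle hJ hρs 1) = v := by
      refine (hΨ1 1).trans ?_
      simp
    rw [← h1, h]
    rfl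

theorem torusHom_mem_of_generators [Finite K] {z : Kˣ} (hz : ∀ x : Kˣ, ∃ n : ℕ, z ^ n = x)
    {S : Subgroup (GL (Fin 2) K)} (h1 : torusHom (z, 1) ∈ S) (h2 : torusHom (1, z) ∈ S)
    (x : Kˣ × Kˣ) : torusHom x ∈ S := by
  obtain ⟨a, d⟩ := x
  obtain ⟨m, rfl⟩ := hz a
  obtain ⟨n, rfl⟩ := hz d
  have e : ((z ^ m, z ^ n) : Kˣ × Kˣ) = (z, 1) ^ m * (1, z) ^ n := by simp
  rw [e, map_mul, map_pow, map_pow]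
  exact S.mul_mem (S.pow_mem h1 m) (S.pow_mem h2 n)

/-- A supercuspidal representation of `GL₂` of a finite field has no nonzero vector that is fixed by
all unipotent upper triangular matrices. -/
theorem IsFiniteSupercuspidal.eq_zero_of_unipotent_fixed [IsAlgClosed k] [Finite K]
    {σ : Representation k (GL (Fin 2) K) V} (hσ : IsFiniteSupercuspidal σ) {v : V}
    (hN : ∀ b, σ (upperTri 1 1 b) v = v) : v = 0 := by
  by_contra hv
  have := hσ.1.finiteDimensional hv
  let S : Submodule k V :=
    { carrier := {w | ∀ b, σ (upperTri 1 1 b) w = w}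
      zero_mem' := fun b => map_zero _
      add_mem' := fun {x y} hx hy b => by rw [map_add, hx, hy]
      smul_mem' := fun c x hx b => by rw [map_smul, hx] }
  have hS : S ≠ ⊥ := (Submodule.ne_bot_iff _).mpr ⟨v, hN, hv⟩
  -- The torus normalizes the unipotent group.
  have hST : ∀ x, ∀ w ∈ S, σ (torusHom x) w ∈ S := by
    intro x w hw b
    have e : upperTri 1 1 b * torusHom x = torusHom x * upperTri 1 1 (↑x.1⁻¹ * b * x.2) := by
      simp [torusHom, upperTri_mul, ← mul_assoc]
    rw [← Module.End.mul_apply, ← map_mul, e, map_mul, Module.End.mul_apply, hw]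
  -- Since `Kˣ` is cyclic, two commuting operators generate the torus action; they have a common
  -- eigenvector in `S`.
  obtain ⟨z, hz⟩ := IsCyclic.exists_monoid_generator (α := Kˣ)
  obtain ⟨c, hc⟩ := Module.End.exists_inf_eigenspace_ne_bot hS (hST (z, 1))
  obtain ⟨d, hd⟩ := Module.End.exists_inf_eigenspace_ne_bot hc (T := σ (torusHom (1, z)))
    fun w hw => ⟨hST _ w hw.1, by
      have h1 := Module.End.mem_eigenspace_iff.mp hw.2
      refine Module.End.mem_eigenspace_iff.mpr ?_
      rw [← Module.End.mul_apply, ← map_mul, ← map_mul, mul_comm, map_mul, map_mul,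
        Module.End.mul_apply, h1, map_smul]⟩
  obtain ⟨w, ⟨⟨hw1, hw2⟩, hw3⟩, hw0⟩ := (Submodule.ne_bot_iff _).mp hd
  obtain ⟨χ₁, χ₂, h⟩ := exists_isSubquotientOfFunctions hσ.1 hw0
    (torusHom_mem_of_generators (fun x => Submonoid.mem_powers_iff _ _ |>.mp (hz x))
      ⟨c, Module.End.mem_eigenspace_iff.mp hw2⟩ ⟨d, Module.End.mem_eigenspace_iff.mp hw3⟩) hw1
  exact hσ.2 χ₁ χ₂ h

section Unipotent

variable {R : Type*} [CommRing R]

/-- A nilpotent matrix with image in the span of `w` that annihilates `w`. -/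
def nilpotentOf (w : Fin 2 → R) : Matrix (Fin 2) (Fin 2) R :=
  !![-(w 0 * w 1), w 0 ^ 2; -(w 1 ^ 2), w 0 * w 1]

theorem nilpotentOf_mul_self (w : Fin 2 → R) : nilpotentOf w * nilpotentOf w = 0 := by
  ext i j
  fin_cases i <;> fin_cases j <;> simp [nilpotentOf, Matrix.mul_apply, Fin.sum_univ_two] <;> ring

/-- With `S` the standard alternating matrix, `nilpotentOf w = w wᵗ S`, and `gᵗ S g = det(g) S`. -/
theorem nilpotentOf_mulVec_mul (g : Matrix (Fin 2) (Fin 2) R) (w : Fin 2 → R) :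
    nilpotentOf (g.mulVec w) * g = g.det • (g * nilpotentOf w) := by
  ext i j
  fin_cases i <;> fin_cases j <;>
    simp [nilpotentOf, Matrix.mul_apply, Matrix.mulVec, dotProduct, Fin.sum_univ_two,
      Matrix.det_fin_two] <;> ring

/-- The unipotent matrices fixing `w`. -/
def unipotentOf (t : R) (w : Fin 2 → R) : GL (Fin 2) R where
  val := 1 + t • nilpotentOf w
  inv := 1 - t • nilpotentOf w
  val_inv := by
    simp [mul_sub, add_mul, nilpotentOf_mul_self]
  inv_val := by
    simp [mul_add, sub_mul, nilpotentOf_mul_self]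

theorem unipotentOf_smul (t c : R) (w : Fin 2 → R) :
    unipotentOf t (c • w) = unipotentOf (t * c ^ 2) w := by
  refine Units.ext ?_
  ext i j
  fin_cases i <;> fin_cases j <;> simp [unipotentOf, nilpotentOf] <;> ring

theorem map_unipotentOf {S : Type*} [CommRing S] (f : R →+* S) (t : R) (w : Fin 2 → R) :
    Matrix.GeneralLinearGroup.map f (unipotentOf t w) = unipotentOf (f t) (f ∘ w) := by
  refine Units.ext ?_
  ext i j
  fin_cases i <;> fin_cases j <;> simp [unipotentOf, nilpotentOf]

theorem conj_unipotentOf (g : GL (Fin 2) R) (t : R) (w : Fin 2 → R) :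
    g * unipotentOf (t * g.1.det) w * g⁻¹ = unipotentOf t (g.1.mulVec w) := by
  rw [mul_inv_eq_iff_eq_mul]
  refine Units.ext ?_
  change g.1 * (1 + (t * g.1.det) • nilpotentOf w) = (1 + t • nilpotentOf (g.1.mulVec w)) * g.1
  rw [mul_add, add_mul, mul_one, one_mul, smul_mul_assoc, nilpotentOf_mulVec_mul, smul_smul,
    mul_smul_comm]

end Unipotent

/-- A supercuspidal representation of `GL₂` of a finite field has no nonzero vector that is fixed by
all unipotent matrices fixing a given nonzero `w`. -/
theorem IsFiniteSupercuspidal.eq_zero_of_fixed [IsAlgClosed k] [Finite K]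
    {σ : Representation k (GL (Fin 2) K) V} (hσ : IsFiniteSupercuspidal σ) {w : Fin 2 → K}
    (hw : w ≠ 0) {v : V} (h : ∀ t : K, σ (unipotentOf t w) v = v) : v = 0 := by
  -- Conjugation by `g` reduces to the line of the first basis vector, whose unipotent matrices are
  -- the upper triangular ones.
  obtain ⟨g, rfl⟩ : ∃ g : GL (Fin 2) K, g.1.mulVec ![1, 0] = w := by
    by_cases h0 : w 0 = 0
    · have h1 : w 1 ≠ 0 := fun h1 => hw (by ext i; fin_cases i <;> simp [h0, h1])
      refine ⟨Matrix.GeneralLinearGroup.mkOfDetNeZero !![w 0, 1; w 1, 0] (by simp [h1]), ?_⟩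
      ext i
      fin_cases i <;> simp [Matrix.mulVec, dotProduct, Matrix.GeneralLinearGroup.mkOfDetNeZero]
    · refine ⟨Matrix.GeneralLinearGroup.mkOfDetNeZero !![w 0, 0; w 1, 1] (by simp [h0]), ?_⟩
      ext i
      fin_cases i <;> simp [Matrix.mulVec, dotProduct, Matrix.GeneralLinearGroup.mkOfDetNeZero]
  have hdet : g.1.det ≠ 0 := ((Matrix.isUnit_iff_isUnit_det g.1).mp g.isUnit).ne_zero
  have h1 : σ g⁻¹ v = 0 := by
    refine hσ.eq_zero_of_unipotent_fixed fun b => ?_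
    have e1 : upperTri 1 1 b = unipotentOf (b * g.1.det⁻¹ * g.1.det) ![1, 0] := by
      refine Units.ext ?_
      ext i j
      fin_cases i <;> fin_cases j <;> simp [upperTri, unipotentOf, nilpotentOf, hdet]
    have e2 : upperTri 1 1 b * g⁻¹ = g⁻¹ * unipotentOf (b * g.1.det⁻¹) (g.1.mulVec ![1, 0]) := by
      rw [← conj_unipotentOf, ← e1]
      group
    rw [← Module.End.mul_apply, ← map_mul, e2, map_mul, Module.End.mul_apply, h]
  have h2 := congrArg (σ g) h1
  rwa [← Module.End.mul_apply, ← map_mul, mul_inv_cancel, map_one, map_zero] at h2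

end FiniteGroup

/-! ### Bijectivity for types attached to simple strata -/

section Main

variable {F : Type u} [Field F] [ValuativeRel F] [TopologicalSpace F]
  [IsNonarchimedeanLocalField F] {k : Type v} [Field k] {J : Subgroup (GL (Fin 2) F)}
  {V : Type u} [AddCommGroup V] [Module k V]

/-- Compact induction is bijective on deformations of a twist of a representation `Λ'` of `J` if a
group `U_𝔄^m`, normal in `J`, acts by scalars on `Λ'` that are intertwined only by `J`. -/
theorem LatticeChain.cIndClasses_bijective_of_twist (p : ℕ) [Fact p.Prime] [CharP 𝓀[F] p]
    {l : ℕ} [Fact l.Prime] (hlp : l ≠ p) [CharP k l] {Λ Λ' : Representation k J V} {φ : Fˣ →* kˣ}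
    (hΛ : ∀ (j : J) (x : V),
      Λ j x = (φ (Matrix.GeneralLinearGroup.det (j : GL (Fin 2) F)) : k) • Λ' j x)
    {W : Type u} [AddCommGroup W] [Module k W] [Nontrivial W] {π : Representation k (GL (Fin 2) F) W}
    (θ : (cInd J Λ).Equiv π) {A : Type u} [CommRing A] [IsLocalRing A]
    [Algebra (WittVector l k) A] (hA : IsFiniteLength (WittVector l k) A)
    (L : LatticeChain F) {m : ℕ} (hm : 1 ≤ m) (hHJ : L.unitGroup m ≤ J)
    (hnorm : ∀ j ∈ J, ∀ h ∈ L.unitGroup m, j⁻¹ * h * j ∈ L.unitGroup m)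
    (hscal : ∀ h : L.unitGroup m, ∃ c : k, ∀ v : V, Λ' ⟨h, hHJ h.2⟩ v = c • v)
    (hint : ∀ g ∉ J, ∀ v : V, (∀ (h : L.unitGroup m) (hh : g * h * g⁻¹ ∈ J),
      Λ' ⟨_, hh⟩ v = Λ' ⟨h, hHJ h.2⟩ v) → v = 0) :
    ∃ hJ : IsOpen (J : Set (GL (Fin 2) F)), Function.Bijective
      (Deformation.cIndClasses hJ θ : Deformation.Classes l Λ A → Deformation.Classes l π A) := by
  refine ⟨Subgroup.isOpen_mono hHJ (L.isOpen_unitGroup m),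
    Deformation.cIndClasses_bijective _ θ hA.isNilpotent_maximalIdeal hHJ (L.isOpen_unitGroup m)
      hnorm (fun h => ?_) (fun g hg v hv => hint g hg v fun h hh => ?_) fun U => ?_⟩
  · obtain ⟨c, hc⟩ := hscal h
    exact ⟨_, fun v => by rw [hΛ, hc, smul_smul]⟩
  · have h1 := hv h hh
    -- The twist takes the same value on `h` and `g h g⁻¹`, so it cancels from the intertwining
    -- condition.
    have h2 : Matrix.GeneralLinearGroup.det (g * (h : GL (Fin 2) F) * g⁻¹) =
        Matrix.GeneralLinearGroup.det (h : GL (Fin 2) F) := by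
      rw [map_mul, map_mul, map_inv, mul_inv_cancel_comm]
    rw [hΛ, hΛ, h2] at h1
    exact smul_right_injective V (Units.ne_zero _) h1
  · have h1 := (WittVector.isUnit_natCast_of_coprime (k := k)
      (L.coprime_relIndex p l Fact.out hlp hm U)).map (algebraMap (WittVector l k) A)
    rwa [map_natCast] at h1

/-- Compact induction is bijective on deformations of representations of `Eˣ U_𝔄^{(n+1)/2}` that
restrict to a multiple of `ψ_α` on `U_𝔄^{n/2+1}`. -/
theorem LatticeChain.IsSimpleStratum.cIndClasses_bijective (p : ℕ) [Fact p.Prime]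
    [CharP 𝓀[F] p] {l : ℕ} [Fact l.Prime] (hlp : l ≠ p) [CharP k l]
    {Λ Λ' : Representation k J V} {φ : Fˣ →* kˣ}
    (hΛ : ∀ (j : J) (x : V),
      Λ j x = (φ (Matrix.GeneralLinearGroup.det (j : GL (Fin 2) F)) : k) • Λ' j x)
    {W : Type u} [AddCommGroup W] [Module k W] [Nontrivial W] {π : Representation k (GL (Fin 2) F) W}
    (θ : (cInd J Λ).Equiv π) {A : Type u} [CommRing A] [IsLocalRing A]
    [Algebra (WittVector l k) A] (hA : IsFiniteLength (WittVector l k) A)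
    {L : LatticeChain F} {n : ℕ} {α : Matrix (Fin 2) (Fin 2) F} (h : L.IsSimpleStratum n α)
    (hJ : J = unitsAdjoin α ⊔ L.unitGroup ((n + 1) / 2)) {ψ : AddChar F k} (hψ : IsLevelOne ψ)
    (hact : ActsByPsi ψ α (L.unitGroup (n / 2 + 1)) Λ') :
    ∃ hJ : IsOpen (J : Set (GL (Fin 2) F)), Function.Bijective
      (Deformation.cIndClasses hJ θ : Deformation.Classes l Λ A → Deformation.Classes l π A) := by
  have hHJ : L.unitGroup (n / 2 + 1) ≤ J := by
    rw [hJ]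
    exact (L.unitGroup_antitone (by lia)).trans le_sup_right
  have hnorm : ∀ j ∈ J, ∀ g ∈ L.unitGroup (n / 2 + 1), j⁻¹ * g * j ∈ L.unitGroup (n / 2 + 1) :=
    fun j hj g hg => h.conj_mem (hJ.le hj) hg
  refine L.cIndClasses_bijective_of_twist p hlp hΛ θ hA (Nat.le_add_left 1 _) hHJ hnorm
    (fun g => ⟨_, fun v => hact _ g.2 v⟩) fun g hg v hv => ?_
  by_contra hv0
  refine hg (hJ.ge (h.mem_of_intertwines hψ g fun u hu hu' => ?_))
  have h1 := hv ⟨u, hu⟩ (hHJ hu')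
  have h2 := (hact ⟨_, hHJ hu'⟩ hu' v).symm.trans (h1.trans (hact ⟨u, hHJ hu⟩ hu v))
  exact smul_left_injective k hv0 h2

end Main

/-! ### The group `Fˣ GL₂(𝒪)` and its congruence subgroup -/

section DepthZero

variable {F : Type u} [Field F] [ValuativeRel F] [TopologicalSpace F]
  [IsNonarchimedeanLocalField F]

section Lattice

omit [TopologicalSpace F] [IsNonarchimedeanLocalField F]

/-- The lattice `a 𝒪²`. -/
noncomputable def scaledLattice (a : F) : Submodule 𝒪[F] (Fin 2 → F) :=
  LinearMap.range ((LinearMap.toSpanSingleton F F a).restrictScalars 𝒪[F] ∘ₗ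
    Algebra.linearMap 𝒪[F] F |>.compLeft (Fin 2))

theorem mem_scaledLattice {a : F} {v : Fin 2 → F} :
    v ∈ scaledLattice a ↔ ∀ j, ∃ c : 𝒪[F], v j = a * c := by
  constructor
  · rintro ⟨c, rfl⟩ j
    exact ⟨c j, mul_comm _ _⟩
  · intro h
    choose c hc using h
    exact ⟨c, funext fun j => (mul_comm _ _).trans (hc j).symm⟩

theorem single_mem_scaledLattice (a : F) (j : Fin 2) : Pi.single j a ∈ scaledLattice a := by
  refine mem_scaledLattice.mpr fun i => ?_
  obtain rfl | h := eq_or_ne i j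
  · exact ⟨1, by simp⟩
  · exact ⟨0, by simp [h]⟩

end Lattice

/-- The chain of the lattices `ϖ^i 𝒪²`. -/
noncomputable def standardChain {ϖ : 𝒪[F]} (hϖ : Irreducible ϖ) : LatticeChain F where
  lattice i := scaledLattice ((ϖ : F) ^ i)
  fg i := by
    rw [scaledLattice, LinearMap.range_eq_map]
    exact Module.Finite.fg_top.map _
  span_eq_top i := by
    have h0 := zpow_ne_zero i (irreducible_coe_ne_zero hϖ)
    refine eq_top_iff.mpr fun v _ => ?_
    have e : v = ∑ j, (v j * ((ϖ : F) ^ i)⁻¹) • (Pi.single j ((ϖ : F) ^ i) : Fin 2 → F) := by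
      ext m
      fin_cases m <;> simp [Fin.sum_univ_two, h0]
    rw [e]
    exact Submodule.sum_mem _ fun j _ => Submodule.smul_mem _ _
      (Submodule.subset_span (single_mem_scaledLattice _ j))
  strictAnti := by
    have h0 := irreducible_coe_ne_zero hϖ
    refine strictAnti_int_of_succ_lt fun i => lt_of_le_of_ne (fun v hv => ?_) fun h => ?_
    · refine mem_scaledLattice.mpr fun j => ?_
      obtain ⟨c, hc⟩ := mem_scaledLattice.mp hv j
      exact ⟨ϖ * c, by rw [hc, zpow_add_one₀ h0]; push_cast; ring⟩
    · obtain ⟨c, hc⟩ := mem_scaledLattice.mp (h.ge (single_mem_scaledLattice _ 0)) 0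
      rw [Pi.single_eq_same, zpow_add_one₀ h0, mul_assoc, left_eq_mul₀ (zpow_ne_zero _ h0)] at hc
      exact hϖ.not_isUnit (IsUnit.of_mul_eq_one c (Subtype.ext hc))
  period := 1
  period_pos := one_pos
  lattice_add_period i := by
    have h0 := irreducible_coe_ne_zero hϖ
    ext v
    rw [hϖ.maximalIdeal_eq, Submodule.ideal_span_singleton_smul, mem_scaledLattice,
      Submodule.mem_smul_pointwise_iff_exists]
    constructor
    · intro h
      choose c hc using h
      refine ⟨fun j => (ϖ : F) ^ i * c j, mem_scaledLattice.mpr fun j => ⟨c j, rfl⟩, ?_⟩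
      ext j
      rw [hc, Nat.cast_one, zpow_add_one₀ h0, integer_smul_def, Pi.smul_apply, smul_eq_mul]
      ring
    · rintro ⟨w, hw, rfl⟩ j
      obtain ⟨c, hc⟩ := mem_scaledLattice.mp hw j
      refine ⟨c, ?_⟩
      rw [Nat.cast_one, zpow_add_one₀ h0, integer_smul_def, Pi.smul_apply, smul_eq_mul, hc]
      ring

theorem mem_radPow_standardChain {ϖ : 𝒪[F]} (hϖ : Irreducible ϖ)
    {x : Matrix (Fin 2) (Fin 2) F} :
    x ∈ (standardChain hϖ).radPow 1 ↔ ∀ i j, ∃ c : 𝒪[F], x i j = ϖ * c := by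
  have h0 := irreducible_coe_ne_zero hϖ
  constructor
  · intro hx i j
    have h1 := hx 0 _ (show Pi.single j 1 ∈ scaledLattice ((ϖ : F) ^ (0 : ℤ)) by
      rw [zpow_zero]; exact single_mem_scaledLattice 1 j)
    rw [Matrix.mulVec_single_one, zero_add] at h1
    obtain ⟨c, hc⟩ := mem_scaledLattice.mp h1 i
    exact ⟨c, by rw [zpow_one] at hc; exact hc⟩
  · intro h m v hv
    choose c hc using h
    choose d hd using mem_scaledLattice.mp hv
    refine mem_scaledLattice.mpr fun i => ⟨∑ j, c i j * d j, ?_⟩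
    rw [Matrix.mulVec, dotProduct, zpow_add_one₀ h0, Fin.sum_univ_two, Fin.sum_univ_two, hc, hc,
      hd, hd]
    push_cast
    ring

/-- The group `U^1` of the standard chain consists of the invertible integral matrices that reduce
to the identity. -/
theorem mem_unitGroup_standardChain {ϖ : 𝒪[F]} (hϖ : Irreducible ϖ) {g : GL (Fin 2) F} :
    g ∈ (standardChain hϖ).unitGroup 1 ↔ ∃ x : GL (Fin 2) 𝒪[F],
      Matrix.GeneralLinearGroup.map (algebraMap 𝒪[F] F) x = g ∧
        Matrix.GeneralLinearGroup.map (IsLocalRing.residue 𝒪[F]) x = 1 := by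
  have hres : IsLocalRing.residue 𝒪[F] ϖ = 0 :=
    (IsLocalRing.residue_eq_zero_iff _).mpr ((IsLocalRing.mem_maximalIdeal _).mpr hϖ.not_isUnit)
  rw [LatticeChain.mem_unitGroup_iff _ le_rfl, Nat.cast_one, mem_radPow_standardChain]
  constructor
  · intro h
    choose c hc using h
    let X : Matrix (Fin 2) (Fin 2) 𝒪[F] := 1 + ϖ • Matrix.of c
    have hX : X.map (IsLocalRing.residue 𝒪[F]) = 1 := by
      ext i j
      fin_cases i <;> fin_cases j <;> simp [X, hres]
    have hdet : IsUnit X.det := by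
      rw [← IsLocalRing.residue_ne_zero_iff_isUnit, RingHom.map_det, RingHom.mapMatrix_apply, hX,
        Matrix.det_one]
      exact one_ne_zero
    refine ⟨Matrix.GeneralLinearGroup.mk'' X hdet, Units.ext ?_, Units.ext hX⟩
    ext i j
    change algebraMap 𝒪[F] F (X i j) = g.1 i j
    have h1 := hc i j
    rw [Matrix.sub_apply, sub_eq_iff_eq_add'] at h1
    rw [h1]
    fin_cases i <;> fin_cases j <;> simp [X] <;> rfl
  · rintro ⟨x, rfl, hx⟩ i j
    have h1 : IsLocalRing.residue 𝒪[F] (x.1 i j - (1 : Matrix (Fin 2) (Fin 2) 𝒪[F]) i j) = 0 := by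
      have h2 := congrArg (fun y : GL (Fin 2) 𝓀[F] => y.1 i j) hx
      rw [map_sub]
      refine sub_eq_zero.mpr (h2.trans ?_)
      fin_cases i <;> fin_cases j <;> simp
    rw [IsLocalRing.residue_eq_zero_iff, hϖ.maximalIdeal_eq, Ideal.mem_span_singleton] at h1
    obtain ⟨c, hc⟩ := h1
    refine ⟨c, ?_⟩
    have h3 := congrArg (algebraMap 𝒪[F] F) hc
    rw [map_sub, map_mul] at h3
    refine Eq.trans ?_ h3
    fin_cases i <;> fin_cases j <;> simp

theorem unitGroup_standardChain_le {ϖ : 𝒪[F]} (hϖ : Irreducible ϖ) :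
    (standardChain hϖ).unitGroup 1 ≤ centerMulGLInteger := by
  intro g hg
  obtain ⟨x, rfl, -⟩ := (mem_unitGroup_standardChain hϖ).mp hg
  exact Subgroup.mem_sup_right ⟨x, rfl⟩

theorem conj_mem_unitGroup_standardChain {ϖ : 𝒪[F]} (hϖ : Irreducible ϖ) {j g : GL (Fin 2) F}
    (hj : j ∈ centerMulGLInteger) (hg : g ∈ (standardChain hϖ).unitGroup 1) :
    j⁻¹ * g * j ∈ (standardChain hϖ).unitGroup 1 := by
  have key : ∀ x : GL (Fin 2) 𝒪[F], ∀ g ∈ (standardChain hϖ).unitGroup 1,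
      Matrix.GeneralLinearGroup.map (algebraMap 𝒪[F] F) x⁻¹ * g *
        Matrix.GeneralLinearGroup.map (algebraMap 𝒪[F] F) x ∈
          (standardChain hϖ).unitGroup 1 := by
    intro x g hg
    obtain ⟨y, rfl, hy⟩ := (mem_unitGroup_standardChain hϖ).mp hg
    refine (mem_unitGroup_standardChain hϖ).mpr ⟨x⁻¹ * y * x, by rw [map_mul, map_mul], ?_⟩
    rw [map_mul, map_mul, hy, mul_one, ← map_mul, inv_mul_cancel, map_one]
  have hle : (centerMulGLInteger : Subgroup (GL (Fin 2) F)) ≤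
      Subgroup.normalizer ((standardChain hϖ).unitGroup 1) := by
    refine sup_le (Subgroup.center_le_normalizer _) ?_
    rintro _ ⟨x, rfl⟩
    rw [Subgroup.mem_normalizer_iff'']
    intro g
    refine ⟨fun h => ?_, fun h => ?_⟩
    · have := key x g h
      rwa [map_inv] at this
    · have := key x⁻¹ _ h
      rw [inv_inv, map_inv] at this
      convert this using 1
      group
  exact (Subgroup.mem_normalizer_iff''.mp (hle hj) g).mp hg

/-- An element of `GL₂(F)` outside `Fˣ GL₂(𝒪)` is a multiple of an integral matrix with an entry one
and with determinant in the maximal ideal. -/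
theorem exists_eq_smul_of_notMem_centerMulGLInteger {g : GL (Fin 2) F}
    (hg : g ∉ centerMulGLInteger) :
    ∃ (s : F) (X : Matrix (Fin 2) (Fin 2) 𝒪[F]) (i j : Fin 2), s ≠ 0 ∧
      g.1 = s • X.map (algebraMap 𝒪[F] F) ∧ X i j = 1 ∧ X.det ∈ 𝓂[F] := by
  -- Dividing by an entry of maximal valuation makes the matrix integral; were its determinant a
  -- unit, `g` would lie in `Fˣ GL₂(𝒪)`.
  obtain ⟨⟨i, j⟩, hij⟩ := Finite.exists_max fun x : Fin 2 × Fin 2 => valuation F (g.1 x.1 x.2)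
  have hs : g.1 i j ≠ 0 := by
    intro h0
    refine g.ne_zero (Matrix.ext fun i' j' => ?_)
    have h1 := hij (i', j')
    simp only [h0, map_zero, le_zero_iff, map_eq_zero] at h1
    exact h1
  have hint : ∀ i' j', (g.1 i j)⁻¹ * g.1 i' j' ∈ 𝒪[F] := fun i' j' => by
    rw [Valuation.mem_integer_iff, map_mul, map_inv₀]
    exact inv_mul_le_one_of_le₀ (hij (i', j')) zero_le
  let X : Matrix (Fin 2) (Fin 2) 𝒪[F] := Matrix.of fun i' j' => ⟨_, hint i' j'⟩
  have hgX : g.1 = g.1 i j • X.map (algebraMap 𝒪[F] F) := by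
    ext i' j'
    exact (mul_inv_cancel_left₀ hs _).symm
  refine ⟨g.1 i j, X, i, j, hs, hgX, Subtype.ext (inv_mul_cancel₀ hs), ?_⟩
  by_contra hdet
  refine hg ?_
  rw [IsLocalRing.mem_maximalIdeal, mem_nonunits_iff, not_not] at hdet
  have e : g = Matrix.GeneralLinearGroup.scalar (Fin 2) (Units.mk0 _ hs) *
      Matrix.GeneralLinearGroup.map (algebraMap 𝒪[F] F)
        (Matrix.GeneralLinearGroup.mk'' X hdet) := by
    refine Units.ext (hgX.trans ?_)
    ext i' j'
    simp
  rw [e]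
  refine Subgroup.mul_mem_sup ?_ ⟨_, rfl⟩
  rw [Matrix.GeneralLinearGroup.center_eq_range_scalar]
  exact ⟨_, rfl⟩

end DepthZero

/-! ### Bijectivity for depth zero types -/

section DepthZeroType

variable {F : Type u} [Field F] [ValuativeRel F] [TopologicalSpace F]
  [IsNonarchimedeanLocalField F] {k : Type v} [Field k] {J : Subgroup (GL (Fin 2) F)}
  {V : Type u} [AddCommGroup V] [Module k V]

/-- Conjugation by an element outside `Fˣ GL₂(𝒪)` maps part of the congruence subgroup onto integral
matrices that reduce to all unipotent matrices fixing some nonzero vector. -/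
theorem exists_conj_unipotentOf {ϖ : 𝒪[F]} (hϖ : Irreducible ϖ) {g : GL (Fin 2) F}
    (hg : g ∉ centerMulGLInteger) :
    ∃ w : Fin 2 → 𝒪[F], IsLocalRing.residue 𝒪[F] ∘ w ≠ 0 ∧
      ∀ t : 𝒪[F], ∃ u ∈ (standardChain hϖ).unitGroup 1,
        g * u * g⁻¹ = Matrix.GeneralLinearGroup.map (algebraMap 𝒪[F] F) (unipotentOf t w) := by
  obtain ⟨s, X, i, j, hs, hgX, hX1, hdet⟩ := exists_eq_smul_of_notMem_centerMulGLInteger hg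
  -- Here `w` is the column of `X` containing the entry `1`. The parameter `t det(X)` lies in `𝔪`,
  -- so the unipotent matrix before conjugation reduces to the identity.
  refine ⟨X.mulVec (Pi.single j 1), fun h => ?_, fun t =>
    ⟨Matrix.GeneralLinearGroup.map (algebraMap 𝒪[F] F) (unipotentOf (t * X.det) (Pi.single j 1)),
      (mem_unitGroup_standardChain hϖ).mpr ⟨_, rfl, ?_⟩, ?_⟩⟩
  · have h1 := congrFun h i
    rw [Matrix.mulVec_single_one, Function.comp_apply, Matrix.col_apply, hX1, map_one] at h1
    exact one_ne_zero h1
  · rw [map_unipotentOf, map_mul, (IsLocalRing.residue_eq_zero_iff _).mpr hdet, mul_zero]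
    refine Units.ext ?_
    change 1 + (0 : 𝓀[F]) • nilpotentOf _ = 1
    rw [zero_smul, add_zero]
  · have h1 : (algebraMap 𝒪[F] F) ∘ (Pi.single j 1 : Fin 2 → 𝒪[F]) = Pi.single j 1 := by
      ext m
      by_cases hm : m = j
      · subst hm
        simp
      · simp [hm]
    have h2 : (algebraMap 𝒪[F] F) ∘ X.mulVec (Pi.single j 1) =
        s⁻¹ • g.1.mulVec (Pi.single j 1) := by
      rw [hgX, Matrix.smul_mulVec, inv_smul_smul₀ hs, ← h1]
      ext m
      exact RingHom.map_mulVec _ _ _ _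
    -- The scalar `s` cancels: `det(g) = s² det(X)`, and `unipotentOf` is quadratic in its vector.
    have h3 : algebraMap 𝒪[F] F (t * X.det) = algebraMap 𝒪[F] F t * s⁻¹ ^ 2 * g.1.det := by
      rw [hgX, Matrix.det_smul, map_mul, RingHom.map_det, RingHom.mapMatrix_apply, Fintype.card_fin]
      field_simp
    rw [map_unipotentOf, map_unipotentOf, h1, h2, h3, conj_unipotentOf, unipotentOf_smul]

/-- Compact induction is bijective on deformations of representations of `Fˣ GL₂(𝒪)` inflated from
supercuspidal representations. -/
theorem IsDepthZeroType.cIndClasses_bijective [IsAlgClosed k] (p : ℕ) [Fact p.Prime]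
    [CharP 𝓀[F] p] {l : ℕ} [Fact l.Prime] (hlp : l ≠ p) [CharP k l]
    {Λ Λ' : Representation k J V} {φ : Fˣ →* kˣ}
    (hΛ : ∀ (j : J) (x : V),
      Λ j x = (φ (Matrix.GeneralLinearGroup.det (j : GL (Fin 2) F)) : k) • Λ' j x)
    {W : Type u} [AddCommGroup W] [Module k W] [Nontrivial W] {π : Representation k (GL (Fin 2) F) W}
    (θ : (cInd J Λ).Equiv π) {A : Type u} [CommRing A] [IsLocalRing A]
    [Algebra (WittVector l k) A] (hA : IsFiniteLength (WittVector l k) A)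
    (h : IsDepthZeroType Λ') :
    ∃ hJ : IsOpen (J : Set (GL (Fin 2) F)), Function.Bijective
      (Deformation.cIndClasses hJ θ : Deformation.Classes l Λ A → Deformation.Classes l π A) := by
  obtain ⟨rfl, σ, hσ, hΛ'⟩ := h
  obtain ⟨ϖ, hϖ⟩ := IsDiscreteValuationRing.exists_irreducible 𝒪[F]
  have hH := unitGroup_standardChain_le hϖ
  have hfix : ∀ u (hu : u ∈ (standardChain hϖ).unitGroup 1) (v : V), Λ' ⟨u, hH hu⟩ v = v := by
    intro u hu v
    obtain ⟨x, rfl, hx⟩ := (mem_unitGroup_standardChain hϖ).mp hu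
    rw [hΛ', hx, map_one, Module.End.one_apply]
  refine (standardChain hϖ).cIndClasses_bijective_of_twist p hlp hΛ θ hA le_rfl hH
    (fun j hj g hg => conj_mem_unitGroup_standardChain hϖ hj hg)
    (fun g => ⟨1, fun v => by rw [hfix _ g.2, one_smul]⟩) fun g hg v hv => ?_
  obtain ⟨w, hw, hconj⟩ := exists_conj_unipotentOf hϖ hg
  -- As `U^1` acts trivially under `Λ'`, an intertwined vector is fixed by the conjugates in
  -- `GL₂(𝒪)`, in particular by unipotents covering all those over the residue field that fix the
  -- reduction of `w`.
  refine hσ.eq_zero_of_fixed hw fun t => ?_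
  obtain ⟨t, rfl⟩ := IsLocalRing.residue_surjective t
  obtain ⟨u, hu, hgu⟩ := hconj t
  have hmem : g * u * g⁻¹ ∈ (centerMulGLInteger : Subgroup (GL (Fin 2) F)) := by
    rw [hgu]
    exact Subgroup.mem_sup_right ⟨_, rfl⟩
  have h1 := hv ⟨u, hu⟩ hmem
  rw [hfix u hu] at h1
  have h2 : (⟨g * u * g⁻¹, hmem⟩ : (centerMulGLInteger : Subgroup (GL (Fin 2) F))) =
      ⟨_, hgu ▸ hmem⟩ := Subtype.ext hgu
  change Λ' ⟨g * u * g⁻¹, hmem⟩ v = v at h1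
  rwa [h2, hΛ', map_unipotentOf] at h1

end DepthZeroType

theorem mainTheorem3
    {F : Type u} [Field F] [ValuativeRel F] [TopologicalSpace F] [IsNonarchimedeanLocalField F]
    [CharZero F] (p : ℕ) [Fact p.Prime] [CharP 𝓀[F] p]
    (l : ℕ) [Fact l.Prime] (hlp : l ≠ p)
    {k : Type v} [Field k] [Algebra (ZMod l) k] [IsAlgClosure (ZMod l) k]
    (ψ : AddChar F k) (hψ : IsLevelOne ψ)
    (J : Subgroup (GL (Fin 2) F))
    {V : Type u} [AddCommGroup V] [Module k V] (Λ : Representation k J V)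
    (hΛ : IsTwistedType ψ Λ)
    {W : Type u} [AddCommGroup W] [Module k W] (π : Representation k (GL (Fin 2) F) W)
    (hπ : IsSupercuspidal π) (θ : (cInd J Λ).Equiv π)
    {A : Type u} [CommRing A] [IsLocalRing A] [Algebra (WittVector l k) A]
    (hA : IsFiniteLength (WittVector l k) A) :
    ∃ hJ : IsOpen (J : Set (GL (Fin 2) F)),
      Function.Bijective
        (Deformation.cIndClasses hJ θ :
          Deformation.Classes l Λ A → Deformation.Classes l π A) := by
  have : IsAlgClosed k := IsAlgClosure.isAlgClosed (ZMod l)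
  have : CharP k l := charP_of_injective_algebraMap (algebraMap (ZMod l) k).injective l
  have : Nontrivial W := by
    by_contra hW
    rw [not_nontrivial_iff_subsingleton] at hW
    exact hπ.1.bot_ne_top (Subrepresentation.toSubmodule_injective (Subsingleton.elim _ _))
  -- Both parities of `n` fit `J = Eˣ U^{[(n+1)/2]}` with `ψ_α` on `U^{[n/2]+1}`: the two exponents
  -- agree for odd `n`, and `[(n+1)/2] = n/2` for even `n`.
  obtain ⟨φ, Λ', -, hΛ', h | ⟨L, n, α, h, hn, hJ, -, hact⟩ | ⟨L, n, α, h, hn, hJ, -, hact⟩⟩ := hΛ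
  · exact h.cIndClasses_bijective p hlp hΛ' θ hA
  · refine h.cIndClasses_bijective p hlp hΛ' θ hA hJ hψ ?_
    rwa [show n / 2 + 1 = (n + 1) / 2 by obtain ⟨m, rfl⟩ := hn; lia]
  · refine h.cIndClasses_bijective p hlp hΛ' θ hA ?_ hψ hact
    rwa [show (n + 1) / 2 = n / 2 by obtain ⟨m, rfl⟩ := hn; lia]
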